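/- A 6-dimensional nilmanifold is a compact quotient $M=\Gamma\backslash G$, where $G$ is a connected nilpotent Lie group of dimension 6 and $\Gamma$ is a discrete subgroup of $G$; it corresponds to the Lie algebra $\mathfrak g$ if the Lie algebra of $G$ is isomorphic to $\mathfrak g$. An $\mathrm{SU}(3)$-structure on $M$ is a pair $(\omega,\Psi)$ consisting of a smooth non-degenerate real two-form $\omega$ and a smooth complex three-form $\Psi$ which at each point is decomposable, $\Psi=\theta^1\wedge\theta^2\wedge\theta^3$, such that $$\Psi\wedge\omega=0,\qquad \Psi\wedge\overline\Psi=\tfrac43\,i\,\omega^3,$$ and such that the almost-complex structure $J$ determined by $\theta^k\circ J=i\,\theta^k$ $(k=1,2,3)$ makes the bilinear form $\omega(J\cdot,\cdot)$ positive definite. It is half-flat if $\omega\wedge\omega$ and $\psi^+=\operatorname{Re}\Psi$ are closed, symplectic if $\omega$ is closed, and invariant if the pullbacks of $\omega$ and $\Psi$ to $G$ are left-invariant. An expression such as $\mathfrak g=(0,0,0,0,12,13)$ means that $\mathfrak g^*$ has a basis $\eta^1,\dots,\eta^6$ with $d\eta^1=\dots=d\eta^4=0$, $d\eta^5=\eta^1\wedge\eta^2$,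 $d\eta^6=\eta^1\wedge\eta^3$, where $d\alpha(x,y)=-\alpha([x,y])$; similarly for the other expressions. **Theorem.** Let $\mathfrak g$ be a 6-dimensional real nilpotent Lie algebra. Then there is a nilmanifold corresponding to $\mathfrak g$ that carries an invariant symplectic half-flat $\mathrm{SU}(3)$-structure if and only if $\mathfrak g$ is one of $$(0,0,0,0,0,0),\qquad (0,0,0,0,12,13),\qquad (0,0,0,12,13,23).$$ Moreover, this does not depend on the choice of the nilmanifold: for every nilmanifold $M$ corresponding to $\mathfrak g$, $M$ carries an invariant symplectic half-flat $\mathrm{SU}(3)$-structure if and only if $\mathfrak g$ is one of these three Lie algebras. -/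

import Mathlib

universe u v

noncomputable section

open scoped Manifold

namespace SHF

/-! ### Exterior algebra of a real vector space -/

section Wedge

variable {V A : Type*} [AddCommGroup V] [Module ℝ V] [TopologicalSpace V]
  [CommRing A] [Algebra ℝ A] [TopologicalSpace A]

/-- The wedge product of alternating forms with values in a commutative algebra `A`, without the
continuity: the sum over shuffles of `sign σ * α (v ∘ σ) * β (v ∘ σ)`. -/
def algWedge {k l : ℕ} (α : V [⋀^Fin k]→ₗ[ℝ] A) (β : V [⋀^Fin l]→ₗ[ℝ] A) :
    V [⋀^Fin (k + l)]→ₗ[ℝ] A :=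
  ((LinearMap.mul' ℝ A).compAlternatingMap (α.domCoprod β)).domDomCongr finSumFinEquiv

variable [IsTopologicalRing A]

theorem continuous_algWedge {k l : ℕ} (α : V [⋀^Fin k]→L[ℝ] A) (β : V [⋀^Fin l]→L[ℝ] A) :
    Continuous (algWedge α.toAlternatingMap β.toAlternatingMap) := by
  have key : ∀ σ : Equiv.Perm.ModSumCongr (Fin k) (Fin l),
      Continuous fun v : Fin (k + l) → V => LinearMap.mul' ℝ A
        (AlternatingMap.domCoprod.summand α.toAlternatingMap β.toAlternatingMap σ
          fun i => v (finSumFinEquiv i)) := by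
    intro σ
    induction σ using Quotient.inductionOn' with
    | h σ =>
      simp only [AlternatingMap.domCoprod.summand_mk'', smul_apply,
        MultilinearMap.domDomCongr_apply, MultilinearMap.domCoprod_apply]
      have h1 : Continuous fun v : Fin (k + l) → V =>
          α (fun i => v (finSumFinEquiv (σ (Sum.inl i)))) *
            β (fun i => v (finSumFinEquiv (σ (Sum.inr i)))) :=
        (α.cont.comp (continuous_pi fun i => continuous_apply _)).mul
          (β.cont.comp (continuous_pi fun i => continuous_apply _))
      rcases Int.units_eq_one_or (Equiv.Perm.sign σ) with h | h
      · simpa [h] using h1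
      · have h3 := h1.neg
        simp only [h, Units.neg_smul, one_smul, map_neg]
        exact h3
  have h2 := continuous_finsetSum Finset.univ fun σ _ => key σ
  refine h2.congr fun v => ?_
  simp [algWedge, AlternatingMap.domCoprod, map_sum, Function.comp_def]

/-- The wedge product of continuous alternating forms. -/
def wedge {k l : ℕ} (α : V [⋀^Fin k]→L[ℝ] A) (β : V [⋀^Fin l]→L[ℝ] A) :
    V [⋀^Fin (k + l)]→L[ℝ] A :=
  { algWedge α.toAlternatingMap β.toAlternatingMap with
    cont := continuous_algWedge α β }

end Wedge

/-! ### `SU(3)`-structures on a real vector space -/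

section SU3

variable {V : Type*} [AddCommGroup V] [Module ℝ V] [TopologicalSpace V]

/-- A real form viewed as a complex one. -/
def toComplex {k : ℕ} (α : V [⋀^Fin k]→L[ℝ] ℝ) : V [⋀^Fin k]→L[ℝ] ℂ :=
  Complex.ofRealCLM.compContinuousAlternatingMap α

/-- The real part of a complex form. -/
def rePart {k : ℕ} (α : V [⋀^Fin k]→L[ℝ] ℂ) : V [⋀^Fin k]→L[ℝ] ℝ :=
  Complex.reCLM.compContinuousAlternatingMap α

/-- The complex conjugate of a complex form. -/
def conjForm {k : ℕ} (α : V [⋀^Fin k]→L[ℝ] ℂ) : V [⋀^Fin k]→L[ℝ] ℂ :=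
  (Complex.conjCLE : ℂ →L[ℝ] ℂ).compContinuousAlternatingMap α

/-- `(ω, Ψ)` is a (linear) `SU(3)`-structure: `ω` is non-degenerate, `Ψ` is a decomposable complex
three-form `θ₀ ∧ θ₁ ∧ θ₂`, `Ψ ∧ ω = 0`, `Ψ ∧ Ψ̄ = (4/3) i ω³`, and the almost-complex structure `J`
whose `(1,0)`-forms are spanned by the `θ`'s is tamed by `ω`: the bilinear form `ω (J ·, ·)`
is positive definite. -/
structure IsSU3 (ω : V [⋀^Fin 2]→L[ℝ] ℝ) (Ψ : V [⋀^Fin 3]→L[ℝ] ℂ) : Prop where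
  nondegenerate : ∀ v : V, (∀ w : V, ω ![v, w] = 0) → v = 0
  decomposable_tamed : ∃ θ : Fin 3 → V →L[ℝ] ℂ,
    (∀ v : Fin 3 → V, Ψ v = Matrix.det (Matrix.of fun i j => θ i (v j))) ∧
    ∃ J : V →ₗ[ℝ] V, (∀ i v, θ i (J v) = Complex.I * θ i v) ∧ ∀ v, v ≠ 0 → 0 < ω ![J v, v]
  wedge_eq_zero : wedge Ψ (toComplex ω) = 0
  volume : ∀ v : Fin 6 → V,
    wedge Ψ (conjForm Ψ) v = (4 / 3 : ℂ) * Complex.I * (wedge (wedge ω ω) ω v : ℝ)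

end SU3

/-! ### Differential forms on six-dimensional manifolds -/

/-- The model space of six-dimensional manifolds. -/
abbrev E6 : Type := EuclideanSpace ℝ (Fin 6)

section Forms

variable {M : Type*} [TopologicalSpace M] [ChartedSpace E6 M]
  {M' : Type*} [TopologicalSpace M'] [ChartedSpace E6 M']
  {F : Type*} [NormedAddCommGroup F] [NormedSpace ℝ F]

variable (M F) in
/-- (Not necessarily smooth) differential `k`-forms on `M` with values in `F`. -/
abbrev DForm (k : ℕ) : Type _ := ∀ x : M, TangentSpace (𝓡 6) x [⋀^Fin k]→L[ℝ] F

/-- The pullback of a differential form along a map. -/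
def pullback {k : ℕ} (f : M → M') (α : DForm M' F k) : DForm M F k :=
  fun x => (α (f x)).compContinuousLinearMap (mfderiv (𝓡 6) (𝓡 6) f x)

/-- The expression of a differential form in the preferred chart at `x₀`, i.e. its pullback along
the inverse of that chart. It is meaningful on the target of the chart. -/
def inChart {k : ℕ} (α : DForm M F k) (x₀ : M) : E6 → E6 [⋀^Fin k]→L[ℝ] F :=
  fun y => (α ((extChartAt (𝓡 6) x₀).symm y)).compContinuousLinearMap
    (mfderiv 𝓘(ℝ, E6) (𝓡 6) (extChartAt (𝓡 6) x₀).symm y)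

/-- A differential form is smooth if its expressions in charts are. -/
def IsSmoothForm {k : ℕ} (α : DForm M F k) : Prop :=
  ∀ x₀ : M, ContDiffOn ℝ ((⊤ : ℕ∞) : WithTop ℕ∞) (inChart α x₀) (extChartAt (𝓡 6) x₀).target

/-- The exterior derivative of a differential form, at `x` computed in the preferred chart
at `x`. -/
def extD {k : ℕ} (α : DForm M F k) : DForm M F (k + 1) :=
  fun x => (extDeriv (inChart α x) (extChartAt (𝓡 6) x x)).compContinuousLinearMap
    (mfderiv (𝓡 6) 𝓘(ℝ, E6) (extChartAt (𝓡 6) x) x)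

/-- Closed differential forms. -/
def IsClosedForm {k : ℕ} (α : DForm M F k) : Prop := ∀ x : M, extD α x = 0

/-- `(ω, Ψ)` is an `SU(3)`-structure on the six-dimensional manifold `M`. -/
structure IsSU3Structure (ω : DForm M ℝ 2) (Ψ : DForm M ℂ 3) : Prop where
  smooth_omega : IsSmoothForm ω
  smooth_psi : IsSmoothForm Ψ
  isSU3 : ∀ x : M, IsSU3 (ω x) (Ψ x)

/-- The half-flat condition: `ω ∧ ω` and `ψ⁺ = Re Ψ` are closed. -/
structure IsHalfFlat (ω : DForm M ℝ 2) (Ψ : DForm M ℂ 3) : Prop where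
  closed_omega_sq : IsClosedForm (F := ℝ) (k := 2 + 2) fun x : M => wedge (ω x) (ω x)
  closed_psi_plus : IsClosedForm fun x : M => rePart (Ψ x)

/-- The symplectic condition: the non-degenerate form `ω` is closed. -/
def IsSymplectic (ω : DForm M ℝ 2) : Prop := IsClosedForm ω

/-- Left-invariant differential forms on a Lie group. -/
def IsLeftInvariant {G : Type*} [TopologicalSpace G] [ChartedSpace E6 G] [Group G] {k : ℕ}
    (α : DForm G F k) : Prop :=
  ∀ g : G, pullback (fun h : G => g * h) α = α

end Forms

/-! ### Nilmanifolds -/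

/-- Six-dimensional nilmanifolds: a connected nilpotent Lie group `G` of dimension six together
with a discrete subgroup `Γ` such that `Γ \ G` is compact. -/
structure Nilmanifold where
  G : Type u
  [group : Group G]
  [topologicalSpace : TopologicalSpace G]
  [t2Space : T2Space G]
  [chartedSpace : ChartedSpace E6 G]
  [lieGroup : LieGroup (𝓡 6) ((⊤ : ℕ∞) : WithTop ℕ∞) G]
  [connectedSpace : ConnectedSpace G]
  [isNilpotent : Group.IsNilpotent G]
  Γ : Subgroup G
  [discreteTopology : DiscreteTopology Γ]
  compactSpace : CompactSpace (MulAction.orbitRel.Quotient Γ G)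

namespace Nilmanifold

attribute [instance] group topologicalSpace t2Space chartedSpace lieGroup connectedSpace
  isNilpotent discreteTopology compactSpace

variable (N : Nilmanifold.{u})

instance : IsTopologicalGroup N.G := topologicalGroup_of_lieGroup (𝓡 6) ((⊤ : ℕ∞) : WithTop ℕ∞)

instance : LocallyCompactSpace N.G := ChartedSpace.locallyCompactSpace E6 N.G

instance : LieGroup (𝓡 6) (minSmoothness ℝ 3) N.G :=
  LieGroup.of_le (n := ((⊤ : ℕ∞) : WithTop ℕ∞)) (by
    rw [minSmoothness_of_isRCLikeNormedField]
    exact ENat.LEInfty.out)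

instance : ProperlyDiscontinuousSMul N.Γ N.G :=
  N.Γ.properlyDiscontinuousSMul_of_tendsto_cofinite
    (Subgroup.tendsto_coe_cofinite_of_discrete N.Γ
      (isDiscrete_iff_discreteTopology.mpr N.discreteTopology))

/-- The nilmanifold `Γ \ G` itself, the space of orbits of `Γ` acting on `G` by left
multiplication, with the quotient topology and with the charts obtained by composing local inverses
of the projection `G → Γ \ G` with the charts of `G`. -/
abbrev space : Type u := MulAction.orbitRel.Quotient N.Γ N.G

/-- The projection `G → Γ \ G`. -/
def proj : N.G → N.space := Quotient.mk _

/-- A differential form on `Γ \ G` is invariant if its pullback to `G` is left-invariant. -/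
def IsInvariant {F : Type*} [NormedAddCommGroup F] [NormedSpace ℝ F] {k : ℕ}
    (α : DForm N.space F k) : Prop :=
  IsLeftInvariant (pullback N.proj α)

/-- The nilmanifold carries an invariant symplectic half-flat `SU(3)`-structure. -/
def CarriesInvariantSymplecticHalfFlat : Prop :=
  ∃ (ω : DForm N.space ℝ 2) (Ψ : DForm N.space ℂ 3),
    IsSU3Structure ω Ψ ∧ IsSymplectic ω ∧ IsHalfFlat ω Ψ ∧ N.IsInvariant ω ∧ N.IsInvariant Ψ

/-- The nilmanifold corresponds to the Lie algebra `𝔤`: the Lie algebra of `G` is isomorphic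
to `𝔤`. -/
def CorrespondsTo (𝔤 : Type*) [LieRing 𝔤] [LieAlgebra ℝ 𝔤] : Prop :=
  Nonempty (GroupLieAlgebra (𝓡 6) N.G ≃ₗ⁅ℝ⁆ 𝔤)

end Nilmanifold

/-! ### Symbolic expressions for Lie algebras -/

section Symbolic

variable {𝔤 : Type*} [LieRing 𝔤] [LieAlgebra ℝ 𝔤]

/-- The (Chevalley-Eilenberg) differential of a one-form on a Lie algebra, as a function of two
arguments: `dα (x, y) = - α [x, y]`. -/
def dOne (α : Module.Dual ℝ 𝔤) : 𝔤 → 𝔤 → ℝ := fun x y => -α ⁅x, y⁆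

/-- The wedge product of two one-forms, as a function of two arguments. -/
def wedgeOne (α β : Module.Dual ℝ 𝔤) : 𝔤 → 𝔤 → ℝ := fun x y => α x * β y - α y * β x

variable (𝔤)

/-- `𝔤 = (0,0,0,0,0,0)`. -/
def Is000000 : Prop :=
  ∃ η : Module.Basis (Fin 6) ℝ (Module.Dual ℝ 𝔤), (fun i => dOne (η i)) = ![0, 0, 0, 0, 0, 0]

/-- `𝔤 = (0,0,0,0,12,13)`. -/
def Is00001213 : Prop :=
  ∃ η : Module.Basis (Fin 6) ℝ (Module.Dual ℝ 𝔤),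
    (fun i => dOne (η i)) = ![0, 0, 0, 0, wedgeOne (η 0) (η 1), wedgeOne (η 0) (η 2)]

/-- `𝔤 = (0,0,0,12,13,23)`. -/
def Is000121323 : Prop :=
  ∃ η : Module.Basis (Fin 6) ℝ (Module.Dual ℝ 𝔤),
    (fun i => dOne (η i)) = ![0, 0, 0, wedgeOne (η 0) (η 1), wedgeOne (η 0) (η 2), wedgeOne (η 1) (η 2)]

end Symbolic

end SHF

end

/-! ### The projection `G → Γ \ G` in charts. -/

noncomputable section
open scoped Manifold ContDiff Topology
open MulAction
namespace SHF.Nilmanifold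
variable (N : Nilmanifold.{u})

/-! Invariant forms on `Γ \ G` are the same as alternating forms on the Lie algebra, and their
exterior derivative becomes the Chevalley-Eilenberg differential (`IsInvariant.isClosedForm_iff`).
Since `dω = 0` gives `d(ω ∧ ω) = 0`, the question is whether the Lie algebra carries a linear
`SU(3)`-structure with `ω` and `Re Ψ` closed (`carriesInvariantSymplecticHalfFlat_iff`). It does not
involve `Γ`, which explains the independence of the nilmanifold.

Necessity. Choose a central `X ≠ 0`. Closedness of `ω` makes `ω(X, ·)` vanish on commutators, and
nilpotency then yields a `Z`, independent of `X`, with `ω(X, Z) = 0` and `[y, Z] ∈ ℝX` for all `y`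
(`exists_lie_mem_span`). As `ω(X, Z) = 0`, there is a unitary basis `b₀, …, b₅` with `b₀ ∈ ℝX` and
`b₂ ∈ ⟨X, Z⟩`, in which `ω` is standard and `Ψ` is a real multiple of the standard form
(`IsSU3.exists_adapted_basis`). Closedness is now a linear system for the structure constants, which
leaves ten parameters (`structureConstants_of_closed`). The Jacobi identity kills two of them and
relates the others (`jacobi_relations`); a single parameter `r` separates two cases. If `r ≠ 0`, the
algebra is `(0,0,0,0,12,13)`. If `r = 0`, it is two-step with bracket `ℝ³ × ℝ³ → ℝ³`, `(x, y) ↦ S (x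
× y)`, for a symmetric trace-free matrix `S`; an orthonormal eigenbasis of `S` diagonalises the
bracket (`exists_hasDiag_of_symmetric`).

In both cases the algebra is diagonal in the sense of `HasDiag`, with coefficients of sum zero.
Rescaling the central basis vectors shows that only the set of non-zero coefficients matters, and
sum zero forbids exactly one non-zero coefficient. So zero, two or three of them are non-zero, which
gives the three algebras of the theorem (`exists_hasDiag_iff`).

Sufficiency. On a diagonal algebra with coordinates `x₀, x₁, x₂` and central coordinates `y₀, y₁,
y₂`, take `ω = ∑ yₖ ∧ xₖ` and let `Ψ` be the product of the forms `xₖ + i yₖ`. Then `Re Ψ` is always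
closed, and `ω` is closed when the coefficients have sum zero (`HasDiag.exists_isSU3`). A
nilmanifold exists because the coefficients can be taken integral: the integral points of an
explicit polynomial group law on `ℝ⁶` form a cocompact lattice. -/

theorem isManifold (N : Nilmanifold.{u}) : IsManifold (𝓡 6) ∞ N.G :=
  (inferInstance : LieGroup (𝓡 6) ∞ N.G).toIsManifold

attribute [instance] isManifold

theorem isLocalHomeomorph_proj : IsLocalHomeomorph N.proj :=
  (isQuotientCoveringMap_quotientMk_of_properlyDiscontinuousSMul
    (E := N.G) (G := N.Γ)).isCoveringMap.isLocalHomeomorph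

theorem proj_surjective : Function.Surjective N.proj := Quotient.mk_surjective

/-- The section of the projection by which the charts of the quotient are defined. -/
def lift : N.space → N.G := N.proj_surjective.hasRightInverse.choose

@[simp]
theorem proj_lift (x : N.space) : N.proj (N.lift x) = x :=
  N.proj_surjective.hasRightInverse.choose_spec x

theorem chartAt_space (x : N.space) : chartAt E6 x =
    (N.isLocalHomeomorph_proj.localInverseAt (N.lift x)).trans (chartAt E6 (N.lift x)) := rfl

theorem proj_mul (γ : N.Γ) (g : N.G) : N.proj (γ * g) = N.proj g :=
  Quotient.sound ⟨γ, rfl⟩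

theorem exists_mul_eq {g h : N.G} (e : N.proj g = N.proj h) : ∃ γ : N.Γ, γ * h = g :=
  Quotient.exact e

theorem extChartAt_space_symm (x : N.space) (y : E6) :
    (extChartAt (𝓡 6) x).symm y = N.proj ((extChartAt (𝓡 6) (N.lift x)).symm y) := by
  simp only [extChartAt, chartAt_space, OpenPartialHomeomorph.extend_coe_symm,
    OpenPartialHomeomorph.trans_symm_eq_symm_trans_symm, OpenPartialHomeomorph.coe_trans,
    Function.comp_apply, IsLocalHomeomorph.localInverseAt_symm]

theorem extChartAt_space_target_subset (x : N.space) :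
    (extChartAt (𝓡 6) x).target ⊆ (extChartAt (𝓡 6) (N.lift x)).target := by
  intro y hy
  simp only [extChartAt, chartAt_space, OpenPartialHomeomorph.extend_target,
    OpenPartialHomeomorph.trans_target] at hy ⊢
  exact ⟨hy.1.1, hy.2⟩

/-- The chart at `x` uses the local section of the projection through `N.lift x`. Near `g` that
section sends `N.proj k` to `γ * k`, since `γ * k` lies over the same point and in the image of the
section. -/
theorem extChartAt_proj_eventuallyEq {g : N.G} {γ : N.Γ} {x : N.space} (h : γ * g = N.lift x) :
    extChartAt (𝓡 6) x ∘ N.proj =ᶠ[𝓝 g] extChartAt (𝓡 6) (N.lift x) ∘ fun k => γ * k := by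
  set e := N.isLocalHomeomorph_proj.localInverseAt (N.lift x)
  have h1 : ∀ᶠ k in 𝓝 g, (γ : N.G) * k ∈ e.target := by
    refine (continuous_const_mul (γ : N.G)).continuousAt.eventually ?_
    change e.target ∈ 𝓝 ((γ : N.G) * g)
    rw [h]
    exact e.open_target.mem_nhds N.isLocalHomeomorph_proj.self_mem_localInverseAt_target
  filter_upwards [h1] with k hk
  have h2 : e (N.proj k) = γ * k := by
    have h3 := e.right_inv hk
    rwa [IsLocalHomeomorph.localInverseAt_symm, proj_mul] at h3
  simp only [Function.comp_apply, extChartAt, chartAt_space, OpenPartialHomeomorph.extend_coe,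
    OpenPartialHomeomorph.coe_trans]
  congr 2

theorem extChartAt_proj_lift_eventuallyEq (x : N.space) :
    extChartAt (𝓡 6) x ∘ N.proj =ᶠ[𝓝 (N.lift x)] extChartAt (𝓡 6) (N.lift x) := by
  have := N.extChartAt_proj_eventuallyEq (g := N.lift x) (γ := 1) (x := x) (by simp)
  simpa [Function.comp_def] using! this

theorem contMDiff_proj : ContMDiff (𝓡 6) (𝓡 6) ∞ N.proj := by
  intro g
  rw [contMDiffAt_iff_target]
  refine ⟨N.isLocalHomeomorph_proj.continuous.continuousAt, ?_⟩
  obtain ⟨γ, hγ⟩ := N.exists_mul_eq (g := N.lift (N.proj g)) (h := g) (by simp)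
  refine ContMDiffAt.congr_of_eventuallyEq ?_ (N.extChartAt_proj_eventuallyEq hγ)
  refine ContMDiffAt.comp g ?_ (contMDiff_mul_left (I := 𝓡 6) (n := ∞) (a := (γ : N.G))).contMDiffAt
  rw [hγ]
  exact contMDiffAt_extChartAt

theorem mdifferentiableAt_proj (g : N.G) : MDifferentiableAt (𝓡 6) (𝓡 6) N.proj g :=
  N.contMDiff_proj.contMDiffAt.mdifferentiableAt (by simp)

theorem mfderiv_extChartAt_comp_mfderiv_proj (x : N.space) :
    (mfderiv (𝓡 6) 𝓘(ℝ, E6) (extChartAt (𝓡 6) x) (N.proj (N.lift x))).comp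
      (mfderiv (𝓡 6) (𝓡 6) N.proj (N.lift x)) =
    mfderiv (𝓡 6) 𝓘(ℝ, E6) (extChartAt (𝓡 6) (N.lift x)) (N.lift x) := by
  have h : MDifferentiableAt (𝓡 6) 𝓘(ℝ, E6) (extChartAt (𝓡 6) x) (N.proj (N.lift x)) := by
    rw [proj_lift]
    exact (contMDiffAt_extChartAt (n := 1)).mdifferentiableAt (by simp)
  rw [← mfderiv_comp _ h (N.mdifferentiableAt_proj _)]
  exact (N.extChartAt_proj_lift_eventuallyEq x).mfderiv_eq

theorem mdifferentiableAt_mul_left (a g : N.G) :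
    MDifferentiableAt (𝓡 6) (𝓡 6) (fun k : N.G => a * k) g :=
  (contMDiff_mul_left (I := 𝓡 6) (n := ∞)).contMDiffAt.mdifferentiableAt (by simp)

theorem mfderiv_mul_left_comp (a b g : N.G) :
    (mfderiv (𝓡 6) (𝓡 6) (fun k : N.G => a * k) (b * g)).comp
      (mfderiv (𝓡 6) (𝓡 6) (fun k : N.G => b * k) g) =
    mfderiv (𝓡 6) (𝓡 6) (fun k : N.G => (a * b) * k) g := by
  rw [← mfderiv_comp g (I' := 𝓡 6) (N.mdifferentiableAt_mul_left a (b * g))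
    (N.mdifferentiableAt_mul_left b g)]
  congr 1
  funext k
  simp [mul_assoc]

theorem mfderiv_proj_comp_mfderiv_mul_left (γ : N.Γ) (g : N.G) :
    (mfderiv (𝓡 6) (𝓡 6) N.proj (γ * g)).comp
      (mfderiv (𝓡 6) (𝓡 6) (fun k : N.G => (γ : N.G) * k) g) =
    mfderiv (𝓡 6) (𝓡 6) N.proj g := by
  rw [← mfderiv_comp g (I' := 𝓡 6) (N.mdifferentiableAt_proj _) (N.mdifferentiableAt_mul_left _ g)]
  congr 1
  funext k
  simp [proj_mul]

theorem mfderiv_mul_left_injective (a g : N.G) :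
    Function.Injective (mfderiv (𝓡 6) (𝓡 6) (fun k : N.G => a * k) g) := by
  have h := N.mfderiv_mul_left_comp a⁻¹ a g
  have h1 : (fun k : N.G => (a⁻¹ * a) * k) = id := by
    funext k
    simp
  rw [h1, mfderiv_id] at h
  intro v w hvw
  have h3 : ∀ v, mfderiv (𝓡 6) (𝓡 6) (fun k : N.G => a⁻¹ * k) (a * g)
      (mfderiv (𝓡 6) (𝓡 6) (fun k : N.G => a * k) g v) = v := by
    intro v
    exact DFunLike.congr_fun h v
  rw [← h3 v, hvw, h3]

/-- At a point `N.lift x` the projection, read in the chart at `x`, is a chart of the group, whose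
derivative is invertible. Any other point is moved to such a point by an element of `Γ`. -/
theorem mfderiv_proj_injective (g : N.G) :
    Function.Injective (mfderiv (𝓡 6) (𝓡 6) N.proj g) := by
  have key : ∀ x, Function.Injective (mfderiv (𝓡 6) (𝓡 6) N.proj (N.lift x)) := by
    intro x
    have h := N.mfderiv_extChartAt_comp_mfderiv_proj x
    have h2 : Function.Injective
        (mfderiv (𝓡 6) 𝓘(ℝ, E6) (extChartAt (𝓡 6) (N.lift x)) (N.lift x)) :=
      (isInvertible_mfderiv_extChartAt (mem_extChartAt_source (I := 𝓡 6) (N.lift x))).injective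
    rw [← h] at h2
    exact Function.Injective.of_comp h2
  obtain ⟨γ, hγ⟩ := N.exists_mul_eq (g := N.lift (N.proj g)) (h := g) (by simp)
  rw [← N.mfderiv_proj_comp_mfderiv_mul_left γ g]
  have := key (N.proj g)
  rw [← hγ] at this
  exact this.comp (N.mfderiv_mul_left_injective _ _)

instance finiteDimensional_tangentSpace {M : Type*} [TopologicalSpace M] [ChartedSpace E6 M]
    (x : M) : FiniteDimensional ℝ (TangentSpace (𝓡 6) x) :=
  inferInstanceAs (FiniteDimensional ℝ (EuclideanSpace ℝ (Fin 6)))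

theorem finrank_tangentSpace {M : Type*} [TopologicalSpace M] [ChartedSpace E6 M]
    (x : M) : Module.finrank ℝ (TangentSpace (𝓡 6) x) = 6 :=
  finrank_euclideanSpace_fin (𝕜 := ℝ) (n := 6)

/-- An injective endomorphism of the model space as an equivalence. -/
def equivOfInjective (f : E6 →L[ℝ] E6) (hf : Function.Injective f) : E6 ≃L[ℝ] E6 :=
  (LinearEquiv.ofInjectiveEndo f.toLinearMap hf).toContinuousLinearEquiv

/-- The derivative of the projection as a linear equivalence. -/
def projDeriv (g : N.G) : TangentSpace (𝓡 6) g ≃L[ℝ] TangentSpace (𝓡 6) (N.proj g) :=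
  equivOfInjective (mfderiv (𝓡 6) (𝓡 6) N.proj g) (N.mfderiv_proj_injective g)

variable {F : Type*} [NormedAddCommGroup F] [NormedSpace ℝ F] {k : ℕ}

theorem mdifferentiableAt_extChartAt_symm {x : N.G} {y : E6}
    (hy : y ∈ (extChartAt (𝓡 6) x).target) :
    MDifferentiableAt 𝓘(ℝ, E6) (𝓡 6) (extChartAt (𝓡 6) x).symm y :=
  (((contMDiffOn_extChartAt_symm (n := ∞) x).contMDiffAt
    ((isOpen_extChartAt_target x).mem_nhds hy))).mdifferentiableAt (by simp)

/-- The inverse chart on the quotient is the projection after an inverse chart of `G`. Hence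
smoothness and exterior derivatives on `Γ \ G` can be computed on `G`. -/
theorem inChart_space (α : DForm N.space F k) (x : N.space) {y : E6}
    (hy : y ∈ (extChartAt (𝓡 6) (N.lift x)).target) :
    inChart α x y = inChart (pullback N.proj α) (N.lift x) y := by
  have h : ⇑(extChartAt (𝓡 6) x).symm = N.proj ∘ (extChartAt (𝓡 6) (N.lift x)).symm :=
    funext (N.extChartAt_space_symm x)
  have h2 := mfderiv_comp y (I' := 𝓡 6) (N.mdifferentiableAt_proj _)
    (N.mdifferentiableAt_extChartAt_symm hy)
  unfold inChart
  rw [h, h2]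
  rfl

theorem isSmoothForm_of_pullback_proj {α : DForm N.space F k}
    (h : IsSmoothForm (pullback N.proj α)) : IsSmoothForm α := fun x =>
  ((h (N.lift x)).mono (N.extChartAt_space_target_subset x)).congr
    fun _ hy => N.inChart_space α x (N.extChartAt_space_target_subset x hy)

theorem extDeriv_inChart_space (α : DForm N.space F k) (x : N.space) :
    extDeriv (inChart α x) (extChartAt (𝓡 6) x x) =
      extDeriv (inChart (pullback N.proj α) (N.lift x))
        (extChartAt (𝓡 6) (N.lift x) (N.lift x)) := by
  have h : extChartAt (𝓡 6) x x = extChartAt (𝓡 6) (N.lift x) (N.lift x) := by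
    have := (N.extChartAt_proj_lift_eventuallyEq x).eq_of_nhds
    rwa [Function.comp_apply, proj_lift] at this
  rw [h]
  refine Filter.EventuallyEq.extDeriv_eq ?_
  filter_upwards [extChartAt_target_mem_nhds (I := 𝓡 6) (N.lift x)] with y hy
  exact N.inChart_space α x hy

end SHF.Nilmanifold

end

/-! ### Left-invariant forms. -/

noncomputable section
open scoped Manifold ContDiff Topology
open MulAction VectorField

section Alternating
variable {E E' F : Type*} [NormedAddCommGroup E] [NormedSpace ℝ E] [NormedAddCommGroup E']
  [NormedSpace ℝ E'] [NormedAddCommGroup F] [NormedSpace ℝ F] {k : ℕ}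

theorem ContinuousMultilinearMap.continuous_alternatization :
    Continuous (ContinuousMultilinearMap.alternatization :
      ContinuousMultilinearMap ℝ (fun _ : Fin k => E) F →+ E [⋀^Fin k]→L[ℝ] F) := by
  refine ContinuousAlternatingMap.isUniformEmbedding_toContinuousMultilinearMap.isInducing.continuous_iff.2 ?_
  change Continuous fun f : ContinuousMultilinearMap ℝ (fun _ : Fin k => E) F =>
    ∑ σ : Equiv.Perm (Fin k), Equiv.Perm.sign σ • f.domDomCongr σ
  refine continuous_finsetSum _ fun σ _ => ?_
  have h : Continuous fun f : ContinuousMultilinearMap ℝ (fun _ : Fin k => E) F =>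
      f.domDomCongr σ :=
    (ContinuousMultilinearMap.domDomCongrₗᵢ ℝ E F σ).continuous
  rcases Int.units_eq_one_or (Equiv.Perm.sign σ) with h1 | h1
  · simpa [h1] using h
  · rw [h1]
    simp only [Units.neg_smul, one_smul]
    exact h.neg

/-- A family of alternating maps is smooth if the underlying family of multilinear maps is. -/
theorem ContinuousAlternatingMap.contDiff_compContinuousLinearMap (f : E' [⋀^Fin k]→L[ℝ] F)
    {n : WithTop ℕ∞} :
    ContDiff ℝ n fun g : E →L[ℝ] E' => f.compContinuousLinearMap g := by
  have h1 : ContDiff ℝ n fun g : E →L[ℝ] E' =>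
      ContinuousMultilinearMap.compContinuousLinearMapContinuousMultilinear ℝ
        (fun _ : Fin k => E) (fun _ => E') F (fun _ => g) f.toContinuousMultilinearMap :=
    ((ContinuousMultilinearMap.contDiff _).comp (contDiff_pi.2 fun _ => contDiff_id)).clm_apply
      contDiff_const
  -- On a multilinear map that is already alternating, alternatization is multiplication by `k!`.
  -- Being continuous and linear, `1 / k!` times it carries smoothness from multilinear maps to
  -- alternating ones.
  have h2 := (((AddMonoidHom.toRealLinearMap _
    (ContinuousMultilinearMap.continuous_alternatization (E := E) (F := F) (k := k))).contDiff
      (n := n)).comp h1).const_smul ((k.factorial : ℝ)⁻¹)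
  convert h2 using 1
  funext g
  ext v
  have h3 : (k.factorial : ℝ) ≠ 0 := by positivity
  change f (fun i => g (v i)) = (k.factorial : ℝ)⁻¹ • ContinuousMultilinearMap.alternatization
    (f.toContinuousMultilinearMap.compContinuousLinearMap fun _ => g) v
  rw [ContinuousMultilinearMap.alternatization_apply_apply, eq_inv_smul_iff₀ h3]
  have h4 : ∀ σ : Equiv.Perm (Fin k), Equiv.Perm.sign σ •
      (f.toContinuousMultilinearMap.compContinuousLinearMap fun _ => g) (v ∘ σ) =
        f fun i => g (v i) := by
    intro σ
    have h5 := f.toAlternatingMap.map_perm (fun i => g (v i)) σ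
    change Equiv.Perm.sign σ • f ((fun i => g (v i)) ∘ σ) = _
    change f ((fun i => g (v i)) ∘ σ) = Equiv.Perm.sign σ • f (fun i => g (v i)) at h5
    rw [h5, smul_smul, Int.units_mul_self, one_smul]
  simp only [h4, Finset.sum_const, Finset.card_univ, Fintype.card_perm, Fintype.card_fin]
  rw [Nat.cast_smul_eq_nsmul]

end Alternating

namespace SHF.Nilmanifold
variable (N : Nilmanifold.{u})
variable {F : Type*} [NormedAddCommGroup F] [NormedSpace ℝ F] {k : ℕ}

/-- The Lie algebra of the covering group of a nilmanifold. -/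
abbrev lieAlg : Type := GroupLieAlgebra (𝓡 6) N.G

variable {N}

theorem IsLeftInvariant.apply_mulInvariantVectorField {α : DForm N.G F k} (h : IsLeftInvariant α)
    (g : N.G) (v : Fin k → N.lieAlg) :
    α g (fun i => mulInvariantVectorField (v i) g) = α 1 v := by
  have h1 := DFunLike.congr_fun (congrFun (h g) 1) v
  rw [← h1]
  -- The points `g * 1` and `g` have different tangent spaces as types, so the equality is
  -- generalised to a variable before it is used.
  have h2 : ∀ a, g = a → α g (fun i => mulInvariantVectorField (v i) g) =
      α a (fun i => (mfderiv (𝓡 6) (𝓡 6) (fun b : N.G => g * b) 1 (v i) : E6)) := by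
    rintro _ rfl
    rfl
  exact h2 _ (mul_one g).symm

/-- Composition of an alternating map on the model space with an endomorphism. -/
abbrev compModel (f : E6 [⋀^Fin k]→L[ℝ] F) (A : E6 →L[ℝ] E6) : E6 [⋀^Fin k]→L[ℝ] F :=
  f.compContinuousLinearMap A

/-- The left-invariant differential form with given value at the identity. -/
def leftForm (ℓ : N.lieAlg [⋀^Fin k]→L[ℝ] F) : DForm N.G F k :=
  fun g => compModel ℓ
    (mfderiv (𝓡 6) (𝓡 6) (fun b : N.G => g⁻¹ * b) g)

theorem leftForm_one (ℓ : N.lieAlg [⋀^Fin k]→L[ℝ] F) : leftForm ℓ 1 = ℓ := by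
  have h1 : (fun b : N.G => 1⁻¹ * b) = id := by
    funext k
    simp
  unfold leftForm
  rw [h1, mfderiv_id]
  rfl

theorem isLeftInvariant_leftForm (ℓ : N.lieAlg [⋀^Fin k]→L[ℝ] F) :
    IsLeftInvariant (leftForm ℓ) := by
  intro g
  funext h
  have h1 := N.mfderiv_mul_left_comp (g * h)⁻¹ g h
  have h2 : (g * h)⁻¹ * g = h⁻¹ := by group
  rw [h2] at h1
  unfold leftForm
  rw [← h1]
  rfl

theorem isLeftInvariant_ext {α β : DForm N.G F k} (hα : IsLeftInvariant α)
    (hβ : IsLeftInvariant β) (h : α 1 = β 1) : α = β := by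
  have key : ∀ {γ : DForm N.G F k}, IsLeftInvariant γ → γ = leftForm (γ 1) := by
    intro γ hγ
    funext g
    have h1 := congrFun (hγ g⁻¹) g
    rw [← h1]
    have h2 : ∀ a : N.G, 1 = a → compModel (γ a)
        (mfderiv (𝓡 6) (𝓡 6) (fun b : N.G => g⁻¹ * b) g) =
      compModel (γ 1)
        (mfderiv (𝓡 6) (𝓡 6) (fun b : N.G => g⁻¹ * b) g) := by
      rintro _ rfl
      rfl
    exact h2 _ (inv_mul_cancel g).symm
  rw [key hα, key hβ, h]

end SHF.Nilmanifold

end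

/-! ### The exterior derivative of left-invariant forms. -/

noncomputable section
open scoped Manifold ContDiff Topology
open MulAction VectorField
namespace SHF.Nilmanifold
variable {N : Nilmanifold.{u}}
variable {F : Type*} [NormedAddCommGroup F] [NormedSpace ℝ F] {k : ℕ}

theorem three_le_infty : (3 : WithTop ℕ∞) ≤ ∞ := ENat.LEInfty.out

/-- The Chevalley-Eilenberg differential of an alternating form on a Lie algebra, as a function. -/
def ceDiff {L : Type*} [Bracket L L] {n : ℕ} (ℓ : (Fin (n + 1) → L) → F)
    (v : Fin (n + 2) → L) : F :=
  -- A pair `i ≤ j` stands for the arguments numbered `i < j + 1`; the outer minus sign turns `(-1)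
  -- ^ (i + j)` into the usual `(-1) ^ (i + (j + 1))`.
  -∑ i : Fin (n + 1), ∑ j ≥ i, (-1 : ℤ) ^ (i + j : ℕ) •
    ℓ (Matrix.vecCons ⁅v i.castSucc, v j.succ⁆ (j.removeNth <| i.castSucc.removeNth v))

/-- The expression of a left-invariant vector field in a chart. -/
def fieldInChart (g : N.G) (v : N.lieAlg) : E6 → E6 :=
  mpullback 𝓘(ℝ, E6) (𝓡 6) (extChartAt (𝓡 6) g).symm (mulInvariantVectorField v)

theorem isInvertible_mfderiv_extChartAt_symm' {g : N.G} {y : E6}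
    (hy : y ∈ (extChartAt (𝓡 6) g).target) :
    (mfderiv 𝓘(ℝ, E6) (𝓡 6) (extChartAt (𝓡 6) g).symm y).IsInvertible := by
  have := isInvertible_mfderivWithin_extChartAt_symm (I := 𝓡 6) hy
  simpa [mfderivWithin_univ] using! this

theorem inChart_fieldInChart {α : DForm N.G F k} (h : IsLeftInvariant α) {g : N.G} {y : E6}
    (hy : y ∈ (extChartAt (𝓡 6) g).target) (v : Fin k → N.lieAlg) :
    inChart α g y (fun i => fieldInChart g (v i) y) = α 1 v := by
  rw [← IsLeftInvariant.apply_mulInvariantVectorField h ((extChartAt (𝓡 6) g).symm y)]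
  unfold inChart fieldInChart
  change α _ (fun i => _) = _
  congr 1
  funext i
  have h1 := (isInvertible_mfderiv_extChartAt_symm' hy)
  simp only [mpullback_apply]
  exact h1.self_apply_inverse _

theorem mdifferentiableAt_mulInvariantVectorField' (v : N.lieAlg) (g : N.G) :
    MDifferentiableAt (𝓡 6) (𝓡 6).tangent
      (fun h : N.G => (mulInvariantVectorField v h : TangentBundle (𝓡 6) N.G)) g :=
  mdifferentiableAt_mulInvariantVectorField v

theorem contMDiffAt_extChartAt_symm' {g : N.G} {y : E6}
    (hy : y ∈ (extChartAt (𝓡 6) g).target) :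
    ContMDiffAt 𝓘(ℝ, E6) (𝓡 6) ∞ (extChartAt (𝓡 6) g).symm y :=
  ((contMDiffOn_extChartAt_symm (n := ∞) g).contMDiffAt
    ((isOpen_extChartAt_target g).mem_nhds hy))

/-- Pullback along the inverse chart commutes with brackets of vector fields, and the bracket of
left-invariant fields is the left-invariant field of the Lie algebra bracket. -/
theorem lieBracket_fieldInChart {g : N.G} {y : E6} (hy : y ∈ (extChartAt (𝓡 6) g).target)
    (v w : N.lieAlg) :
    lieBracket ℝ (fieldInChart g v) (fieldInChart g w) y = fieldInChart g ⁅v, w⁆ y := by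
  have h1 := mpullback_mlieBracket (I := 𝓘(ℝ, E6)) (I' := 𝓡 6) (n := (3 : WithTop ℕ∞))
    (mdifferentiableAt_mulInvariantVectorField' v ((extChartAt (𝓡 6) g).symm y))
    (mdifferentiableAt_mulInvariantVectorField' w ((extChartAt (𝓡 6) g).symm y))
    ((contMDiffAt_extChartAt_symm' hy).of_le three_le_infty) (by
      rw [minSmoothness_of_isRCLikeNormedField]; norm_num)
  rw [← mulInvariantVector_mlieBracket] at h1
  unfold fieldInChart
  rw [GroupLieAlgebra.bracket_def, h1, ← mlieBracketWithin_univ,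
    mlieBracketWithin_eq_lieBracketWithin]
  exact congrFun lieBracketWithin_univ.symm y

theorem differentiableAt_fieldInChart {g : N.G} {y : E6} (hy : y ∈ (extChartAt (𝓡 6) g).target)
    (v : N.lieAlg) : DifferentiableAt ℝ (fieldInChart g v) y := by
  have h1 := MDifferentiableAt.mpullback_vectorField (I := 𝓘(ℝ, E6)) (I' := 𝓡 6)
    (n := (3 : WithTop ℕ∞))
    (mdifferentiableAt_mulInvariantVectorField' v ((extChartAt (𝓡 6) g).symm y))
    ((contMDiffAt_extChartAt_symm' hy).of_le three_le_infty)
    (isInvertible_mfderiv_extChartAt_symm' hy) (by norm_num)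
  exact (((contMDiff_snd_tangentBundle_modelSpace E6 𝓘(ℝ, E6) (n := 1)).contMDiffAt.mdifferentiableAt
    one_ne_zero).comp y h1).differentiableAt

/-- In the invariant formula for `dα` on left-invariant fields, the terms that differentiate values
of `α` vanish because these values are constant. Only the bracket terms remain. -/
theorem extDeriv_inChart {n : ℕ} {α : DForm N.G F (n + 1)} (h : IsLeftInvariant α) (g : N.G)
    (hd : DifferentiableAt ℝ (inChart α g) (extChartAt (𝓡 6) g g)) (v : Fin (n + 2) → N.lieAlg) :
    extDeriv (inChart α g) (extChartAt (𝓡 6) g g)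
      (fun i => fieldInChart g (v i) (extChartAt (𝓡 6) g g)) = ceDiff (α 1) v := by
  have ht := mem_extChartAt_target (I := 𝓡 6) g
  have h1 := extDeriv_apply_vectorField hd
    (fun i => differentiableAt_fieldInChart ht (v i))
  rw [h1]
  have h2 : ∀ i : Fin (n + 2), fderiv ℝ (fun x => inChart α g x
      (i.removeNth fun j => fieldInChart g (v j) x)) (extChartAt (𝓡 6) g g) = 0 := by
    intro i
    have h3 : (fun x => inChart α g x (i.removeNth fun j => fieldInChart g (v j) x)) =ᶠ[
        𝓝 (extChartAt (𝓡 6) g g)] fun _ => α 1 (i.removeNth v) := by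
      filter_upwards [extChartAt_target_mem_nhds (I := 𝓡 6) g] with y hy
      exact inChart_fieldInChart h hy (i.removeNth v)
    rw [h3.fderiv_eq]
    simp
  simp only [h2, zero_apply, smul_zero, Finset.sum_const_zero, zero_sub, ceDiff]
  congr 1
  refine Finset.sum_congr rfl fun i _ => Finset.sum_congr rfl fun j _ => ?_
  congr 1
  rw [lieBracket_fieldInChart ht, ← inChart_fieldInChart h ht]
  congr 1
  funext m
  refine Fin.cases ?_ (fun m => ?_) m <;> rfl

end SHF.Nilmanifold

end

/-! ### Smoothness and closedness of invariant forms. -/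

noncomputable section
open scoped Manifold ContDiff Topology
open MulAction VectorField
namespace SHF.Nilmanifold
variable {N : Nilmanifold.{u}}
variable {F : Type*} [NormedAddCommGroup F] [NormedSpace ℝ F] {k : ℕ}

/-- The left logarithmic derivative of the inverse of a chart. -/
def chartMaurerCartan (x : N.G) (y : E6) : E6 →L[ℝ] E6 :=
  fderiv ℝ (fun z => extChartAt (𝓡 6) (1 : N.G)
    (((extChartAt (𝓡 6) x).symm y)⁻¹ * (extChartAt (𝓡 6) x).symm z)) y

theorem inChart_leftForm (ℓ : N.lieAlg [⋀^Fin k]→L[ℝ] F) {x : N.G} {y : E6}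
    (hy : y ∈ (extChartAt (𝓡 6) x).target) :
    inChart (leftForm ℓ) x y = compModel ℓ (chartMaurerCartan x y) := by
  set a := (extChartAt (𝓡 6) x).symm y with ha
  have h1 : MDifferentiableAt 𝓘(ℝ, E6) (𝓡 6) ((fun b : N.G => a⁻¹ * b) ∘ (extChartAt (𝓡 6) x).symm)
      y := (N.mdifferentiableAt_mul_left a⁻¹ a).comp y (N.mdifferentiableAt_extChartAt_symm hy)
  have h2 : (mfderiv 𝓘(ℝ, E6) (𝓡 6) ((fun b : N.G => a⁻¹ * b) ∘ (extChartAt (𝓡 6) x).symm) y :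
      E6 →L[ℝ] E6) = chartMaurerCartan x y := by
    have h3 : extChartAt (𝓡 6) (((fun b : N.G => a⁻¹ * b) ∘ (extChartAt (𝓡 6) x).symm) y) =
        extChartAt (𝓡 6) (1 : N.G) := by
      congr 1
      exact inv_mul_cancel a
    have h4 : (mfderiv 𝓘(ℝ, E6) (𝓡 6) ((fun b : N.G => a⁻¹ * b) ∘ (extChartAt (𝓡 6) x).symm) y :
        E6 →L[ℝ] E6) = fderivWithin ℝ (writtenInExtChartAt 𝓘(ℝ, E6) (𝓡 6) y
          ((fun b : N.G => a⁻¹ * b) ∘ (extChartAt (𝓡 6) x).symm))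
          (Set.range 𝓘(ℝ, E6)) (extChartAt 𝓘(ℝ, E6) y y) := h1.mfderiv
    refine h4.trans ?_
    unfold writtenInExtChartAt
    rw [h3]
    simp only [modelWithCornersSelf_coe, Set.range_id, fderivWithin_univ,
      extChartAt_model_space_eq_id, PartialEquiv.refl_coe, PartialEquiv.refl_symm, id_eq]
    rfl
  exact congrArg (compModel ℓ) ((mfderiv_comp y (I' := 𝓡 6) (N.mdifferentiableAt_mul_left a⁻¹ a)
    (N.mdifferentiableAt_extChartAt_symm hy)).symm.trans h2)

/-- This is the partial derivative in `z`, on the diagonal `z = y`, of a function smooth in `(y,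
z)`. Together with `inChart_leftForm` it makes every left-invariant form smooth, with no regularity
assumed. -/
theorem contDiffAt_chartMaurerCartan {x : N.G} {y : E6} (hy : y ∈ (extChartAt (𝓡 6) x).target) :
    ContDiffAt ℝ ∞ (chartMaurerCartan x) y := by
  refine ContDiffAt.fderiv (n := ∞) (f := fun y z => extChartAt (𝓡 6) (1 : N.G)
    (((extChartAt (𝓡 6) x).symm y)⁻¹ * (extChartAt (𝓡 6) x).symm z)) (g := fun y => y) ?_
    contDiffAt_id (by simp)
  rw [← contMDiffAt_iff_contDiffAt]
  have h1 : ContMDiffAt 𝓘(ℝ, E6 × E6) (𝓡 6) ∞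
      (fun p : E6 × E6 => (extChartAt (𝓡 6) x).symm p.1) (y, y) :=
    (contMDiffAt_extChartAt_symm' hy).comp (y, y) contDiffAt_fst.contMDiffAt
  have h2 : ContMDiffAt 𝓘(ℝ, E6 × E6) (𝓡 6) ∞
      (fun p : E6 × E6 => (extChartAt (𝓡 6) x).symm p.2) (y, y) :=
    (contMDiffAt_extChartAt_symm' hy).comp (y, y) contDiffAt_snd.contMDiffAt
  refine ContMDiffAt.comp (y, y) (I' := 𝓡 6) (g := extChartAt (𝓡 6) (1 : N.G)) ?_ (h1.inv.mul h2)
  simp only [inv_mul_cancel]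
  exact contMDiffAt_extChartAt

theorem isSmoothForm_leftForm (ℓ : N.lieAlg [⋀^Fin k]→L[ℝ] F) : IsSmoothForm (leftForm ℓ) := by
  intro x
  have h1 : ContDiffOn ℝ ∞ (fun y => compModel ℓ (chartMaurerCartan x y))
      (extChartAt (𝓡 6) x).target := fun y hy =>
    ((ContinuousAlternatingMap.contDiff_compContinuousLinearMap (E := E6) (E' := E6)
      (n := ∞) (ℓ : E6 [⋀^Fin k]→L[ℝ] F)).contDiffAt.comp y
        (contDiffAt_chartMaurerCartan hy)).contDiffWithinAt
  exact h1.congr fun y hy => inChart_leftForm ℓ hy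

theorem IsLeftInvariant.eq_leftForm {α : DForm N.G F k} (h : IsLeftInvariant α) :
    α = leftForm (α 1) :=
  isLeftInvariant_ext h (isLeftInvariant_leftForm _) (leftForm_one _).symm

theorem IsLeftInvariant.isSmoothForm {α : DForm N.G F k} (h : IsLeftInvariant α) :
    IsSmoothForm α := by
  rw [IsLeftInvariant.eq_leftForm h]
  exact isSmoothForm_leftForm _

theorem fieldInChart_surjective {g : N.G} {y : E6} (hy : y ∈ (extChartAt (𝓡 6) g).target) :
    Function.Surjective fun v : N.lieAlg => fieldInChart g v y := by
  obtain ⟨e, he⟩ := isInvertible_mfderiv_extChartAt_symm' hy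
  intro w
  obtain ⟨v, hv⟩ := (equivOfInjective _
    (N.mfderiv_mul_left_injective ((extChartAt (𝓡 6) g).symm y) 1)).surjective (e w)
  refine ⟨v, ?_⟩
  have h1 : (mfderiv 𝓘(ℝ, E6) (𝓡 6) (extChartAt (𝓡 6) g).symm y).inverse = e.symm := by
    rw [← he, ContinuousLinearMap.inverse_equiv]
  refine (DFunLike.congr_fun h1 _).trans ?_
  exact (congrArg e.symm hv).trans (e.symm_apply_apply w)

theorem mfderiv_extChartAt_surjective (N : Nilmanifold.{u}) (x : N.space) :
    Function.Surjective (mfderiv (𝓡 6) 𝓘(ℝ, E6) (extChartAt (𝓡 6) x) x) := by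
  have h1 : Function.Surjective
      (mfderiv (𝓡 6) 𝓘(ℝ, E6) (extChartAt (𝓡 6) x) (N.proj (N.lift x))) := by
    have h2 : Function.Surjective
        (mfderiv (𝓡 6) 𝓘(ℝ, E6) (extChartAt (𝓡 6) (N.lift x)) (N.lift x)) :=
      (isInvertible_mfderiv_extChartAt (mem_extChartAt_source (I := 𝓡 6) (N.lift x))).surjective
    rw [← N.mfderiv_extChartAt_comp_mfderiv_proj] at h2
    exact Function.Surjective.of_comp h2
  rwa [proj_lift] at h1

theorem IsLeftInvariant.extDeriv_eq_zero_iff {n : ℕ} {α : DForm N.G F (n + 1)}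
    (h : IsLeftInvariant α) (g : N.G) :
    extDeriv (inChart α g) (extChartAt (𝓡 6) g g) = 0 ↔ ∀ v, ceDiff (α 1) v = 0 := by
  have ht := mem_extChartAt_target (I := 𝓡 6) g
  have hd : DifferentiableAt ℝ (inChart α g) (extChartAt (𝓡 6) g g) :=
    ((IsLeftInvariant.isSmoothForm h g).contDiffAt
      (extChartAt_target_mem_nhds (I := 𝓡 6) g)).differentiableAt (by simp)
  constructor
  · intro h1 v
    rw [← extDeriv_inChart h g hd, h1]
    rfl
  · intro h1
    ext w
    have h2 : ∀ i, ∃ v : N.lieAlg, fieldInChart g v (extChartAt (𝓡 6) g g) = w i := by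
      intro i
      exact fieldInChart_surjective ht (w i)
    choose v hv using h2
    have h3 := extDeriv_inChart h g hd v
    simp only [hv, h1] at h3
    exact h3

/-- Forms on the nilmanifold whose pullback is left-invariant are closed precisely if their value
at the identity is closed in the sense of Chevalley and Eilenberg. -/
theorem IsInvariant.isClosedForm_iff {n : ℕ} {α : DForm N.space F (n + 1)} (h : N.IsInvariant α) :
    IsClosedForm α ↔ ∀ v, ceDiff (pullback N.proj α 1) v = 0 := by
  have h1 : ∀ x, extD α x = 0 ↔ extDeriv (inChart α x) (extChartAt (𝓡 6) x x) = 0 := by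
    intro x
    constructor
    · intro h2
      ext w
      choose v hv using fun i => N.mfderiv_extChartAt_surjective x (w i)
      have h3 := DFunLike.congr_fun h2 v
      rw [← funext hv]
      exact h3
    · intro h2
      unfold extD
      rw [h2]
      rfl
  unfold IsClosedForm
  simp only [h1, extDeriv_inChart_space]
  constructor
  · intro h2
    exact (IsLeftInvariant.extDeriv_eq_zero_iff h _).1 (h2 (N.proj 1))
  · intro h2 x
    exact (IsLeftInvariant.extDeriv_eq_zero_iff h _).2 h2

end SHF.Nilmanifold

end

/-! ### Reduction to linear algebra on the Lie algebra. -/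

noncomputable section
open scoped Manifold Topology
open MulAction VectorField
namespace SHF

section LinearPullback
variable {V V' A : Type*} [AddCommGroup V] [Module ℝ V] [TopologicalSpace V]
  [AddCommGroup V'] [Module ℝ V'] [TopologicalSpace V']
  [CommRing A] [Algebra ℝ A] [TopologicalSpace A] [IsTopologicalRing A]

theorem wedge_compContinuousLinearMap {k l : ℕ} (α : V [⋀^Fin k]→L[ℝ] A)
    (β : V [⋀^Fin l]→L[ℝ] A) (f : V' →L[ℝ] V) :
    wedge (α.compContinuousLinearMap f) (β.compContinuousLinearMap f) =
      (wedge α β).compContinuousLinearMap f := by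
  ext v
  change algWedge _ _ v = algWedge _ _ (f ∘ v)
  simp only [algWedge, AlternatingMap.domDomCongr_apply, LinearMap.compAlternatingMap_apply,
    AlternatingMap.domCoprod_apply, sum_apply]
  congr 1
  refine Finset.sum_congr rfl fun σ _ => ?_
  induction σ using Quotient.inductionOn' with
  | h σ => rfl

theorem IsSU3.comp {ω : V [⋀^Fin 2]→L[ℝ] ℝ} {Ψ : V [⋀^Fin 3]→L[ℝ] ℂ} (h : IsSU3 ω Ψ)
    (e : V' ≃L[ℝ] V) : IsSU3 (ω.compContinuousLinearMap (e : V' →L[ℝ] V))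
      (Ψ.compContinuousLinearMap (e : V' →L[ℝ] V)) where
  nondegenerate v hv := by
    have h1 : e v = 0 := h.nondegenerate _ fun w => by
      have h2 := hv (e.symm w)
      change ω (fun i => e (![v, e.symm w] i)) = 0 at h2
      rw [← h2]
      congr 1
      funext i
      fin_cases i <;> simp
    simpa using h1
  decomposable_tamed := by
    obtain ⟨θ, h1, J, h2, h3⟩ := h.decomposable_tamed
    refine ⟨fun i => (θ i).comp (e : V' →L[ℝ] V), fun v => h1 _,
      e.symm.toLinearEquiv.toLinearMap ∘ₗ J ∘ₗ e.toLinearEquiv.toLinearMap, fun i v => ?_,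
      fun v hv => ?_⟩
    · simpa using h2 i (e v)
    · have h4 := h3 (e v) (by simpa using hv)
      convert h4 using 1
      change ω (fun i => e (![_, v] i)) = _
      congr 1
      funext i
      fin_cases i <;> simp
  wedge_eq_zero := by
    have h1 : toComplex (ω.compContinuousLinearMap (e : V' →L[ℝ] V)) =
      (toComplex ω).compContinuousLinearMap (e : V' →L[ℝ] V) := rfl
    rw [h1, wedge_compContinuousLinearMap, h.wedge_eq_zero]
    rfl
  volume v := by
    have h1 : conjForm (Ψ.compContinuousLinearMap (e : V' →L[ℝ] V)) =
      (conjForm Ψ).compContinuousLinearMap (e : V' →L[ℝ] V) := rfl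
    rw [h1, wedge_compContinuousLinearMap, wedge_compContinuousLinearMap,
      wedge_compContinuousLinearMap, ContinuousAlternatingMap.compContinuousLinearMap_apply,
      ContinuousAlternatingMap.compContinuousLinearMap_apply]
    have h2 := h.volume (⇑(e : V' →L[ℝ] V) ∘ v)
    rw [h2]

end LinearPullback

namespace Nilmanifold
variable {N : Nilmanifold.{u}}
variable {F : Type*} [NormedAddCommGroup F] [NormedSpace ℝ F] {k : ℕ}

/-- The form on the nilmanifold induced by an alternating form on the Lie algebra. -/
def descend (ℓ : N.lieAlg [⋀^Fin k]→L[ℝ] F) : DForm N.space F k := fun x =>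
  compModel (leftForm ℓ (N.lift x)) (N.projDeriv (N.lift x)).symm.toContinuousLinearMap

/-- The descended form is defined through the chosen point `N.lift x` of each fibre. The choice is
harmless because points of a fibre differ by left translation by `Γ`, under which `leftForm ℓ` is
invariant. -/
theorem pullback_descend (ℓ : N.lieAlg [⋀^Fin k]→L[ℝ] F) :
    pullback N.proj (descend ℓ) = leftForm ℓ := by
  funext g
  obtain ⟨γ, hγ⟩ := N.exists_mul_eq (g := N.lift (N.proj g)) (h := g) (by simp)
  have key : ∀ h : N.G, γ * g = h → compModel (compModel (leftForm ℓ h)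
      (N.projDeriv h).symm.toContinuousLinearMap) (mfderiv (𝓡 6) (𝓡 6) N.proj g) = leftForm ℓ g := by
    rintro _ rfl
    have h1 := congrFun (isLeftInvariant_leftForm ℓ (γ : N.G)) g
    rw [← N.mfderiv_proj_comp_mfderiv_mul_left γ g, ← h1]
    ext v
    change leftForm ℓ (γ * g) (fun i => (N.projDeriv (γ * g)).symm (N.projDeriv (γ * g)
      (mfderiv (𝓡 6) (𝓡 6) (fun k : N.G => (γ : N.G) * k) g (v i)))) = _
    simp only [ContinuousLinearEquiv.symm_apply_apply]
    rfl
  exact key _ hγ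

theorem isInvariant_descend (ℓ : N.lieAlg [⋀^Fin k]→L[ℝ] F) : N.IsInvariant (descend ℓ) := by
  unfold IsInvariant
  rw [pullback_descend]
  exact isLeftInvariant_leftForm ℓ

theorem isSU3_descend {ω : N.lieAlg [⋀^Fin 2]→L[ℝ] ℝ} {Ψ : N.lieAlg [⋀^Fin 3]→L[ℝ] ℂ}
    (h : IsSU3 ω Ψ) (x : N.space) : IsSU3 (descend ω x) (descend Ψ x) := by
  have h1 := h.comp (V' := TangentSpace (𝓡 6) (N.lift x))
    (equivOfInjective _ (N.mfderiv_mul_left_injective (N.lift x)⁻¹ (N.lift x)))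
  exact h1.comp (V' := E6) ((N.projDeriv (N.lift x)).symm)

/-- Evaluation at the identity and `descend` pass between invariant forms and forms on the Lie
algebra. The assumption `hw` disposes of the closedness of `ω ∧ ω`; `ceDiff_wedge_self` supplies it.
-/
theorem carriesInvariantSymplecticHalfFlat_iff
    (hw : ∀ ω : N.lieAlg [⋀^Fin 2]→L[ℝ] ℝ, (∀ v, ceDiff ω v = 0) →
      ∀ v, ceDiff (n := 3) (wedge ω ω) v = 0) :
    N.CarriesInvariantSymplecticHalfFlat ↔
      ∃ (ω : N.lieAlg [⋀^Fin 2]→L[ℝ] ℝ) (Ψ : N.lieAlg [⋀^Fin 3]→L[ℝ] ℂ), IsSU3 ω Ψ ∧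
        (∀ v, ceDiff ω v = 0) ∧ ∀ v, ceDiff (rePart Ψ) v = 0 := by
  have hre : ∀ {Ψ : DForm N.space ℂ 3}, pullback N.proj (fun x => rePart (Ψ x)) =
      fun g => rePart (pullback N.proj Ψ g) := fun {Ψ} => rfl
  have hrei : ∀ {Ψ : DForm N.space ℂ 3}, N.IsInvariant Ψ →
      N.IsInvariant (fun x => rePart (Ψ x)) := by
    intro Ψ hΨ g
    funext h
    exact congrArg rePart (congrFun (hΨ g) h)
  constructor
  · rintro ⟨ω, Ψ, h1, h2, h3, h4, h5⟩
    refine ⟨pullback N.proj ω 1, pullback N.proj Ψ 1, ?_, ?_, ?_⟩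
    · exact (h1.isSU3 (N.proj 1)).comp (V' := N.lieAlg) (N.projDeriv 1)
    · exact (IsInvariant.isClosedForm_iff h4).1 h2
    · exact (IsInvariant.isClosedForm_iff (hrei h5)).1 h3.closed_psi_plus
  · rintro ⟨ω, Ψ, h1, h2, h3⟩
    have h4 := isInvariant_descend ω
    have h5 := isInvariant_descend Ψ
    have h6 : pullback N.proj (descend ω) 1 = ω := by rw [pullback_descend, leftForm_one]
    have h7 : pullback N.proj (descend Ψ) 1 = Ψ := by rw [pullback_descend, leftForm_one]
    refine ⟨descend ω, descend Ψ, ⟨?_, ?_, isSU3_descend h1⟩, ?_, ⟨?_, ?_⟩, h4, h5⟩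
    · exact isSmoothForm_of_pullback_proj _ (IsLeftInvariant.isSmoothForm h4)
    · exact isSmoothForm_of_pullback_proj _ (IsLeftInvariant.isSmoothForm h5)
    · refine (IsInvariant.isClosedForm_iff h4).2 ?_
      rwa [h6]
    · have h8 : pullback (k := 2 + 2) (F := ℝ) N.proj (fun x => wedge (descend ω x) (descend ω x)) =
          fun g => wedge (pullback N.proj (descend ω) g) (pullback N.proj (descend ω) g) := by
        funext g
        exact (wedge_compContinuousLinearMap _ _ _).symm
      have h9 : N.IsInvariant (k := 2 + 2) (F := ℝ)
          (fun x => wedge (descend ω x) (descend ω x)) := by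
        unfold IsInvariant
        rw [h8]
        intro g
        funext h
        refine (wedge_compContinuousLinearMap _ _ _).symm.trans ?_
        have h10 := congrFun (h4 g) h
        exact congrArg (fun a => wedge a a) h10
      refine (IsInvariant.isClosedForm_iff (n := 3) h9).2 ?_
      have h11 := congrFun h8 1
      rw [h6] at h11
      erw [h11]
      exact hw ω h2
    · refine (IsInvariant.isClosedForm_iff (hrei h5)).2 ?_
      rw [hre]
      change ∀ v, ceDiff (rePart (pullback N.proj (descend Ψ) 1)) v = 0
      rw [h7]
      exact h3

end Nilmanifold
end SHF

end

/-! ### Wedge products as determinants. -/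

noncomputable section
open scoped Topology
namespace SHF

section DetForm
variable {V A : Type*} [AddCommGroup V] [Module ℝ V] [CommRing A] [Algebra ℝ A]

/-- The wedge product of linear forms. -/
def detForm {k : ℕ} (θ : Fin k → V →ₗ[ℝ] A) : V [⋀^Fin k]→ₗ[ℝ] A :=
  MultilinearMap.alternatization ((MultilinearMap.mkPiAlgebra ℝ (Fin k) A).compLinearMap θ)

theorem detForm_apply {k : ℕ} (θ : Fin k → V →ₗ[ℝ] A) (v : Fin k → V) :
    detForm θ v = Matrix.det (Matrix.of fun i j => θ i (v j)) := by
  rw [detForm, MultilinearMap.alternatization_apply, ← Matrix.det_transpose, Matrix.det_apply]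
  rfl

/-- Both sides are the alternatization of one product of `k + l` linear forms. This replaces sums
over shuffles by determinants. -/
theorem algWedge_detForm {k l : ℕ} (θ : Fin k → V →ₗ[ℝ] A) (φ : Fin l → V →ₗ[ℝ] A) :
    algWedge (detForm θ) (detForm φ) = detForm (Fin.append θ φ) := by
  ext v
  rw [detForm_apply, algWedge, detForm, detForm, ← MultilinearMap.domCoprod_alternization,
    AlternatingMap.domDomCongr_apply, LinearMap.compAlternatingMap_apply,
    MultilinearMap.alternatization_apply, map_sum,
    ← Matrix.det_submatrix_equiv_self finSumFinEquiv, ← Matrix.det_transpose, Matrix.det_apply]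
  refine Finset.sum_congr rfl fun σ _ => ?_
  rw [Units.smul_def, map_zsmul, Units.smul_def]
  congr 1
  simp only [MultilinearMap.domDomCongr_apply, MultilinearMap.domCoprod_apply,
    LinearMap.mul'_apply, MultilinearMap.compLinearMap_apply, MultilinearMap.mkPiAlgebra_apply,
    Fintype.prod_sum_type, Matrix.transpose_apply, Matrix.submatrix_apply, Matrix.of_apply,
    finSumFinEquiv_apply_left, finSumFinEquiv_apply_right, Fin.append_left, Fin.append_right,
    Function.comp_apply]

/-- The wedge product as a bilinear map. -/
def algWedgeₗ (k l : ℕ) : (V [⋀^Fin k]→ₗ[ℝ] A) →ₗ[ℝ] (V [⋀^Fin l]→ₗ[ℝ] A) →ₗ[ℝ]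
    (V [⋀^Fin (k + l)]→ₗ[ℝ] A) :=
  LinearMap.mk₂ ℝ algWedge
    (fun a b c => by
      ext v
      simp [algWedge, ← AlternatingMap.domCoprod'_apply, TensorProduct.add_tmul])
    (fun a b c => by
      ext v
      simp [algWedge, ← AlternatingMap.domCoprod'_apply, ← TensorProduct.smul_tmul'])
    (fun a b c => by
      ext v
      simp [algWedge, ← AlternatingMap.domCoprod'_apply, TensorProduct.tmul_add])
    (fun a b c => by
      ext v
      simp [algWedge, ← AlternatingMap.domCoprod'_apply])

theorem algWedgeₗ_apply {k l : ℕ} (α : V [⋀^Fin k]→ₗ[ℝ] A) (β : V [⋀^Fin l]→ₗ[ℝ] A) :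
    algWedgeₗ k l α β = algWedge α β := rfl

theorem alternatingMap_sum_apply {ι : Type*} {k : ℕ} (s : Finset ι) (f : ι → V [⋀^Fin k]→ₗ[ℝ] A)
    (v : Fin k → V) : (∑ i ∈ s, f i) v = ∑ i ∈ s, f i v := by
  classical
  induction s using Finset.induction_on with
  | empty => simp
  | insert a s ha h => rw [Finset.sum_insert ha, Finset.sum_insert ha, AlternatingMap.add_apply, h]

/-- The contraction of a two-form with a vector. -/
def contract (α : V [⋀^Fin 2]→ₗ[ℝ] A) (w : V) : V →ₗ[ℝ] A :=
  α.toMultilinearMap.toLinearMap ![w, 0] 1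

theorem contract_apply (α : V [⋀^Fin 2]→ₗ[ℝ] A) (w v : V) : contract α w v = α ![w, v] := by
  change α (Function.update ![w, 0] 1 v) = _
  congr 1
  funext i
  fin_cases i <;> simp

/-- This is `α = ½ ∑ bⁱ ∧ α(bᵢ, ·)`; the factor `½` appears because the sum evaluates to `α(v, w) -
α(w, v)`. It reduces linear identities in two-forms to products of linear forms. -/
theorem twoForm_eq_sum_detForm {ι : Type*} [Fintype ι] (b : Module.Basis ι ℝ V)
    (α : V [⋀^Fin 2]→ₗ[ℝ] A) : α = (2 : ℝ)⁻¹ • ∑ i, detForm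
      ![(Algebra.linearMap ℝ A).comp (b.coord i), contract α (b i)] := by
  ext v
  have h1 : ∀ w u, ∑ i, algebraMap ℝ A (b.coord i w) * contract α (b i) u = α ![w, u] := by
    intro w u
    have h2 : α ![w, u] = -contract α u w := by
      rw [contract_apply, ← AlternatingMap.map_swap α ![u, w] (i := 0) (j := 1) (by simp)]
      congr 1
      funext i
      fin_cases i <;> simp
    have h3 : ∀ i, contract α (b i) u = -contract α u (b i) := by
      intro i
      rw [contract_apply, contract_apply,
        ← AlternatingMap.map_swap α ![u, b i] (i := 0) (j := 1) (by simp)]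
      congr 1
      funext i
      fin_cases i <;> simp
    rw [h2]
    conv_rhs => rw [← b.sum_repr w]
    rw [map_sum, ← Finset.sum_neg_distrib]
    refine Finset.sum_congr rfl fun i _ => ?_
    rw [map_smul, h3, Algebra.smul_def, Module.Basis.coord_apply]
    ring
  have h4 : α ![v 1, v 0] = -α ![v 0, v 1] := by
    rw [← AlternatingMap.map_swap α ![v 0, v 1] (i := 0) (j := 1) (by simp)]
    congr 1
    funext i
    fin_cases i <;> simp
  have h5 : α v = α ![v 0, v 1] := by
    congr 1
    funext i
    fin_cases i <;> simp
  have h6 : ∀ i, detForm ![(Algebra.linearMap ℝ A).comp (b.coord i), contract α (b i)] v =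
      algebraMap ℝ A (b.coord i (v 0)) * contract α (b i) (v 1) -
      algebraMap ℝ A (b.coord i (v 1)) * contract α (b i) (v 0) := by
    intro i
    rw [detForm_apply, Matrix.det_fin_two]
    simp
  rw [AlternatingMap.smul_apply, alternatingMap_sum_apply]
  simp only [h6, Finset.sum_sub_distrib, h1, h4, h5]
  rw [sub_neg_eq_add, ← two_smul ℝ, smul_smul]
  norm_num

theorem det_fin_four {R : Type*} [CommRing R] (M : Matrix (Fin 4) (Fin 4) R) : M.det =
    (M 0 0 * M 1 1 - M 0 1 * M 1 0) * (M 2 2 * M 3 3 - M 2 3 * M 3 2) -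
    (M 0 0 * M 1 2 - M 0 2 * M 1 0) * (M 2 1 * M 3 3 - M 2 3 * M 3 1) +
    (M 0 0 * M 1 3 - M 0 3 * M 1 0) * (M 2 1 * M 3 2 - M 2 2 * M 3 1) +
    (M 0 1 * M 1 2 - M 0 2 * M 1 1) * (M 2 0 * M 3 3 - M 2 3 * M 3 0) -
    (M 0 1 * M 1 3 - M 0 3 * M 1 1) * (M 2 0 * M 3 2 - M 2 2 * M 3 0) +
    (M 0 2 * M 1 3 - M 0 3 * M 1 2) * (M 2 0 * M 3 1 - M 2 1 * M 3 0) := by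
  simp only [Matrix.det_succ_row_zero (n := 3), Matrix.det_fin_three, Fin.sum_univ_succ,
    Matrix.submatrix_apply, Fin.succAbove, Finset.univ_unique, Fin.default_eq_zero,
    Finset.sum_singleton]
  simp [Fin.lt_def]
  ring

theorem detForm_fin_two (θ : Fin 2 → V →ₗ[ℝ] A) (v w : V) :
    detForm θ ![v, w] = θ 0 v * θ 1 w - θ 0 w * θ 1 v := by
  rw [detForm_apply, Matrix.det_fin_two]
  simp

theorem detForm_fin_three (θ : Fin 3 → V →ₗ[ℝ] A) (u v w : V) :
    detForm θ ![u, v, w] = θ 0 u * θ 1 v * θ 2 w - θ 0 u * θ 1 w * θ 2 v -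
      θ 0 v * θ 1 u * θ 2 w + θ 0 v * θ 1 w * θ 2 u + θ 0 w * θ 1 u * θ 2 v -
      θ 0 w * θ 1 v * θ 2 u := by
  rw [detForm_apply, Matrix.det_fin_three]
  simp

theorem twoForm_induction [FiniteDimensional ℝ V] {P : (V [⋀^Fin 2]→ₗ[ℝ] A) → Prop}
    (hdet : ∀ θ, P (detForm θ)) (hadd : ∀ α β, P α → P β → P (α + β))
    (hsmul : ∀ (c : ℝ) α, P α → P (c • α)) (α : V [⋀^Fin 2]→ₗ[ℝ] A) : P α := by
  rw [twoForm_eq_sum_detForm (Module.finBasis ℝ V) α]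
  refine hsmul _ _ (Finset.sum_induction _ P hadd ?_ fun i _ => hdet _)
  simpa using hsmul 0 _ (hdet 0)

/-- By bilinearity both forms may be taken decomposable. The formula is then the Laplace expansion
of a `4 × 4` determinant along its first two rows. -/
theorem algWedge_two_two [FiniteDimensional ℝ V] (α β : V [⋀^Fin 2]→ₗ[ℝ] A) (v : Fin 4 → V) :
    algWedge α β v =
      α ![v 0, v 1] * β ![v 2, v 3] - α ![v 0, v 2] * β ![v 1, v 3] +
      α ![v 0, v 3] * β ![v 1, v 2] + α ![v 1, v 2] * β ![v 0, v 3] -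
      α ![v 1, v 3] * β ![v 0, v 2] + α ![v 2, v 3] * β ![v 0, v 1] := by
  simp only [← algWedgeₗ_apply]
  induction α using twoForm_induction with
  | hadd α α' h h' =>
    simp only [map_add, AlternatingMap.add_apply, LinearMap.add_apply, h, h']
    ring
  | hsmul c α h =>
    simp only [map_smul, AlternatingMap.smul_apply, LinearMap.smul_apply, h, Algebra.smul_def]
    ring
  | hdet θ =>
    induction β using twoForm_induction with
    | hadd α α' h h' =>
      simp only [map_add, AlternatingMap.add_apply, h, h']
      ring
    | hsmul c α h =>
      simp only [map_smul, AlternatingMap.smul_apply, h, Algebra.smul_def]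
      ring
    | hdet φ =>
      rw [algWedgeₗ_apply, algWedge_detForm, detForm_apply]
      refine (det_fin_four _).trans ?_
      simp only [detForm_fin_two]
      rfl

theorem det_fin_five {R : Type*} [CommRing R] (M : Matrix (Fin 5) (Fin 5) R) :
    let d (i j k : Fin 5) : R := M 0 i * M 1 j * M 2 k - M 0 i * M 1 k * M 2 j -
      M 0 j * M 1 i * M 2 k + M 0 j * M 1 k * M 2 i + M 0 k * M 1 i * M 2 j - M 0 k * M 1 j * M 2 i
    let e (i j : Fin 5) : R := M 3 i * M 4 j - M 3 j * M 4 i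
    M.det = d 0 1 2 * e 3 4 - d 0 1 3 * e 2 4 + d 0 1 4 * e 2 3 + d 0 2 3 * e 1 4 -
      d 0 2 4 * e 1 3 + d 0 3 4 * e 1 2 - d 1 2 3 * e 0 4 + d 1 2 4 * e 0 3 - d 1 3 4 * e 0 2 +
      d 2 3 4 * e 0 1 := by
  simp only [Matrix.det_succ_row_zero (n := 4), det_fin_four,
    Fin.sum_univ_succ, Matrix.submatrix_apply, Fin.succAbove, Finset.univ_unique,
    Fin.default_eq_zero, Finset.sum_singleton]
  simp [Fin.lt_def]
  ring

theorem algWedge_three_two [FiniteDimensional ℝ V] (θ : Fin 3 → V →ₗ[ℝ] A)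
    (β : V [⋀^Fin 2]→ₗ[ℝ] A) (v : Fin 5 → V) :
    algWedge (detForm θ) β v =
      detForm θ ![v 0, v 1, v 2] * β ![v 3, v 4] - detForm θ ![v 0, v 1, v 3] * β ![v 2, v 4] +
      detForm θ ![v 0, v 1, v 4] * β ![v 2, v 3] + detForm θ ![v 0, v 2, v 3] * β ![v 1, v 4] -
      detForm θ ![v 0, v 2, v 4] * β ![v 1, v 3] + detForm θ ![v 0, v 3, v 4] * β ![v 1, v 2] -
      detForm θ ![v 1, v 2, v 3] * β ![v 0, v 4] + detForm θ ![v 1, v 2, v 4] * β ![v 0, v 3] -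
      detForm θ ![v 1, v 3, v 4] * β ![v 0, v 2] + detForm θ ![v 2, v 3, v 4] * β ![v 0, v 1] := by
  simp only [← algWedgeₗ_apply]
  induction β using twoForm_induction with
  | hadd α α' h h' =>
    simp only [map_add, AlternatingMap.add_apply, h, h']
    ring
  | hsmul c α h =>
    simp only [map_smul, AlternatingMap.smul_apply, h, Algebra.smul_def]
    ring
  | hdet φ =>
    rw [algWedgeₗ_apply, algWedge_detForm, detForm_apply]
    refine (det_fin_five _).trans ?_
    simp only [detForm_fin_two, detForm_fin_three]
    rfl

end DetForm
end SHF

end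

/-! ### The Chevalley-Eilenberg differential in degrees two, three and four. -/

noncomputable section
open scoped Topology
namespace SHF

section CEDiff
open Nilmanifold
variable {L F : Type*} [Bracket L L] [NormedAddCommGroup F]

theorem ceDiff_two (ℓ : (Fin 2 → L) → F) (v : Fin 3 → L) : ceDiff ℓ v =
    -(ℓ ![⁅v 0, v 1⁆, v 2] - ℓ ![⁅v 0, v 2⁆, v 1] + ℓ ![⁅v 1, v 2⁆, v 0]) := by
  have h0 : Finset.Ici (0 : Fin 2) = {0, 1} := by decide
  have h1 : Finset.Ici (1 : Fin 2) = {1} := by decide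
  refine (congrArg Neg.neg (Fin.sum_univ_two _)).trans ?_
  simp only [h0, h1]
  rw [Finset.sum_pair (by decide), Finset.sum_singleton]
  congr 1
  have e : ∀ (i j : Fin 2) (w : Fin 1 → L), (j.removeNth (i.castSucc.removeNth v)) = w →
      ℓ (Matrix.vecCons ⁅v i.castSucc, v j.succ⁆ (j.removeNth (i.castSucc.removeNth v))) =
      ℓ (Matrix.vecCons ⁅v i.castSucc, v j.succ⁆ w) := by rintro i j w rfl; rfl
  rw [e 0 0 ![v 2] (by ext i; fin_cases i; rfl), e 0 1 ![v 1] (by ext i; fin_cases i; rfl),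
    e 1 1 ![v 0] (by ext i; fin_cases i; rfl)]
  simp
  abel

theorem ceDiff_three (ℓ : (Fin 3 → L) → F) (v : Fin 4 → L) : ceDiff ℓ v =
    -(ℓ ![⁅v 0, v 1⁆, v 2, v 3] - ℓ ![⁅v 0, v 2⁆, v 1, v 3] + ℓ ![⁅v 0, v 3⁆, v 1, v 2] +
      ℓ ![⁅v 1, v 2⁆, v 0, v 3] - ℓ ![⁅v 1, v 3⁆, v 0, v 2] + ℓ ![⁅v 2, v 3⁆, v 0, v 1]) := by
  have h0 : Finset.Ici (0 : Fin 3) = {0, 1, 2} := by decide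
  have h1 : Finset.Ici (1 : Fin 3) = {1, 2} := by decide
  have h2 : Finset.Ici (2 : Fin 3) = {2} := by decide
  refine (congrArg Neg.neg (Fin.sum_univ_three _)).trans ?_
  simp only [h0, h1, h2]
  rw [Finset.sum_insert (by decide), Finset.sum_pair (by decide), Finset.sum_pair (by decide),
    Finset.sum_singleton]
  congr 1
  have e : ∀ (i j : Fin 3) (w : Fin 2 → L), (j.removeNth (i.castSucc.removeNth v)) = w →
      ℓ (Matrix.vecCons ⁅v i.castSucc, v j.succ⁆ (j.removeNth (i.castSucc.removeNth v))) =
      ℓ (Matrix.vecCons ⁅v i.castSucc, v j.succ⁆ w) := by rintro i j w rfl; rfl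
  rw [e 0 0 ![v 2, v 3] (by ext i; fin_cases i <;> rfl),
    e 0 1 ![v 1, v 3] (by ext i; fin_cases i <;> rfl),
    e 0 2 ![v 1, v 2] (by ext i; fin_cases i <;> rfl),
    e 1 1 ![v 0, v 3] (by ext i; fin_cases i <;> rfl),
    e 1 2 ![v 0, v 2] (by ext i; fin_cases i <;> rfl),
    e 2 2 ![v 0, v 1] (by ext i; fin_cases i <;> rfl)]
  have t : (2 : Fin 3).succ = 3 := rfl
  have t' : (2 : Fin 3).castSucc = 2 := rfl
  have t2 : (1 : Fin 3).succ = 2 := rfl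
  simp [t, t', t2]
  abel

theorem ceDiff_four (ℓ : (Fin 4 → L) → F) (v : Fin 5 → L) : ceDiff ℓ v =
    -(ℓ ![⁅v 0, v 1⁆, v 2, v 3, v 4] - ℓ ![⁅v 0, v 2⁆, v 1, v 3, v 4] +
      ℓ ![⁅v 0, v 3⁆, v 1, v 2, v 4] - ℓ ![⁅v 0, v 4⁆, v 1, v 2, v 3] +
      ℓ ![⁅v 1, v 2⁆, v 0, v 3, v 4] - ℓ ![⁅v 1, v 3⁆, v 0, v 2, v 4] +
      ℓ ![⁅v 1, v 4⁆, v 0, v 2, v 3] + ℓ ![⁅v 2, v 3⁆, v 0, v 1, v 4] -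
      ℓ ![⁅v 2, v 4⁆, v 0, v 1, v 3] + ℓ ![⁅v 3, v 4⁆, v 0, v 1, v 2]) := by
  have h0 : Finset.Ici (0 : Fin 4) = {0, 1, 2, 3} := by decide
  have h1 : Finset.Ici (1 : Fin 4) = {1, 2, 3} := by decide
  have h2 : Finset.Ici (2 : Fin 4) = {2, 3} := by decide
  have h3 : Finset.Ici (3 : Fin 4) = {3} := by decide
  refine (congrArg Neg.neg (Fin.sum_univ_four _)).trans ?_
  simp only [h0, h1, h2, h3]
  rw [Finset.sum_insert (by decide), Finset.sum_insert (by decide), Finset.sum_pair (by decide),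
    Finset.sum_insert (by decide), Finset.sum_pair (by decide), Finset.sum_pair (by decide),
    Finset.sum_singleton]
  congr 1
  have e : ∀ (i j : Fin 4) (w : Fin 3 → L), (j.removeNth (i.castSucc.removeNth v)) = w →
      ℓ (Matrix.vecCons ⁅v i.castSucc, v j.succ⁆ (j.removeNth (i.castSucc.removeNth v))) =
      ℓ (Matrix.vecCons ⁅v i.castSucc, v j.succ⁆ w) := by rintro i j w rfl; rfl
  rw [e 0 0 ![v 2, v 3, v 4] (by ext i; fin_cases i <;> rfl),
    e 0 1 ![v 1, v 3, v 4] (by ext i; fin_cases i <;> rfl),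
    e 0 2 ![v 1, v 2, v 4] (by ext i; fin_cases i <;> rfl),
    e 0 3 ![v 1, v 2, v 3] (by ext i; fin_cases i <;> rfl),
    e 1 1 ![v 0, v 3, v 4] (by ext i; fin_cases i <;> rfl),
    e 1 2 ![v 0, v 2, v 4] (by ext i; fin_cases i <;> rfl),
    e 1 3 ![v 0, v 2, v 3] (by ext i; fin_cases i <;> rfl),
    e 2 2 ![v 0, v 1, v 4] (by ext i; fin_cases i <;> rfl),
    e 2 3 ![v 0, v 1, v 3] (by ext i; fin_cases i <;> rfl),
    e 3 3 ![v 0, v 1, v 2] (by ext i; fin_cases i <;> rfl)]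
  have t : (2 : Fin 4).succ = 3 := rfl
  have t' : (2 : Fin 4).castSucc = 2 := rfl
  have t3 : (3 : Fin 4).succ = 4 := rfl
  have t4 : (3 : Fin 4).castSucc = 3 := rfl
  have t2 : (1 : Fin 4).succ = 2 := rfl
  simp [t, t', t2, t3, t4, pow_succ]
  abel

end CEDiff

theorem twoForm_swap {V A : Type*} [AddCommGroup V] [Module ℝ V] [CommRing A] [Algebra ℝ A]
    (α : V [⋀^Fin 2]→ₗ[ℝ] A) (v w : V) : α ![v, w] = -α ![w, v] := by
  rw [← AlternatingMap.map_swap α ![w, v] (i := 0) (j := 1) (by simp)]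
  congr 1
  funext i
  fin_cases i <;> simp

/-- This is `d(ω ∧ ω) = 2 dω ∧ ω`, carried out by substituting the cyclic relation `dω = 0` into
each of the ten bracket terms. -/
theorem ceDiff_wedge_self {L : Type*} [AddCommGroup L] [Module ℝ L] [TopologicalSpace L]
    [Bracket L L] [FiniteDimensional ℝ L] {ω : L [⋀^Fin 2]→L[ℝ] ℝ}
    (h : ∀ v, Nilmanifold.ceDiff ω v = 0) (v : Fin 5 → L) :
    Nilmanifold.ceDiff (n := 3) (wedge ω ω) v = 0 := by
  have hw : ∀ a b c d : L, wedge ω ω ![a, b, c, d] =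
      2 * (ω ![a, b] * ω ![c, d] - ω ![a, c] * ω ![b, d] + ω ![a, d] * ω ![b, c]) := by
    intro a b c d
    refine (algWedge_two_two ω.toAlternatingMap ω.toAlternatingMap ![a, b, c, d]).trans ?_
    change ω ![a, b] * ω ![c, d] - ω ![a, c] * ω ![b, d] + ω ![a, d] * ω ![b, c] +
      ω ![b, c] * ω ![a, d] - ω ![b, d] * ω ![a, c] + ω ![c, d] * ω ![a, b] = _
    ring
  have hs : ∀ a b : L, ω ![a, b] = -ω ![b, a] := twoForm_swap ω.toAlternatingMap
  have hd : ∀ i j k : Fin 5, ω ![⁅v i, v j⁆, v k] =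
      ω ![⁅v i, v k⁆, v j] - ω ![⁅v j, v k⁆, v i] := by
    intro i j k
    have := h ![v i, v j, v k]
    rw [ceDiff_two] at this
    simp at this
    linear_combination -this
  rw [ceDiff_four]
  simp only [hw]
  rw [hd 0 1 2, hd 0 1 3, hd 0 1 4, hd 0 2 3, hd 0 2 4, hd 0 3 4, hd 1 2 3, hd 1 2 4, hd 1 3 4,
    hd 2 3 4]
  ring

end SHF

end

/-! ### Diagonal two-step Lie algebras and their classification. -/

noncomputable section
open scoped Topology
namespace SHF

section HasDiag
variable {L L' : Type*} [LieRing L] [LieAlgebra ℝ L] [LieRing L'] [LieAlgebra ℝ L']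

/-- `L` has a basis `u₀, u₁, u₂, c₀, c₁, c₂` whose only non-zero brackets, up to antisymmetry, are
`⁅u₁, u₂⁆ = s₀ c₀`, `⁅u₂, u₀⁆ = s₁ c₁` and `⁅u₀, u₁⁆ = s₂ c₂`. -/
def HasDiag (L : Type*) [LieRing L] [LieAlgebra ℝ L] (s : Fin 3 → ℝ) : Prop :=
  ∃ b : Module.Basis (Fin 6) ℝ L, ∀ x y : L, ⁅x, y⁆ =
    (s 0 * (b.coord 1 x * b.coord 2 y - b.coord 2 x * b.coord 1 y)) • b 3 +
    (s 1 * (b.coord 2 x * b.coord 0 y - b.coord 0 x * b.coord 2 y)) • b 4 +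
    (s 2 * (b.coord 0 x * b.coord 1 y - b.coord 1 x * b.coord 0 y)) • b 5

theorem HasDiag.of_basis {s : Fin 3 → ℝ} (b : Module.Basis (Fin 6) ℝ L)
    (h0 : ⁅b 1, b 2⁆ = s 0 • b 3) (h1 : ⁅b 2, b 0⁆ = s 1 • b 4) (h2 : ⁅b 0, b 1⁆ = s 2 • b 5)
    (h3 : ∀ i, ⁅b 3, b i⁆ = 0) (h4 : ∀ i, ⁅b 4, b i⁆ = 0) (h5 : ∀ i, ⁅b 5, b i⁆ = 0) :
    HasDiag L s := by
  have k0 : ⁅b 2, b 1⁆ = -(s 0 • b 3) := by rw [← h0, lie_skew]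
  have k1 : ⁅b 0, b 2⁆ = -(s 1 • b 4) := by rw [← h1, lie_skew]
  have k2 : ⁅b 1, b 0⁆ = -(s 2 • b 5) := by rw [← h2, lie_skew]
  have k3 : ∀ i, ⁅b i, b 3⁆ = 0 := fun i => by rw [← lie_skew, h3, neg_zero]
  have k4 : ∀ i, ⁅b i, b 4⁆ = 0 := fun i => by rw [← lie_skew, h4, neg_zero]
  have k5 : ∀ i, ⁅b i, b 5⁆ = 0 := fun i => by rw [← lie_skew, h5, neg_zero]
  refine ⟨b, fun x y => ?_⟩
  conv_lhs => rw [← b.sum_repr x, ← b.sum_repr y]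
  simp only [Fin.sum_univ_six, lie_add, add_lie, smul_lie, lie_smul, h0, h1, h2, h3, h4, h5, k0, k1,
    k2, k3, k4, k5, lie_self, Module.Basis.coord_apply]
  module

theorem HasDiag.map {s : Fin 3 → ℝ} (h : HasDiag L s) (e : L ≃ₗ⁅ℝ⁆ L') : HasDiag L' s := by
  obtain ⟨b, hb⟩ := h
  refine ⟨b.map e.toLinearEquiv, fun x y => ?_⟩
  have := congrArg e (hb (e.symm x) (e.symm y))
  rw [LieEquiv.map_lie, e.apply_symm_apply, e.apply_symm_apply] at this
  rw [this]
  simp only [map_add, map_smul]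
  rfl

theorem HasDiag.rotate {s : Fin 3 → ℝ} (h : HasDiag L s) : HasDiag L ![s 1, s 2, s 0] := by
  obtain ⟨b, hb⟩ := h
  let σ : Equiv.Perm (Fin 6) := ⟨![1, 2, 0, 4, 5, 3], ![2, 0, 1, 5, 3, 4], by decide, by decide⟩
  refine ⟨b.reindex σ.symm, fun x y => ?_⟩
  have h1 : ∀ i, b.reindex σ.symm i = b (σ i) := fun i => by simp
  have h2 : ∀ i x, (b.reindex σ.symm).coord i x = b.coord (σ i) x := fun i x => by simp
  simp only [h1, h2, hb]
  simp [σ]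
  module

theorem HasDiag.rescale {s : Fin 3 → ℝ} (h : HasDiag L s) (c : Fin 3 → ℝˣ) :
    HasDiag L fun i => c i * s i := by
  obtain ⟨b, hb⟩ := h
  refine ⟨b.unitsSMul ![1, 1, 1, (c 0)⁻¹, (c 1)⁻¹, (c 2)⁻¹], fun x y => ?_⟩
  simp only [Module.Basis.coord_unitsSMul, Module.Basis.unitsSMul_apply, hb]
  simp [Units.smul_def, smul_smul]
  congr 2
  · congr 1
    field_simp
  · congr 1
    field_simp
  · field_simp

theorem exists_basis_coord_eq [FiniteDimensional ℝ L] {ι : Type*} [Finite ι]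
    (η : Module.Basis ι ℝ (Module.Dual ℝ L)) : ∃ b : Module.Basis ι ℝ L, ∀ i, b.coord i = η i := by
  classical
  have := Fintype.ofFinite ι
  refine ⟨η.dualBasis.map (Module.evalEquiv ℝ L).symm, fun i => ?_⟩
  refine Module.Basis.ext (η.dualBasis.map (Module.evalEquiv ℝ L).symm) fun j => ?_
  rw [Module.Basis.coord_apply, Module.Basis.repr_self, Module.Basis.map_apply]
  have : η i ((Module.evalEquiv ℝ L).symm (η.dualBasis j)) = η.dualBasis j (η i) := by
    simp
  rw [this, Module.Basis.dualBasis_apply_self, Finsupp.single_apply]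
  simp [eq_comm]

theorem hasDiag_iff_exists_dual [FiniteDimensional ℝ L] {s : Fin 3 → ℝ} : HasDiag L s ↔
    ∃ η : Module.Basis (Fin 6) ℝ (Module.Dual ℝ L), (fun i => dOne (η i)) =
      ![0, 0, 0, -s 0 • wedgeOne (η 1) (η 2), s 1 • wedgeOne (η 0) (η 2),
        -s 2 • wedgeOne (η 0) (η 1)] := by
  constructor
  · rintro ⟨b, hb⟩
    refine ⟨b.dualBasis, ?_⟩
    funext i x y
    simp only [dOne, Module.Basis.coe_dualBasis, hb]
    fin_cases i <;> simp [wedgeOne]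
    · ring_nf
      simp
    · ring
    · ring_nf
      simp
  · rintro ⟨η, hη⟩
    obtain ⟨b, hb⟩ := exists_basis_coord_eq η
    refine ⟨b, fun x y => b.ext_elem fun i => ?_⟩
    have := congrFun (congrFun (congrFun hη i) x) y
    simp only [← hb, dOne] at this
    change b.coord i _ = b.coord i _
    rw [neg_eq_iff_eq_neg.mp this]
    fin_cases i <;> simp [wedgeOne]
    · ring_nf
      simp
    · ring
    · ring_nf
      simp

/-- Each central basis vector can be rescaled independently, so a non-zero coefficient may be given
any non-zero value. -/
theorem HasDiag.of_support {s t : Fin 3 → ℝ} (h : HasDiag L s) (hst : ∀ i, s i = 0 ↔ t i = 0) :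
    HasDiag L t := by
  have : ∀ i, ∃ c : ℝˣ, c * s i = t i := by
    intro i
    by_cases hi : s i = 0
    · exact ⟨1, by simp [hi, (hst i).1 hi]⟩
    · exact ⟨Units.mk0 (t i / s i) (div_ne_zero (fun h => hi ((hst i).2 h)) hi), by
        simp [div_mul_cancel₀ _ hi]⟩
  choose c hc using this
  simpa only [hc] using h.rescale c

theorem is000000_iff [FiniteDimensional ℝ L] : Is000000 L ↔ HasDiag L 0 := by
  rw [hasDiag_iff_exists_dual, Is000000]
  simp

theorem is00001213_iff [FiniteDimensional ℝ L] : Is00001213 L ↔ HasDiag L ![0, 1, -1] := by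
  rw [hasDiag_iff_exists_dual, Is00001213]
  constructor
  all_goals
    rintro ⟨η, hη⟩
    refine ⟨η.reindex (Equiv.swap 4 5), ?_⟩
    have h : ∀ i, η.reindex (Equiv.swap 4 5) i = η (Equiv.swap 4 5 i) := fun i => by simp
    funext i
    have := congrFun hη (Equiv.swap 4 5 i)
    simp only [h]
    rw [this]
    fin_cases i <;> simp [Equiv.swap_apply_def]

/-- The symbolic expression corresponds directly to the coefficients `(-1, 1, -1)`. The
representative `(1, 1, -2)` has the same support and, in addition, sum zero. -/
theorem is000121323_iff [FiniteDimensional ℝ L] : Is000121323 L ↔ HasDiag L ![1, 1, -2] := by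
  have h : HasDiag L ![1, 1, -2] ↔ HasDiag L ![-1, 1, -1] := by
    constructor <;> intro h <;> refine h.of_support fun i => ?_ <;> fin_cases i <;> simp
  rw [h, hasDiag_iff_exists_dual, Is000121323]
  constructor
  all_goals
    rintro ⟨η, hη⟩
    refine ⟨η.reindex (Equiv.swap 3 5), ?_⟩
    have h : ∀ i, η.reindex (Equiv.swap 3 5) i = η (Equiv.swap 3 5 i) := fun i => by simp
    funext i
    have := congrFun hη (Equiv.swap 3 5 i)
    simp only [h]
    rw [this]
    fin_cases i <;> simp [Equiv.swap_apply_def]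

theorem HasDiag.of_eq_zero {s : Fin 3 → ℝ} (h : HasDiag L s) (hs : s 0 + s 1 + s 2 = 0)
    (h0 : s 0 = 0) : HasDiag L 0 ∨ HasDiag L ![0, 1, -1] := by
  by_cases h1 : s 1 = 0
  · left
    refine h.of_support fun i => ?_
    have h2 : s 2 = 0 := by linarith
    fin_cases i <;> simp [*]
  · right
    refine h.of_support fun i => ?_
    have h2 : s 2 ≠ 0 := fun h2 => h1 (by linarith)
    fin_cases i <;> simp [*]

/-- Only the support of `s` matters. If some `s i` is zero, a cyclic rotation makes it the first
one, and the other two are then opposite to each other. -/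
theorem exists_hasDiag_iff : (∃ s : Fin 3 → ℝ, s 0 + s 1 + s 2 = 0 ∧ HasDiag L s) ↔
    HasDiag L 0 ∨ HasDiag L ![0, 1, -1] ∨ HasDiag L ![1, 1, -2] := by
  constructor
  · rintro ⟨s, hs, h⟩
    by_cases h0 : s 0 = 0
    · exact (h.of_eq_zero hs h0).imp_right Or.inl
    by_cases h1 : s 1 = 0
    · exact (h.rotate.of_eq_zero (by simp; linarith) h1).imp_right Or.inl
    by_cases h2 : s 2 = 0
    · exact (h.rotate.rotate.of_eq_zero (by simp; linarith) h2).imp_right Or.inl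
    refine Or.inr (Or.inr (h.of_support fun i => ?_))
    fin_cases i <;> simp [*]
  · rintro (h | h | h)
    · exact ⟨_, by simp, h⟩
    · exact ⟨_, by simp, h⟩
    · exact ⟨_, by simp; norm_num, h⟩

end HasDiag
end SHF

end

/-! ### Symplectic bases and the cube of a non-degenerate two-form. -/

noncomputable section
open scoped Topology
namespace SHF

section Cube
variable {V A : Type*} [AddCommGroup V] [Module ℝ V] [CommRing A] [Algebra ℝ A]

theorem detForm_perm {k : ℕ} (θ : Fin k → V →ₗ[ℝ] A) (σ : Equiv.Perm (Fin k)) :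
    detForm (θ ∘ σ) = (Equiv.Perm.sign σ : ℤ) • detForm θ := by
  ext v
  rw [AlternatingMap.smul_apply, detForm_apply, detForm_apply, zsmul_eq_mul]
  exact Matrix.det_permute σ (Matrix.of fun i j => θ i (v j))

theorem detForm_eq_zero {k : ℕ} {θ : Fin k → V →ₗ[ℝ] A} {i j : Fin k} (h : θ i = θ j)
    (hij : i ≠ j) : detForm θ = 0 := by
  ext v
  rw [detForm_apply]
  exact Matrix.det_zero_of_row_eq hij (by ext l; simp [h])

/-- The two-forms `xₖ ∧ yₖ` commute and have square zero, so only the six products of three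
different ones survive, and these are all equal. -/
theorem algWedge_cube (x y : Fin 3 → V →ₗ[ℝ] A) :
    algWedge (algWedge (∑ k, detForm ![x k, y k]) (∑ k, detForm ![x k, y k]))
      (∑ k, detForm ![x k, y k]) = (6 : ℤ) • detForm ![x 0, y 0, x 1, y 1, x 2, y 2] := by
  have h : ∀ i j k, algWedge (algWedge (detForm ![x i, y i]) (detForm ![x j, y j]))
      (detForm ![x k, y k]) = detForm ![x i, y i, x j, y j, x k, y k] := by
    intro i j k
    rw [algWedge_detForm, algWedge_detForm]
    refine congrArg detForm ?_
    funext l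
    fin_cases l <;> rfl
  have h1 : ∀ i k, detForm ![x i, y i, x i, y i, x k, y k] = 0 := fun i k =>
    detForm_eq_zero (i := 0) (j := 2) rfl (by decide)
  have h2 : ∀ i k, detForm ![x i, y i, x k, y k, x i, y i] = 0 := fun i k =>
    detForm_eq_zero (i := 0) (j := 4) rfl (by decide)
  have h3 : ∀ i k, detForm ![x k, y k, x i, y i, x i, y i] = 0 := fun i k =>
    detForm_eq_zero (i := 2) (j := 4) rfl (by decide)
  have h4 : ∀ i j k, detForm ![x j, y j, x i, y i, x k, y k] =
      detForm ![x i, y i, x j, y j, x k, y k] := by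
    intro i j k
    have := detForm_perm ![x i, y i, x j, y j, x k, y k] (Equiv.swap 0 2 * Equiv.swap 1 3)
    have hs : Equiv.Perm.sign (Equiv.swap 0 2 * Equiv.swap 1 3 : Equiv.Perm (Fin 6)) = 1 := by
      decide
    rw [hs, Units.val_one, one_smul] at this
    rw [← this]
    refine congrArg detForm ?_
    funext l
    fin_cases l <;> rfl
  have h5 : ∀ i j k, detForm ![x i, y i, x k, y k, x j, y j] =
      detForm ![x i, y i, x j, y j, x k, y k] := by
    intro i j k
    have := detForm_perm ![x i, y i, x j, y j, x k, y k] (Equiv.swap 2 4 * Equiv.swap 3 5)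
    have hs : Equiv.Perm.sign (Equiv.swap 2 4 * Equiv.swap 3 5 : Equiv.Perm (Fin 6)) = 1 := by
      decide
    rw [hs, Units.val_one, one_smul] at this
    rw [← this]
    refine congrArg detForm ?_
    funext l
    fin_cases l <;> rfl
  simp only [← algWedgeₗ_apply] at h ⊢
  simp only [Fin.sum_univ_three, map_add, LinearMap.add_apply,
    h, h1, h2, h3]
  rw [h5 0 1 2, h4 0 1 2, h5 1 0 2, h4 0 1 2, h4 0 2 1, h5 0 1 2, h5 2 0 1, h4 0 2 1, h5 0 1 2]
  generalize hD : detForm ![x 0, y 0, x 1, y 1, x 2, y 2] = D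
  have : ∀ D : V [⋀^Fin 6]→ₗ[ℝ] A, (6 : ℤ) • D = D + D + D + D + D + D := fun D => by abel
  refine Eq.trans ?_ (this D).symm
  simp only [zero_add, add_zero]
  abel

end Cube

section Symplectic
variable {V : Type*} [AddCommGroup V] [Module ℝ V]

/-- Symplectic Gram-Schmidt: while `2 n < dim V`, some non-zero `a` is `ω`-orthogonal to the pairs
found so far, and non-degeneracy provides a partner for it. -/
theorem exists_symplectic_pairs [FiniteDimensional ℝ V] {ω : V [⋀^Fin 2]→ₗ[ℝ] ℝ}
    (h : ∀ v, (∀ w, ω ![v, w] = 0) → v = 0) (n : ℕ) (hn : 2 * n ≤ Module.finrank ℝ V) :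
    ∃ p q : Fin n → V, (∀ i j, ω ![p i, p j] = 0) ∧ (∀ i j, ω ![q i, q j] = 0) ∧
      ∀ i j, ω ![p i, q j] = if i = j then 1 else 0 := by
  have h00 : ∀ a, ω ![a, a] = 0 := fun a => by
    have := twoForm_swap ω a a
    linarith
  induction n with
  | zero => exact ⟨0, 0, fun i => i.elim0, fun i => i.elim0, fun i => i.elim0⟩
  | succ n ih =>
    obtain ⟨p, q, h1, h2, h3⟩ := ih (by omega)
    let f : V →ₗ[ℝ] (Fin n ⊕ Fin n → ℝ) :=
      LinearMap.pi fun i => contract ω (Sum.elim p q i)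
    obtain ⟨a, ha, ha0⟩ := (Submodule.ne_bot_iff _).1 (LinearMap.ker_ne_bot_of_finrank_lt
      (f := f) (by simp; omega))
    have hap : ∀ i, ω ![p i, a] = 0 := fun i => by
      rw [← contract_apply]
      exact congrFun (LinearMap.mem_ker.1 ha) (Sum.inl i)
    have haq : ∀ i, ω ![q i, a] = 0 := fun i => by
      rw [← contract_apply]
      exact congrFun (LinearMap.mem_ker.1 ha) (Sum.inr i)
    obtain ⟨w, hw⟩ : ∃ w, ω ![a, w] ≠ 0 := by
      by_contra! hc
      exact ha0 (h a hc)
    -- The partner `w`, made orthogonal to the earlier pairs and normalised. The opposite signs of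
    -- the two sums come from `ω(qᵢ, pᵢ) = -1`.
    let c := (ω ![a, w])⁻¹ • (w - ∑ i, contract ω (p i) w • q i + ∑ i, contract ω (q i) w • p i)
    have hc : ∀ x, ω ![x, c] = (ω ![a, w])⁻¹ * (ω ![x, w] - ∑ i, ω ![p i, w] * ω ![x, q i] +
        ∑ i, ω ![q i, w] * ω ![x, p i]) := by
      intro x
      simp only [← contract_apply, c]
      simp [mul_comm, mul_add]
    have hac : ω ![a, c] = 1 := by
      simp [hc, twoForm_swap ω a (p _), twoForm_swap ω a (q _), hap, haq, hw]
    have hpc : ∀ i, ω ![p i, c] = 0 := by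
      intro i
      simp [hc, h1, h3]
    have hqc : ∀ i, ω ![q i, c] = 0 := by
      intro i
      simp [hc, h2, twoForm_swap ω (q _) (p _), h3]
    refine ⟨Fin.snoc p a, Fin.snoc q c, ?_, ?_, ?_⟩
    all_goals
      intro i j
      induction i using Fin.lastCases <;> induction j using Fin.lastCases
      all_goals simp [h1, h2, h3, h00, hap, haq, hac, hpc, hqc, twoForm_swap ω a (p _),
        twoForm_swap ω a (q _), twoForm_swap ω c (q _), Fin.ext_iff,
        (Fin.castSucc_ne_last _).symm]
    exact (Fin.is_lt _).ne

theorem exists_basis_of_symplectic_pairs [FiniteDimensional ℝ V] {ω : V [⋀^Fin 2]→ₗ[ℝ] ℝ} {n : ℕ}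
    (hV : Module.finrank ℝ V = n + n) (p q : Fin n → V) (h1 : ∀ i j, ω ![p i, p j] = 0)
    (h2 : ∀ i j, ω ![q i, q j] = 0) (h3 : ∀ i j, ω ![p i, q j] = if i = j then 1 else 0) :
    ∃ b : Module.Basis (Fin n ⊕ Fin n) ℝ V, ⇑b = Sum.elim p q ∧
      ω = ∑ k, detForm ![b.coord (Sum.inl k), b.coord (Sum.inr k)] := by
  let x : Fin n → V →ₗ[ℝ] ℝ := fun k => -contract ω (q k)
  let y : Fin n → V →ₗ[ℝ] ℝ := fun k => contract ω (p k)
  have hx : ∀ k v, x k v = -ω ![q k, v] := fun k v => by simp [x, contract_apply]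
  have hy : ∀ k v, y k v = ω ![p k, v] := fun k v => contract_apply ..
  have hxp : ∀ i j, x i (p j) = if i = j then 1 else 0 := fun i j => by
    rw [hx, ← twoForm_swap, h3]
    simp [eq_comm]
  have hxq : ∀ i j, x i (q j) = 0 := fun i j => by simp [hx, h2]
  have hyp : ∀ i j, y i (p j) = 0 := fun i j => by simp [hy, h1]
  have hyq : ∀ i j, y i (q j) = if i = j then 1 else 0 := fun i j => by rw [hy, h3]
  have hli : LinearIndependent ℝ (Sum.elim p q) :=
    LinearIndependent.of_pairwise_dual_eq_zero_one _ (Sum.elim x y)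
      (by rintro (i | i) (j | j) hij <;> simp [hxp, hxq, hyp, hyq] <;> rintro rfl <;> exact hij rfl)
      (by rintro (i | i) <;> simp [hxp, hyq])
  let b : Module.Basis (Fin n ⊕ Fin n) ℝ V := Module.Basis.mk hli
    (hli.span_eq_top_of_card_eq_finrank' (by simp [hV])).ge
  have hb : ∀ i, b i = Sum.elim p q i := fun i => Module.Basis.mk_apply ..
  refine ⟨b, funext hb, Module.Basis.ext_alternating b fun v hv => ?_⟩
  have : ∀ a c : V, (∑ k, detForm ![b.coord (Sum.inl k), b.coord (Sum.inr k)]) ![a, c] =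
      ∑ k, (b.coord (Sum.inl k) a * b.coord (Sum.inr k) c -
        b.coord (Sum.inl k) c * b.coord (Sum.inr k) a) := fun a c => by
    rw [alternatingMap_sum_apply]
    simp [detForm_fin_two]
  have hv2 : (fun i => b (v i)) = ![b (v 0), b (v 1)] := by
    funext i
    fin_cases i <;> rfl
  have hc : ∀ i j, b.coord i (b j) = if j = i then 1 else 0 := fun i j => by
    rw [Module.Basis.coord_apply, Module.Basis.repr_self, Finsupp.single_apply]
  rw [hv2, this]
  simp only [hc]
  rw [hb, hb]
  rcases v 0 with i | i <;> rcases v 1 with j | j <;>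
    simp [h1, h2, h3, twoForm_swap ω (q _) (p _)]

theorem cube_ne_zero {ω : V [⋀^Fin 2]→ₗ[ℝ] ℝ}
    (h : ∀ v, (∀ w, ω ![v, w] = 0) → v = 0) (hV : Module.finrank ℝ V = 6) :
    algWedge (algWedge ω ω) ω ≠ 0 := by
  have : FiniteDimensional ℝ V := Module.finite_of_finrank_eq_succ hV
  obtain ⟨p, q, h1, h2, h3⟩ := exists_symplectic_pairs h 3 (by omega)
  obtain ⟨b, hb, hω⟩ := exists_basis_of_symplectic_pairs hV p q h1 h2 h3
  let e : Fin 6 → Fin 3 ⊕ Fin 3 :=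
    ![Sum.inl 0, Sum.inr 0, Sum.inl 1, Sum.inr 1, Sum.inl 2, Sum.inr 2]
  rw [hω, algWedge_cube (fun k => b.coord (Sum.inl k)) (fun k => b.coord (Sum.inr k))]
  intro h0
  have hd : (Matrix.of fun i j => ![b.coord (Sum.inl 0), b.coord (Sum.inr 0), b.coord (Sum.inl 1),
      b.coord (Sum.inr 1), b.coord (Sum.inl 2), b.coord (Sum.inr 2)] i (b (e j))) =
      (1 : Matrix (Fin 6) (Fin 6) ℝ) := by
    ext i j
    fin_cases i <;> fin_cases j <;> simp [e]
  have := DFunLike.congr_fun h0 fun i => b (e i)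
  rw [AlternatingMap.smul_apply, detForm_apply, hd] at this
  simp at this

end Symplectic
end SHF

end

/-! ### The complex structure of a linear `SU(3)`-structure. -/

noncomputable section
open scoped Topology
namespace SHF

section Complex
variable {V : Type*} [AddCommGroup V] [Module ℝ V]

/-- The vectors `(2 k, 2 k + 1)`-th coordinates combined to complex linear forms. -/
def complexCoord (b : Module.Basis (Fin 6) ℝ V) : Fin 3 → V →ₗ[ℝ] ℂ :=
  ![(Algebra.linearMap ℝ ℂ).comp (b.coord 0) + Complex.I • (Algebra.linearMap ℝ ℂ).comp (b.coord 1),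
    (Algebra.linearMap ℝ ℂ).comp (b.coord 2) + Complex.I • (Algebra.linearMap ℝ ℂ).comp (b.coord 3),
    (Algebra.linearMap ℝ ℂ).comp (b.coord 4) + Complex.I • (Algebra.linearMap ℝ ℂ).comp (b.coord 5)]

/-- Three vectors with non-zero complex determinant solve `θ(x) = z` with complex coefficients `c`.
The map `J` realises multiplication by `i`, so `x` can be formed in the real space `V`. -/
theorem surjective_of_detForm_ne_zero {θ : Fin 3 → V →ₗ[ℝ] ℂ} {J : V →ₗ[ℝ] V}
    (hJ : ∀ i v, θ i (J v) = Complex.I * θ i v) (h : detForm θ ≠ 0) :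
    Function.Surjective (LinearMap.pi θ) := by
  obtain ⟨v, hv⟩ : ∃ v, detForm θ v ≠ 0 := by
    by_contra! hc
    exact h (AlternatingMap.ext hc)
  rw [detForm_apply] at hv
  set M := Matrix.of fun i j => θ i (v j) with hM
  intro z
  let c := M⁻¹.mulVec z
  have hc : M.mulVec c = z := by
    rw [Matrix.mulVec_mulVec, Matrix.mul_nonsing_inv _ (isUnit_iff_ne_zero.2 hv), Matrix.one_mulVec]
  refine ⟨∑ j, ((c j).re • v j + (c j).im • J (v j)), ?_⟩
  rw [← hc]
  funext i
  simp only [LinearMap.pi_apply, map_sum, map_add, map_smul, hJ, Matrix.mulVec, dotProduct, hM,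
    Matrix.of_apply, Complex.real_smul]
  refine Finset.sum_congr rfl fun j _ => ?_
  conv_rhs => rw [← Complex.re_add_im (c j)]
  ring

theorem exists_detForm_ne_zero {θ : Fin 3 → V →ₗ[ℝ] ℂ}
    (hs : Function.Surjective (LinearMap.pi θ)) {v : V} (hv : LinearMap.pi θ v ≠ 0) :
    ∃ x u, detForm θ ![v, x, u] ≠ 0 := by
  have hs' : ∀ z : Fin 3 → ℂ, ∃ x, ∀ i, θ i x = z i := fun z => by
    obtain ⟨x, hx⟩ := hs z
    exact ⟨x, fun i => congrFun hx i⟩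
  obtain ⟨e0, h0⟩ := hs' ![1, 0, 0]
  obtain ⟨e1, h1⟩ := hs' ![0, 1, 0]
  obtain ⟨e2, h2⟩ := hs' ![0, 0, 1]
  obtain ⟨i, hi⟩ : ∃ i, θ i v ≠ 0 := by
    by_contra! hc
    exact hv (funext hc)
  fin_cases i
  · exact ⟨e1, e2, by rw [detForm_fin_three]; simpa [h0, h1, h2] using hi⟩
  · exact ⟨e0, e2, by rw [detForm_fin_three]; simpa [h0, h1, h2] using hi⟩
  · exact ⟨e0, e1, by rw [detForm_fin_three]; simpa [h0, h1, h2] using hi⟩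

/-- The condition `Ψ ∧ ω = 0` says that `ω` is of type `(1,1)`, that is, `J`-invariant. Evaluated on
`v, Jv, w, Jw, u` it is `Ψ(v, w, u)` times a complex number with real part `ω(v, w) - ω(Jv, Jw)`. -/
theorem compatible_of_detForm_ne_zero [FiniteDimensional ℝ V] {θ : Fin 3 → V →ₗ[ℝ] ℂ}
    {J : V →ₗ[ℝ] V} (hJ : ∀ i v, θ i (J v) = Complex.I * θ i v) {ω : V [⋀^Fin 2]→ₗ[ℝ] ℝ}
    {β : V [⋀^Fin 2]→ₗ[ℝ] ℂ} (hβ : ∀ v, β v = ω v) (h : algWedge (detForm θ) β = 0) {v w u : V}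
    (hne : detForm θ ![v, w, u] ≠ 0) : ω ![J v, J w] = ω ![v, w] := by
  have h1 := algWedge_three_two θ β ![v, J v, w, J w, u]
  rw [h] at h1
  simp only [Matrix.cons_val, AlternatingMap.zero_apply, hβ] at h1
  have e : detForm θ ![v, w, u] * ((ω ![v, w] - ω ![J v, J w] : ℝ) +
      (ω ![v, J w] + ω ![J v, w] : ℝ) * Complex.I) = 0 := by
    rw [h1]
    simp only [detForm_fin_three, hJ]
    push_cast
    have hI := Complex.I_mul_I
    linear_combination (θ 0 v * θ 1 w * θ 2 u - θ 0 v * θ 1 u * θ 2 w -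
      θ 0 w * θ 1 v * θ 2 u + θ 0 w * θ 1 u * θ 2 v + θ 0 u * θ 1 v * θ 2 w -
      θ 0 u * θ 1 w * θ 2 v) * ω ![v, w] * hI
  have h2 := congrArg Complex.re ((mul_eq_zero.1 e).resolve_left hne)
  simp at h2
  linarith

end Complex

section Facts
variable {V : Type*} [AddCommGroup V] [Module ℝ V] [TopologicalSpace V]

theorem wedge_toAlternatingMap {A : Type*} [CommRing A] [Algebra ℝ A] [TopologicalSpace A]
    [IsTopologicalRing A] {k l : ℕ} (α : V [⋀^Fin k]→L[ℝ] A) (β : V [⋀^Fin l]→L[ℝ] A) :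
    (wedge α β).toAlternatingMap = algWedge α.toAlternatingMap β.toAlternatingMap := rfl

theorem wedge_apply {A : Type*} [CommRing A] [Algebra ℝ A] [TopologicalSpace A]
    [IsTopologicalRing A] {k l : ℕ} (α : V [⋀^Fin k]→L[ℝ] A) (β : V [⋀^Fin l]→L[ℝ] A)
    (v : Fin (k + l) → V) :
    wedge α β v = algWedge α.toAlternatingMap β.toAlternatingMap v := rfl

theorem IsSU3.exists_complex_structure {ω : V [⋀^Fin 2]→L[ℝ] ℝ} {Ψ : V [⋀^Fin 3]→L[ℝ] ℂ}
    (h : IsSU3 ω Ψ) (hV : Module.finrank ℝ V = 6) :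
    ∃ (θ : Fin 3 → V →ₗ[ℝ] ℂ) (J : V →ₗ[ℝ] V), Ψ.toAlternatingMap = detForm θ ∧
      (∀ i v, θ i (J v) = Complex.I * θ i v) ∧ (∀ v, v ≠ 0 → 0 < ω ![J v, v]) ∧
      Function.Bijective (LinearMap.pi θ) ∧ (∀ v, J (J v) = -v) ∧
      ∀ v w, ω ![J v, J w] = ω ![v, w] := by
  have : FiniteDimensional ℝ V := Module.finite_of_finrank_eq_succ hV
  obtain ⟨θ', hΨ', J, hJ, hpos⟩ := h.decomposable_tamed
  let θ : Fin 3 → V →ₗ[ℝ] ℂ := fun i => θ' i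
  have hΨ : Ψ.toAlternatingMap = detForm θ := by
    ext v
    rw [detForm_apply]
    exact hΨ' v
  -- If `Ψ` were zero, the volume condition would give `ω³ = 0`, against non-degeneracy in dimension
  -- six. Only this consequence of the normalisation `4/3` is needed.
  have hne : detForm θ ≠ 0 := by
    intro h0
    refine cube_ne_zero (ω := ω.toAlternatingMap) h.nondegenerate hV ?_
    ext v
    have h1 := h.volume v
    rw [wedge_apply (wedge ω ω) ω] at h1
    have h2 : wedge Ψ (conjForm Ψ) v = 0 := by
      rw [wedge_apply, hΨ, h0, ← algWedgeₗ_apply, map_zero]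
      rfl
    rw [h2] at h1
    have h3 := (mul_eq_zero.1 h1.symm).resolve_left (by simp)
    rw [AlternatingMap.zero_apply, ← Complex.ofReal_eq_zero, ← h3,
      wedge_toAlternatingMap]
  have hs := surjective_of_detForm_ne_zero hJ hne
  have hi : Function.Injective (LinearMap.pi θ) :=
    (LinearMap.injective_iff_surjective_of_finrank_eq_finrank (by
      rw [hV, Module.finrank_pi_fintype]; simp)).2 hs
  have hw : algWedge (detForm θ) (toComplex ω).toAlternatingMap = 0 := by
    rw [← hΨ]
    ext v
    rw [← wedge_apply, h.wedge_eq_zero]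
    rfl
  have hz : ∀ v w u, detForm θ ![v, w, u] ≠ 0 → ω ![J v, J w] = ω ![v, w] := fun v w u hne =>
    compatible_of_detForm_ne_zero (ω := ω.toAlternatingMap) hJ (fun v => rfl) hw hne
  refine ⟨θ, J, hΨ, hJ, hpos, ⟨hi, hs⟩, fun v => hi ?_, fun v w => ?_⟩
  · funext i
    simp only [LinearMap.pi_apply, map_neg, θ]
    erw [hJ, hJ]
    rw [← mul_assoc, Complex.I_mul_I]
    simp
  · by_cases hv : v = 0
    · have h0 : ∀ u : V, ω ![0, u] = 0 := fun u => ω.map_coord_zero 0 rfl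
      simp [hv, h0]
    · obtain ⟨x, u, hxu⟩ := exists_detForm_ne_zero hs (v := v) fun h0 => hv (hi (by simpa using h0))
      -- If `Ψ(v, w, u) = 0`, the invariance holds for the pairs `v, w + x` and `v, x`, where `Ψ(v,
      -- x, u) ≠ 0`; subtraction gives it for `v, w`.
      by_cases hd : detForm θ ![v, w, u] = 0
      · have hd2 : detForm θ ![v, w + x, u] ≠ 0 := by
          have : detForm θ ![v, w + x, u] = detForm θ ![v, w, u] + detForm θ ![v, x, u] := by
            simp only [detForm_fin_three, map_add]
            ring
          rwa [this, hd, zero_add]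
        have h1 := hz _ _ _ hd2
        have h2 := hz _ _ _ hxu
        have ha : ∀ a b c : V, ω ![a, b + c] = ω ![a, b] + ω ![a, c] := fun a b c =>
          (contract_apply ω.toAlternatingMap a (b + c)).symm.trans (by
            rw [map_add, contract_apply, contract_apply]; rfl)
        rw [map_add, ha, ha] at h1
        linarith
      · exact hz _ _ _ hd

end Facts
end SHF

end

/-! ### Unitary bases adapted to two given vectors. -/

noncomputable section
open scoped Topology
namespace SHF

section TwoForm
variable {V A : Type*} [AddCommGroup V] [Module ℝ V] [CommRing A] [Algebra ℝ A]

theorem twoForm_add_right (α : V [⋀^Fin 2]→ₗ[ℝ] A) (u v w : V) :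
    α ![u, v + w] = α ![u, v] + α ![u, w] := by
  simp only [← contract_apply, map_add]

theorem twoForm_smul_right (α : V [⋀^Fin 2]→ₗ[ℝ] A) (c : ℝ) (u v : V) :
    α ![u, c • v] = c • α ![u, v] := by
  simp only [← contract_apply, map_smul]

theorem twoForm_neg_right (α : V [⋀^Fin 2]→ₗ[ℝ] A) (u v : V) :
    α ![u, -v] = -α ![u, v] := by
  simp only [← contract_apply, map_neg]

theorem twoForm_add_left (α : V [⋀^Fin 2]→ₗ[ℝ] A) (u v w : V) :
    α ![u + v, w] = α ![u, w] + α ![v, w] := by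
  rw [twoForm_swap, twoForm_add_right, twoForm_swap α w, twoForm_swap α w]
  ring

theorem twoForm_smul_left (α : V [⋀^Fin 2]→ₗ[ℝ] A) (c : ℝ) (u v : V) :
    α ![c • u, v] = c • α ![u, v] := by
  rw [twoForm_swap, twoForm_smul_right, twoForm_swap α v, smul_neg, neg_neg]

theorem twoForm_neg_left (α : V [⋀^Fin 2]→ₗ[ℝ] A) (u v : V) :
    α ![-u, v] = -α ![u, v] := by
  rw [twoForm_swap, twoForm_neg_right, twoForm_swap α v, neg_neg]

theorem twoForm_self (α : V [⋀^Fin 2]→ₗ[ℝ] A) (v : V) : α ![v, v] = 0 :=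
  α.map_eq_zero_of_eq ![v, v] (i := 0) (j := 1) rfl (by decide)

end TwoForm

section Unitary
variable {V : Type*} [AddCommGroup V] [Module ℝ V] {ω : V [⋀^Fin 2]→ₗ[ℝ] ℝ} {J : V →ₗ[ℝ] V}

theorem exists_basis_of_unitary (hV : Module.finrank ℝ V = 6)
    (hcomp : ∀ v w, ω ![J v, J w] = ω ![v, w]) {q : Fin 3 → V} (h1 : ∀ i j, ω ![q i, q j] = 0)
    (h2 : ∀ i j, ω ![J (q i), q j] = if i = j then 1 else 0) {θ : Fin 3 → V →ₗ[ℝ] ℂ}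
    (hθ : ∀ i v, θ i (J v) = Complex.I * θ i v) :
    ∃ b : Module.Basis (Fin 6) ℝ V, b 0 = q 0 ∧ b 2 = q 1 ∧
      (∀ v w, ω ![v, w] = b.coord 1 v * b.coord 0 w - b.coord 0 v * b.coord 1 w +
        (b.coord 3 v * b.coord 2 w - b.coord 2 v * b.coord 3 w) +
        (b.coord 5 v * b.coord 4 w - b.coord 4 v * b.coord 5 w)) ∧
      ∀ v, detForm θ v = detForm θ ![q 0, q 1, q 2] * detForm (complexCoord b) v := by
  have : FiniteDimensional ℝ V := Module.finite_of_finrank_eq_succ hV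
  obtain ⟨b', hb', hω⟩ := exists_basis_of_symplectic_pairs hV (fun i => J (q i)) q
    (fun i j => by rw [hcomp, h1]) h1 h2
  let σ : Fin 3 ⊕ Fin 3 ≃ Fin 6 := ⟨Sum.elim ![1, 3, 5] ![0, 2, 4],
    ![Sum.inr 0, Sum.inl 0, Sum.inr 1, Sum.inl 1, Sum.inr 2, Sum.inl 2], by decide, by decide⟩
  have hs : ∀ i, b'.reindex σ i = Sum.elim (fun i => J (q i)) q (σ.symm i) := fun i => by
    rw [Module.Basis.reindex_apply, hb']
  have hc : ∀ i, b'.coord i = (b'.reindex σ).coord (σ i) := fun i => by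
    ext v
    simp
  refine ⟨b'.reindex σ, hs 0, hs 2, fun v w => ?_, fun v => ?_⟩
  · rw [hω, alternatingMap_sum_apply]
    simp only [detForm_fin_two, Fin.sum_univ_three, Matrix.cons_val_zero, Matrix.cons_val_one, hc]
    simp only [σ, Equiv.coe_fn_mk, Sum.elim_inl, Sum.elim_inr, Matrix.cons_val]
    ring
  -- In the basis `q₀, Jq₀, q₁, Jq₁, q₂, Jq₂` with complex coordinates `zₖ` one has `θᵢ = ∑ₖ θᵢ(qₖ)
  -- zₖ`, so the determinants multiply.
  · rw [detForm_apply, detForm_apply, detForm_apply, ← Matrix.det_mul]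
    congr 1
    ext i j
    rw [Matrix.mul_apply, Fin.sum_univ_three, Matrix.of_apply]
    conv_lhs => rw [← (b'.reindex σ).sum_repr (v j)]
    simp only [hs, Fin.sum_univ_six]
    generalize b'.reindex σ = b
    simp only [σ, Equiv.coe_fn_symm_mk, Matrix.cons_val, Sum.elim_inl, Sum.elim_inr, map_add,
      map_smul, hθ,
      complexCoord, Matrix.of_apply, LinearMap.add_apply, LinearMap.smul_apply,
      LinearMap.comp_apply, Algebra.linearMap_apply, Complex.coe_algebraMap, smul_eq_mul,
      Complex.real_smul, Module.Basis.coord_apply]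
    ring

theorem exists_unit_smul (hpos : ∀ v, v ≠ 0 → 0 < ω ![J v, v]) {v : V} (hv : v ≠ 0) :
    ∃ t : ℝ, t ≠ 0 ∧ ω ![J (t • v), t • v] = 1 := by
  have h := hpos v hv
  refine ⟨(√(ω ![J v, v]))⁻¹, inv_ne_zero (Real.sqrt_ne_zero'.2 h), ?_⟩
  rw [map_smul, twoForm_smul_left, twoForm_smul_right, smul_smul, smul_eq_mul, ← mul_inv,
    Real.mul_self_sqrt h.le, inv_mul_cancel₀ h.ne']

/-- Multiplying the third vector of a unitary frame by the phase `a + i c` keeps the frame unitary.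
This freedom is used to make `Ψ` a real multiple of the standard form while the first two vectors
stay fixed. -/
theorem isUnitary_rotate (hJ : ∀ v, J (J v) = -v) (hcomp : ∀ v w, ω ![J v, J w] = ω ![v, w])
    {q0 q1 q2 : V} (hq0 : ω ![J q0, q0] = 1) (hq1 : ω ![J q1, q1] = 1) (hq2 : ω ![J q2, q2] = 1)
    (h01 : ω ![q0, q1] = 0) (h01' : ω ![J q0, q1] = 0) (h02 : ω ![q0, q2] = 0)
    (h02' : ω ![J q0, q2] = 0) (h12 : ω ![q1, q2] = 0) (h12' : ω ![J q1, q2] = 0)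
    {a c : ℝ} (hac : a ^ 2 + c ^ 2 = 1) :
    (∀ i j, ω ![![q0, q1, a • q2 + c • J q2] i, ![q0, q1, a • q2 + c • J q2] j] = 0) ∧
      ∀ i j, ω ![J (![q0, q1, a • q2 + c • J q2] i), ![q0, q1, a • q2 + c • J q2] j] =
        if i = j then 1 else 0 := by
  have hsymm : ∀ v w, ω ![J v, w] = ω ![J w, v] := fun v w => by
    rw [← hcomp, hJ, twoForm_neg_left, ← twoForm_swap]
  have k1 : ω ![q0, J q2] = 0 := by rw [twoForm_swap, hsymm, h02', neg_zero]
  have k2 : ω ![q1, J q2] = 0 := by rw [twoForm_swap, hsymm, h12', neg_zero]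
  have k3 : ω ![q2, J q2] = -1 := by rw [twoForm_swap, hq2]
  constructor
  · intro i j
    fin_cases i <;> fin_cases j <;>
      simp [twoForm_self, h01, h02, h12, k1, k2, twoForm_add_left, twoForm_add_right,
        twoForm_smul_left, twoForm_smul_right, twoForm_swap ω q1 q0, twoForm_swap ω q2 q0,
        twoForm_swap ω q2 q1, twoForm_swap ω (J q2) q0, twoForm_swap ω (J q2) q1]
  · intro i j
    fin_cases i <;> fin_cases j <;>
      simp [twoForm_self, h02, h12, h01', h02', h12', k3, twoForm_add_left,
        twoForm_add_right, twoForm_neg_left, hJ, hcomp, hq0, hq1, hq2,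
        twoForm_smul_left, twoForm_smul_right, hsymm q1 q0, hsymm q2 q0, hsymm q2 q1,
        twoForm_swap ω q2 q0, twoForm_swap ω q2 q1]
    linear_combination hac

end Unitary

theorem re_sq_add_im_sq (d : ℂ) : d.re ^ 2 + d.im ^ 2 = ‖d‖ ^ 2 := by
  rw [← Complex.normSq_eq_norm_sq, Complex.normSq_apply]
  ring

theorem phase_sq {d : ℂ} (hd : d ≠ 0) : (d.re / ‖d‖) ^ 2 + (-d.im / ‖d‖) ^ 2 = 1 := by
  have hn : ‖d‖ ≠ 0 := norm_ne_zero_iff.2 hd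
  field_simp
  exact re_sq_add_im_sq d

theorem phase_mul {d : ℂ} (hd : d ≠ 0) :
    ((d.re / ‖d‖ : ℝ) + (-d.im / ‖d‖ : ℝ) * Complex.I) * d = ‖d‖ := by
  have hn : (‖d‖ : ℂ) ≠ 0 := by exact_mod_cast norm_ne_zero_iff.2 hd
  have hsq : (d.re : ℂ) ^ 2 + (d.im : ℂ) ^ 2 = (‖d‖ : ℂ) ^ 2 := by
    exact_mod_cast re_sq_add_im_sq d
  push_cast
  field_simp
  linear_combination hsq - (d.re - d.im * Complex.I) * Complex.re_add_im d -
    (d.im : ℂ) ^ 2 * Complex.I_sq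

/-- Unitary Gram-Schmidt applied to `X, Z`. Since `ω(X, Z) = 0`, only a real multiple of `X` has to
be subtracted from `Z`, which keeps the second vector in the real span. The factor `r` is harmless
because closedness is a homogeneous condition. -/
theorem IsSU3.exists_adapted_basis {V : Type*} [AddCommGroup V] [Module ℝ V] [TopologicalSpace V]
    {ω : V [⋀^Fin 2]→L[ℝ] ℝ} {Ψ : V [⋀^Fin 3]→L[ℝ] ℂ} (h : IsSU3 ω Ψ)
    (hV : Module.finrank ℝ V = 6) {X Z : V} (hX : X ≠ 0) (hZ : Z ∉ Submodule.span ℝ {X})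
    (hXZ : ω ![X, Z] = 0) :
    ∃ (b : Module.Basis (Fin 6) ℝ V) (r : ℝ), r ≠ 0 ∧ b 0 ∈ Submodule.span ℝ {X} ∧
      b 2 ∈ Submodule.span ℝ {X, Z} ∧
      (∀ v w, ω ![v, w] = b.coord 1 v * b.coord 0 w - b.coord 0 v * b.coord 1 w +
        (b.coord 3 v * b.coord 2 w - b.coord 2 v * b.coord 3 w) +
        (b.coord 5 v * b.coord 4 w - b.coord 4 v * b.coord 5 w)) ∧
      ∀ v, Ψ v = r * detForm (complexCoord b) v := by
  have : FiniteDimensional ℝ V := Module.finite_of_finrank_eq_succ hV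
  obtain ⟨θ, J, hΨ, hθ, hpos, hbij, hJ, hcomp⟩ := h.exists_complex_structure hV
  set β : V [⋀^Fin 2]→ₗ[ℝ] ℝ := ω.toAlternatingMap with hβ
  have hωβ : ∀ v, ω v = β v := fun v => rfl
  simp only [hωβ] at hXZ hpos hcomp ⊢
  obtain ⟨t0, ht0, hq0⟩ := exists_unit_smul hpos hX
  set q0 := t0 • X with hq0d
  have hZ' : Z - β ![J q0, Z] • q0 ≠ 0 := by
    intro h0
    apply hZ
    rw [sub_eq_zero.1 h0, hq0d, smul_smul]
    exact Submodule.smul_mem _ _ (Submodule.mem_span_singleton_self X)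
  obtain ⟨t1, ht1, hq1⟩ := exists_unit_smul hpos hZ'
  set q1 := t1 • (Z - β ![J q0, Z] • q0) with hq1d
  have h01 : β ![q0, q1] = 0 := by
    rw [hq1d, sub_eq_add_neg, twoForm_smul_right, twoForm_add_right, twoForm_neg_right,
      twoForm_smul_right, twoForm_self, hq0d, twoForm_smul_left, hXZ]
    simp
  have h01' : β ![J q0, q1] = 0 := by
    rw [hq1d, sub_eq_add_neg, twoForm_smul_right, twoForm_add_right, twoForm_neg_right,
      twoForm_smul_right, hq0]
    simp
  -- Four linear conditions in dimension six leave a non-zero vector Hermitian-orthogonal to `q0`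
  -- and `q1`.
  obtain ⟨Y, hY, hY0⟩ := (Submodule.ne_bot_iff _).1 (LinearMap.ker_ne_bot_of_finrank_lt
    (f := LinearMap.pi fun i : Fin 4 => contract β (![q0, J q0, q1, J q1] i))
    (by rw [hV]; simp))
  have hY' : ∀ i : Fin 4, β ![![q0, J q0, q1, J q1] i, Y] = 0 := fun i => by
    rw [← contract_apply]
    exact congrFun (LinearMap.mem_ker.1 hY) i
  obtain ⟨t2, ht2, hq2⟩ := exists_unit_smul hpos hY0
  set q2 := t2 • Y with hq2d
  have hq2' : ∀ i : Fin 4, β ![![q0, J q0, q1, J q1] i, q2] = 0 := fun i => by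
    rw [hq2d, twoForm_smul_right, hY', smul_zero]
  have h02 : β ![q0, q2] = 0 := hq2' 0
  have h02' : β ![J q0, q2] = 0 := hq2' 1
  have h12 : β ![q1, q2] = 0 := hq2' 2
  have h12' : β ![J q1, q2] = 0 := hq2' 3
  have hu := fun a c => isUnitary_rotate hJ hcomp hq0 hq1 hq2 h01 h01' h02 h02' h12 h12'
    (a := a) (c := c)
  obtain ⟨b0, -, -, -, hdet⟩ := exists_basis_of_unitary hV hcomp (hu 1 0 (by norm_num)).1
    (hu 1 0 (by norm_num)).2 hθ
  simp only [one_smul, zero_smul, add_zero, Matrix.cons_val] at hdet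
  set d := detForm θ ![q0, q1, q2] with hd
  have hd0 : d ≠ 0 := by
    intro h0
    obtain ⟨x, u, hxu⟩ := exists_detForm_ne_zero hbij.2 (v := X)
      fun h0 => hX (hbij.1 (by simpa using h0))
    exact hxu (by rw [hdet, h0, zero_mul])
  have hn : ‖d‖ ≠ 0 := norm_ne_zero_iff.2 hd0
  have hac := phase_sq hd0
  -- The phase is the conjugate of `d` divided by `‖d‖`; it changes `Ψ(q₀, q₁, q₂) = d` into the
  -- positive number `‖d‖`.
  obtain ⟨b, hb0, hb2, hω, hdet⟩ := exists_basis_of_unitary hV hcomp (hu _ _ hac).1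
    (hu _ _ hac).2 hθ
  refine ⟨b, ‖d‖, hn, ?_, ?_, hω, fun v => ?_⟩
  · rw [hb0]
    exact Submodule.smul_mem _ _ (Submodule.mem_span_singleton_self X)
  · rw [hb2]
    refine Submodule.smul_mem _ _ (Submodule.sub_mem _ (Submodule.subset_span (by simp))
      (Submodule.smul_mem _ _ (Submodule.smul_mem _ _ (Submodule.subset_span (by simp)))))
  · have h1 : Ψ v = detForm θ v := by
      rw [← hΨ]
      rfl
    have h2 : detForm θ ![q0, q1, (d.re / ‖d‖) • q2 + (-d.im / ‖d‖) • J q2] =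
        ((d.re / ‖d‖ : ℝ) + (-d.im / ‖d‖ : ℝ) * Complex.I) * d := by
      rw [hd]
      simp only [detForm_fin_three, map_add, map_smul, hθ, Complex.real_smul]
      ring
    rw [h1, hdet]
    simp only [Matrix.cons_val]
    rw [h2, phase_mul hd0]

end SHF

end

/-! ### The structure constants allowed by closedness. -/

noncomputable section
open scoped Topology
namespace SHF

section StructureConstants

/-- The values `ω₀ (x, eₖ)` of the standard two-form on `ℝ⁶`. -/
def stdOmega (x : Fin 6 → ℝ) : Fin 6 → ℝ := ![x 1, -x 0, x 3, -x 2, x 5, -x 4]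

/-- The values `Re Ψ₀ (x, eⱼ, eₖ)` of the standard three-form on `ℝ⁶`. -/
def stdPsi (x : Fin 6 → ℝ) : Fin 6 → Fin 6 → ℝ :=
  ![![0, 0, x 4, -x 5, -x 2, x 3],
    ![0, 0, -x 5, -x 4, x 3, x 2],
    ![-x 4, x 5, 0, 0, x 0, -x 1],
    ![x 5, x 4, 0, 0, -x 1, -x 0],
    ![x 2, -x 3, -x 0, x 1, 0, 0],
    ![-x 3, -x 2, x 1, x 0, 0, 0]]

-- Here `C i j` is the coordinate vector of `[bᵢ, bⱼ]`, with `b₀` central and `[bᵢ, b₂] ∈ ℝb₀`. The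
-- equations `dω = 0` and `d Re Ψ = 0` are linear in `C`; below, `wijk` and `pijkl` are their values
-- on the basis vectors with these indices.
set_option linter.unusedSimpArgs false in
theorem structureConstants_of_closed {C : Fin 6 → Fin 6 → Fin 6 → ℝ} (h0 : ∀ j, C 0 j = 0)
    (h2 : ∀ i k, k ≠ 0 → C i 2 k = 0) (h2' : ∀ i k, k ≠ 0 → C 2 i k = 0)
    (hω : ∀ i j k, stdOmega (C i j) k - stdOmega (C i k) j + stdOmega (C j k) i = 0)
    (hψ : ∀ i j k l, stdPsi (C i j) k l - stdPsi (C i k) j l + stdPsi (C i l) j k +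
      stdPsi (C j k) i l - stdPsi (C j l) i k + stdPsi (C k l) i j = 0) :
    C 1 2 = ![-C 3 5 5, 0, 0, 0, 0, 0] ∧
    C 1 3 = ![C 1 3 0, 0, C 1 3 2, C 1 3 3, 0, C 1 3 5] ∧
    C 1 4 = ![C 1 4 0, 0, C 1 4 2, C 1 4 3, 0, C 1 3 2] ∧
    C 1 5 = ![C 1 5 0, 0, -C 1 4 3, C 1 5 3, 0, -C 1 3 3] ∧
    C 2 3 = ![-C 1 3 3, 0, 0, 0, 0, 0] ∧
    C 2 4 = ![-C 1 4 3, 0, 0, 0, 0, 0] ∧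
    C 2 5 = ![-C 1 5 3, 0, 0, 0, 0, 0] ∧
    C 3 4 = ![C 1 3 5 + C 1 4 2, 0, -C 1 4 0, 0, 0, -C 1 3 0] ∧
    C 3 5 = ![-C 1 4 3, 0, C 1 5 0, 0, 0, C 3 5 5] ∧
    C 4 5 = ![C 1 3 3, 0, -C 3 5 5, 0, 0, C 1 5 0] := by
  have a1 : ∀ i, C i 2 1 = 0 := fun i => h2 i 1 (by decide)
  have b1 : ∀ i, C 2 i 1 = 0 := fun i => h2' i 1 (by decide)
  have a2 : ∀ i, C i 2 2 = 0 := fun i => h2 i 2 (by decide)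
  have b2 : ∀ i, C 2 i 2 = 0 := fun i => h2' i 2 (by decide)
  have a3 : ∀ i, C i 2 3 = 0 := fun i => h2 i 3 (by decide)
  have b3 : ∀ i, C 2 i 3 = 0 := fun i => h2' i 3 (by decide)
  have a4 : ∀ i, C i 2 4 = 0 := fun i => h2 i 4 (by decide)
  have b4 : ∀ i, C 2 i 4 = 0 := fun i => h2' i 4 (by decide)
  have a5 : ∀ i, C i 2 5 = 0 := fun i => h2 i 5 (by decide)
  have b5 : ∀ i, C 2 i 5 = 0 := fun i => h2' i 5 (by decide)
  have p0123 : -C 1 3 4 = 0 := by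
    have := hψ 0 1 2 3
    simp [stdPsi, h0, a1, a2, a3, a4, a5, b1, b2, b3, b4, b5] at this
    linarith
  have p0124 : -C 1 4 4 = 0 := by
    have := hψ 0 1 2 4
    simp [stdPsi, h0, a1, a2, a3, a4, a5, b1, b2, b3, b4, b5] at this
    linarith
  have p0125 : -C 1 5 4 = 0 := by
    have := hψ 0 1 2 5
    simp [stdPsi, h0, a1, a2, a3, a4, a5, b1, b2, b3, b4, b5] at this
    linarith
  have p0134 : -C 1 3 2 + C 1 4 5 = 0 := by
    have := hψ 0 1 3 4
    simp [stdPsi, h0, a1, a2, a3, a4, a5, b1, b2, b3, b4, b5] at this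
    linarith
  have p0135 : C 1 3 3 + C 1 5 5 = 0 := by
    have := hψ 0 1 3 5
    simp [stdPsi, h0, a1, a2, a3, a4, a5, b1, b2, b3, b4, b5] at this
    linarith
  have p0145 : C 1 4 3 + C 1 5 2 = 0 := by
    have := hψ 0 1 4 5
    simp [stdPsi, h0, a1, a2, a3, a4, a5, b1, b2, b3, b4, b5] at this
    linarith
  have p0234 : C 3 4 4 = 0 := by
    have := hψ 0 2 3 4
    simp [stdPsi, h0, a1, a2, a3, a4, a5, b1, b2, b3, b4, b5] at this
    linarith
  have p0235 : C 3 5 4 = 0 := by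
    have := hψ 0 2 3 5
    simp [stdPsi, h0, a1, a2, a3, a4, a5, b1, b2, b3, b4, b5] at this
    linarith
  have p0245 : C 4 5 4 = 0 := by
    have := hψ 0 2 4 5
    simp [stdPsi, h0, a1, a2, a3, a4, a5, b1, b2, b3, b4, b5] at this
    linarith
  have p0345 : C 3 4 3 + C 3 5 2 - C 4 5 5 = 0 := by
    have := hψ 0 3 4 5
    simp [stdPsi, h0, a1, a2, a3, a4, a5, b1, b2, b3, b4, b5] at this
    linarith
  have p1234 : -C 1 3 0 - C 3 4 5 = 0 := by
    have := hψ 1 2 3 4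
    simp [stdPsi, h0, a1, a2, a3, a4, a5, b1, b2, b3, b4, b5] at this
    linarith
  have p1235 : -C 1 2 0 + C 1 3 1 - C 3 5 5 = 0 := by
    have := hψ 1 2 3 5
    simp [stdPsi, h0, a1, a2, a3, a4, a5, b1, b2, b3, b4, b5] at this
    linarith
  have p1245 : C 1 4 1 + C 1 5 0 - C 4 5 5 = 0 := by
    have := hψ 1 2 4 5
    simp [stdPsi, h0, a1, a2, a3, a4, a5, b1, b2, b3, b4, b5] at this
    linarith
  have p1345 : C 1 4 0 - C 1 5 1 + C 3 4 2 - C 3 5 3 - C 4 5 4 = 0 := by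
    have := hψ 1 3 4 5
    simp [stdPsi, h0, a1, a2, a3, a4, a5, b1, b2, b3, b4, b5] at this
    linarith
  have w013 : C 1 3 1 = 0 := by
    have := hω 0 1 3
    simp [stdOmega, h0, a1, a2, a3, a4, a5, b1, b2, b3, b4, b5] at this
    linarith
  have w014 : C 1 4 1 = 0 := by
    have := hω 0 1 4
    simp [stdOmega, h0, a1, a2, a3, a4, a5, b1, b2, b3, b4, b5] at this
    linarith
  have w015 : C 1 5 1 = 0 := by
    have := hω 0 1 5
    simp [stdOmega, h0, a1, a2, a3, a4, a5, b1, b2, b3, b4, b5] at this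
    linarith
  have w034 : C 3 4 1 = 0 := by
    have := hω 0 3 4
    simp [stdOmega, h0, a1, a2, a3, a4, a5, b1, b2, b3, b4, b5] at this
    linarith
  have w035 : C 3 5 1 = 0 := by
    have := hω 0 3 5
    simp [stdOmega, h0, a1, a2, a3, a4, a5, b1, b2, b3, b4, b5] at this
    linarith
  have w045 : C 4 5 1 = 0 := by
    have := hω 0 4 5
    simp [stdOmega, h0, a1, a2, a3, a4, a5, b1, b2, b3, b4, b5] at this
    linarith
  have w123 : -C 1 3 3 - C 2 3 0 = 0 := by
    have := hω 1 2 3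
    simp [stdOmega, h0, a1, a2, a3, a4, a5, b1, b2, b3, b4, b5] at this
    linarith
  have w124 : -C 1 4 3 - C 2 4 0 = 0 := by
    have := hω 1 2 4
    simp [stdOmega, h0, a1, a2, a3, a4, a5, b1, b2, b3, b4, b5] at this
    linarith
  have w125 : -C 1 5 3 - C 2 5 0 = 0 := by
    have := hω 1 2 5
    simp [stdOmega, h0, a1, a2, a3, a4, a5, b1, b2, b3, b4, b5] at this
    linarith
  have w134 : C 1 3 5 + C 1 4 2 - C 3 4 0 = 0 := by
    have := hω 1 3 4
    simp [stdOmega, h0, a1, a2, a3, a4, a5, b1, b2, b3, b4, b5] at this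
    linarith
  have w135 : -C 1 3 4 + C 1 5 2 - C 3 5 0 = 0 := by
    have := hω 1 3 5
    simp [stdOmega, h0, a1, a2, a3, a4, a5, b1, b2, b3, b4, b5] at this
    linarith
  have w145 : -C 1 4 4 - C 1 5 5 - C 4 5 0 = 0 := by
    have := hω 1 4 5
    simp [stdOmega, h0, a1, a2, a3, a4, a5, b1, b2, b3, b4, b5] at this
    linarith
  have w234 : C 3 4 3 = 0 := by
    have := hω 2 3 4
    simp [stdOmega, h0, a1, a2, a3, a4, a5, b1, b2, b3, b4, b5] at this
    linarith
  have w235 : C 3 5 3 = 0 := by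
    have := hω 2 3 5
    simp [stdOmega, h0, a1, a2, a3, a4, a5, b1, b2, b3, b4, b5] at this
    linarith
  have w245 : C 4 5 3 = 0 := by
    have := hω 2 4 5
    simp [stdOmega, h0, a1, a2, a3, a4, a5, b1, b2, b3, b4, b5] at this
    linarith
  have w345 : -C 3 4 4 - C 3 5 5 - C 4 5 2 = 0 := by
    have := hω 3 4 5
    simp [stdOmega, h0, a1, a2, a3, a4, a5, b1, b2, b3, b4, b5] at this
    linarith
  refine ⟨?_, ?_, ?_, ?_, ?_, ?_, ?_, ?_, ?_, ?_⟩
  · funext k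
    fin_cases k
    · change C 1 2 0 = -C 3 5 5
      linarith only [p1235, w013]
    · exact a1 1
    · exact a2 1
    · exact a3 1
    · exact a4 1
    · exact a5 1
  · funext k
    fin_cases k
    · rfl
    · change C 1 3 1 = 0
      linarith only [w013]
    · rfl
    · rfl
    · change C 1 3 4 = 0
      linarith only [p0123]
    · rfl
  · funext k
    fin_cases k
    · rfl
    · change C 1 4 1 = 0
      linarith only [w014]
    · rfl
    · rfl
    · change C 1 4 4 = 0
      linarith only [p0124]
    · change C 1 4 5 = C 1 3 2
      linarith only [p0134]
  · funext k
    fin_cases k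
    · rfl
    · change C 1 5 1 = 0
      linarith only [w015]
    · change C 1 5 2 = -C 1 4 3
      linarith only [p0145]
    · rfl
    · change C 1 5 4 = 0
      linarith only [p0125]
    · change C 1 5 5 = -C 1 3 3
      linarith only [p0135]
  · funext k
    fin_cases k
    · change C 2 3 0 = -C 1 3 3
      linarith only [w123]
    · exact b1 3
    · exact b2 3
    · exact b3 3
    · exact b4 3
    · exact b5 3
  · funext k
    fin_cases k
    · change C 2 4 0 = -C 1 4 3
      linarith only [w124]
    · exact b1 4
    · exact b2 4
    · exact b3 4
    · exact b4 4
    · exact b5 4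
  · funext k
    fin_cases k
    · change C 2 5 0 = -C 1 5 3
      linarith only [w125]
    · exact b1 5
    · exact b2 5
    · exact b3 5
    · exact b4 5
    · exact b5 5
  · funext k
    fin_cases k
    · change C 3 4 0 = C 1 3 5 + C 1 4 2
      linarith only [w134]
    · change C 3 4 1 = 0
      linarith only [w034]
    · change C 3 4 2 = -C 1 4 0
      linarith only [p1345, w015, w235, p0245]
    · change C 3 4 3 = 0
      linarith only [w234]
    · change C 3 4 4 = 0
      linarith only [p0234]
    · change C 3 4 5 = -C 1 3 0
      linarith only [p1234]
  · funext k
    fin_cases k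
    · change C 3 5 0 = -C 1 4 3
      linarith only [p0145, p0123, w135]
    · change C 3 5 1 = 0
      linarith only [w035]
    · change C 3 5 2 = C 1 5 0
      linarith only [p0345, w234, p1245, w014]
    · change C 3 5 3 = 0
      linarith only [w235]
    · change C 3 5 4 = 0
      linarith only [p0235]
    · rfl
  · funext k
    fin_cases k
    · change C 4 5 0 = C 1 3 3
      linarith only [p0135, p0124, w145]
    · change C 4 5 1 = 0
      linarith only [w045]
    · change C 4 5 2 = -C 3 5 5
      linarith only [p0234, w345]
    · change C 4 5 3 = 0
      linarith only [w245]
    · change C 4 5 4 = 0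
      linarith only [p0245]
    · change C 4 5 5 = C 1 5 0
      linarith only [p1245, w014]

end StructureConstants
end SHF

end

/-! ### From the bracket table to diagonal form. -/

noncomputable section
open scoped Topology
namespace SHF

section Spectral
open Matrix

/-- In an orthonormal eigenbasis, the cross product of two basis vectors is a multiple `δ` of the
third, with the same `δ` for all three cyclic pairs. So `sᵢ = δ λᵢ`, and the sum is `δ` times the
trace. -/
theorem exists_eigenbasis {S : Matrix (Fin 3) (Fin 3) ℝ} (hS : S.IsSymm) (htr : S.trace = 0) :
    ∃ (e : Module.Basis (Fin 3) ℝ (Fin 3 → ℝ)) (s : Fin 3 → ℝ), s 0 + s 1 + s 2 = 0 ∧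
      S *ᵥ crossProduct (e 1) (e 2) = s 0 • e 0 ∧ S *ᵥ crossProduct (e 2) (e 0) = s 1 • e 1 ∧
      S *ᵥ crossProduct (e 0) (e 1) = s 2 • e 2 := by
  have hH : S.IsHermitian := by
    rw [Matrix.IsHermitian, Matrix.conjTranspose_eq_transpose_of_trivial]
    exact hS
  let v := hH.eigenvectorBasis
  let e : Module.Basis (Fin 3) ℝ (Fin 3 → ℝ) := v.toBasis.map (WithLp.linearEquiv 2 ℝ (Fin 3 → ℝ))
  have he : ∀ i, e i = (v i).ofLp := fun i => by simp [e]
  have hmul : ∀ i, S *ᵥ e i = hH.eigenvalues i • e i := fun i => by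
    rw [he]
    exact hH.mulVec_eigenvectorBasis i
  have hsum : ∀ w : Fin 3 → ℝ, w = ∑ i, (e i ⬝ᵥ w) • e i := by
    intro w
    have := congrArg WithLp.ofLp (v.sum_repr' (WithLp.toLp 2 w))
    simp only [WithLp.ofLp_sum, WithLp.ofLp_smul] at this
    refine this.symm.trans (Finset.sum_congr rfl fun i _ => ?_)
    rw [he]
    congr 1
    rw [EuclideanSpace.inner_eq_star_dotProduct, dotProduct_comm]
    rfl
  let δ := e 0 ⬝ᵥ crossProduct (e 1) (e 2)
  have h1 : crossProduct (e 1) (e 2) = δ • e 0 := by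
    rw [hsum (crossProduct (e 1) (e 2)), Fin.sum_univ_three, dot_self_cross, dot_cross_self]
    simp [δ]
  have h2 : crossProduct (e 2) (e 0) = δ • e 1 := by
    rw [hsum (crossProduct (e 2) (e 0)), Fin.sum_univ_three, dot_self_cross, dot_cross_self,
      triple_product_permutation, triple_product_permutation]
    simp [δ]
  have h3 : crossProduct (e 0) (e 1) = δ • e 2 := by
    rw [hsum (crossProduct (e 0) (e 1)), Fin.sum_univ_three, dot_self_cross, dot_cross_self,
      triple_product_permutation]
    simp [δ]
  refine ⟨e, fun i => δ * hH.eigenvalues i, ?_, ?_, ?_, ?_⟩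
  · have h := hH.trace_eq_sum_eigenvalues
    rw [htr, Fin.sum_univ_three] at h
    simp only [RCLike.ofReal_real_eq_id, id_eq] at h
    rw [← mul_add, ← mul_add, ← h, mul_zero]
  · rw [h1, mulVec_smul, hmul, smul_smul]
  · rw [h2, mulVec_smul, hmul, smul_smul]
  · rw [h3, mulVec_smul, hmul, smul_smul]

end Spectral

section Table
open Matrix
variable {L : Type*} [LieRing L] [LieAlgebra ℝ L]

/-- The bracket is `[x, y] = S (x × y)`, from one copy of `ℝ³` to a central second copy. Using the
same eigenbasis of `S` in both copies diagonalises it. -/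
theorem exists_hasDiag_of_symmetric (b : Module.Basis (Fin 3 ⊕ Fin 3) ℝ L)
    {S : Matrix (Fin 3) (Fin 3) ℝ} (hS : S.IsSymm) (htr : S.trace = 0)
    (h0 : ⁅b (.inl 1), b (.inl 2)⁆ = ∑ k, S 0 k • b (.inr k))
    (h1 : ⁅b (.inl 2), b (.inl 0)⁆ = ∑ k, S 1 k • b (.inr k))
    (h2 : ⁅b (.inl 0), b (.inl 1)⁆ = ∑ k, S 2 k • b (.inr k))
    (hc : ∀ k i, ⁅b (.inr k), b i⁆ = 0) :
    ∃ s : Fin 3 → ℝ, s 0 + s 1 + s 2 = 0 ∧ HasDiag L s := by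
  obtain ⟨e, s, hs, he0, he1, he2⟩ := exists_eigenbasis hS htr
  refine ⟨s, hs, ?_⟩
  let E : ((Fin 3 → ℝ) × (Fin 3 → ℝ)) ≃ₗ[ℝ] L :=
    (LinearEquiv.sumArrowLequivProdArrow (Fin 3) (Fin 3) ℝ ℝ).symm.trans b.equivFun.symm
  have hE : ∀ x y, E (x, y) = ∑ i, x i • b (.inl i) + ∑ i, y i • b (.inr i) := by
    intro x y
    simp [E, Module.Basis.equivFun_symm_apply]
  have k0 : ⁅b (.inl 2), b (.inl 1)⁆ = -∑ k, S 0 k • b (.inr k) := by rw [← h0, lie_skew]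
  have k1 : ⁅b (.inl 0), b (.inl 2)⁆ = -∑ k, S 1 k • b (.inr k) := by rw [← h1, lie_skew]
  have k2 : ⁅b (.inl 1), b (.inl 0)⁆ = -∑ k, S 2 k • b (.inr k) := by rw [← h2, lie_skew]
  have hc' : ∀ k i, ⁅b i, b (.inr k)⁆ = 0 := fun k i => by rw [← lie_skew, hc, neg_zero]
  have hS' : ∀ i j, S i j = S j i := fun i j => hS.apply j i
  have hbr : ∀ x y, ⁅E (x, 0), E (y, 0)⁆ = E (0, S *ᵥ crossProduct x y) := by
    intro x y
    simp only [hE, Pi.zero_apply, zero_smul, Finset.sum_const_zero, add_zero, zero_add]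
    simp only [Fin.sum_univ_three, lie_add, add_lie, smul_lie, lie_smul, h0, h1, h2, k0, k1, k2,
      lie_self, Matrix.mulVec, dotProduct, cross_apply, Matrix.cons_val]
    rw [hS' 1 0, hS' 2 0, hS' 2 1]
    module
  have hcE : ∀ (z : Fin 3 → ℝ) (w : L), ⁅E (0, z), w⁆ = 0 := by
    intro z w
    have hcw : ∀ k, ⁅b (.inr k), w⁆ = 0 := fun k => by
      rw [← b.sum_repr w]
      simp only [lie_sum, lie_smul, hc, smul_zero, Finset.sum_const_zero]
    simp [hE, sum_lie, hcw]
  let b' := ((e.prod e).map E).reindex finSumFinEquiv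
  have hl : ∀ i : Fin 3, b' (Fin.castAdd 3 i) = E (e i, 0) := fun i => by
    have : finSumFinEquiv.symm (Fin.castAdd 3 i) = Sum.inl i :=
      finSumFinEquiv_symm_apply_castAdd i
    rw [Module.Basis.reindex_apply, this]
    simp
  have hr : ∀ i : Fin 3, b' (Fin.natAdd 3 i) = E (0, e i) := fun i => by
    have : finSumFinEquiv.symm (Fin.natAdd 3 i) = Sum.inr i := finSumFinEquiv_symm_apply_natAdd i
    rw [Module.Basis.reindex_apply, this]
    simp
  have hsm : ∀ (c : ℝ) z, E (0, c • z) = c • E (0, z) := fun c z => by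
    rw [← map_smul]
    simp
  have l0 : b' 0 = E (e 0, 0) := hl 0
  have l1 : b' 1 = E (e 1, 0) := hl 1
  have l2 : b' 2 = E (e 2, 0) := hl 2
  have r0 : b' 3 = E (0, e 0) := hr 0
  have r1 : b' 4 = E (0, e 1) := hr 1
  have r2 : b' 5 = E (0, e 2) := hr 2
  refine HasDiag.of_basis b' ?_ ?_ ?_ ?_ ?_ ?_
  · rw [l1, l2, r0, hbr, he0, hsm]
  · rw [l2, l0, r1, hbr, he1, hsm]
  · rw [l0, l1, r2, hbr, he2, hsm]
  · exact fun i => by rw [r0, hcE]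
  · exact fun i => by rw [r1, hcE]
  · exact fun i => by rw [r2, hcE]

/-- The case `r = 0`: `b₀, b₂, b₅` are central, and the bracket is determined by `b₁, b₃, b₄`.
Replacing `b₅` by `-b₅` makes its matrix symmetric; the diagonal `q + t, -t, -q` has sum zero. -/
theorem exists_hasDiag_of_brackets_of_eq_zero (b : Module.Basis (Fin 6) ℝ L) {k l s t q : ℝ}
    (c0 : ∀ i, ⁅b 0, b i⁆ = 0) (c2 : ∀ i, ⁅b 2, b i⁆ = 0) (c5 : ∀ i, ⁅b 5, b i⁆ = 0)
    (c13 : ⁅b 1, b 3⁆ = k • b 0 + s • b 2 + q • b 5)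
    (c14 : ⁅b 1, b 4⁆ = l • b 0 + t • b 2 + s • b 5)
    (c34 : ⁅b 3, b 4⁆ = (q + t) • b 0 - l • b 2 - k • b 5) :
    ∃ s : Fin 3 → ℝ, s 0 + s 1 + s 2 = 0 ∧ HasDiag L s := by
  have d14 := (lie_skew (b 4) (b 1)).symm.trans (congrArg Neg.neg c14)
  let σ : Fin 6 ≃ Fin 3 ⊕ Fin 3 := ⟨![.inr 0, .inl 0, .inr 1, .inl 1, .inl 2, .inr 2],
    Sum.elim ![1, 3, 4] ![0, 2, 5], by decide, by decide⟩
  have hσ : ∀ i, (b.unitsSMul ![1, 1, 1, 1, 1, -1]).reindex σ i =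
      Sum.elim ![b 1, b 3, b 4] ![b 0, b 2, -b 5] i := by
    intro i
    rw [Module.Basis.reindex_apply, Module.Basis.unitsSMul_apply]
    rcases i with i | i <;> fin_cases i <;> simp [σ]
  refine exists_hasDiag_of_symmetric ((b.unitsSMul ![1, 1, 1, 1, 1, -1]).reindex σ)
    (S := !![q + t, -l, k; -l, -t, s; k, s, -q]) ?_ ?_ ?_ ?_ ?_ ?_
  · ext i j
    fin_cases i <;> fin_cases j <;> rfl
  · simp [Matrix.trace, Fin.sum_univ_three]
  · simp only [hσ, Fin.sum_univ_three]
    simp [c34]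
    module
  · simp only [hσ, Fin.sum_univ_three]
    simp [d14]
    module
  · simp only [hσ, Fin.sum_univ_three]
    simp [c13]
  · intro i j
    rw [hσ, hσ]
    fin_cases i <;> rcases j with j | j <;> fin_cases j <;> simp [c0, c2, c5]

theorem hasDiag_of_brackets_of_ne_zero (b : Module.Basis (Fin 6) ℝ L) {s t p q r u : ℝ}
    (hr : r ≠ 0) (h1 : p ^ 2 + q * r = 0) (h2 : p * u + r * s = 0) (h3 : u ^ 2 + r * t = 0)
    (c0 : ∀ i, ⁅b 0, b i⁆ = 0) (c12 : ⁅b 1, b 2⁆ = 0)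
    (c13 : ⁅b 1, b 3⁆ = s • b 2 + p • b 3 + q • b 5)
    (c14 : ⁅b 1, b 4⁆ = t • b 2 + u • b 3 + s • b 5)
    (c15 : ⁅b 1, b 5⁆ = -u • b 2 + r • b 3 - p • b 5)
    (c23 : ⁅b 2, b 3⁆ = -p • b 0) (c24 : ⁅b 2, b 4⁆ = -u • b 0) (c25 : ⁅b 2, b 5⁆ = -r • b 0)
    (c34 : ⁅b 3, b 4⁆ = (q + t) • b 0) (c35 : ⁅b 3, b 5⁆ = -u • b 0) (c45 : ⁅b 4, b 5⁆ = p • b 0) :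
    HasDiag L ![0, 1, -1] := by
  have d0 : ∀ i, ⁅b i, b 0⁆ = 0 := fun i => by rw [← lie_skew, c0, neg_zero]
  have d12 := (lie_skew (b 2) (b 1)).symm.trans (congrArg Neg.neg c12)
  have d13 := (lie_skew (b 3) (b 1)).symm.trans (congrArg Neg.neg c13)
  have d14 := (lie_skew (b 4) (b 1)).symm.trans (congrArg Neg.neg c14)
  have d15 := (lie_skew (b 5) (b 1)).symm.trans (congrArg Neg.neg c15)
  have d23 := (lie_skew (b 3) (b 2)).symm.trans (congrArg Neg.neg c23)
  have d24 := (lie_skew (b 4) (b 2)).symm.trans (congrArg Neg.neg c24)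
  have d25 := (lie_skew (b 5) (b 2)).symm.trans (congrArg Neg.neg c25)
  have d34 := (lie_skew (b 4) (b 3)).symm.trans (congrArg Neg.neg c34)
  have d35 := (lie_skew (b 5) (b 3)).symm.trans (congrArg Neg.neg c35)
  have d45 := (lie_skew (b 5) (b 4)).symm.trans (congrArg Neg.neg c45)
  have hb : ∀ i j, b.coord i (b j) = if j = i then 1 else 0 := fun i j => by
    rw [Module.Basis.coord_apply, Module.Basis.repr_self, Finsupp.single_apply]
  -- The last vector is `[b₁, b₅]`, and the fourth is a further central element; both are central by
  -- the quadratic relations. In this basis the only non-zero brackets, up to antisymmetry, are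
  -- `[b₂, b₅] = -r b₀` and `[b₅, b₁] = -[b₁, b₅]`.
  have hli : LinearIndependent ℝ ![b 5, b 1, b 2, p • b 2 + r • b 4 - u • b 5, b 0,
      -u • b 2 + r • b 3 - p • b 5] := by
    rw [Fintype.linearIndependent_iff]
    intro g hg
    have g0 := congrArg (b.coord 0) hg
    have g1 := congrArg (b.coord 1) hg
    have g2 := congrArg (b.coord 2) hg
    have g3 := congrArg (b.coord 3) hg
    have g4 := congrArg (b.coord 4) hg
    have g5 := congrArg (b.coord 5) hg
    simp [Fin.sum_univ_six, hb, -Module.Basis.coord_apply, hr] at g0 g1 g2 g3 g4 g5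
    rw [g3, g4] at g2 g5
    simp at g2 g5
    intro i
    fin_cases i
    exacts [g5, g1, g2, g4, g0, g3]
  have hw : ∀ i, ⁅-u • b 2 + r • b 3 - p • b 5, b i⁆ = 0 := by
    intro i
    simp only [sub_lie, add_lie, smul_lie]
    fin_cases i <;> simp only [Fin.zero_eta, Fin.mk_one, Fin.reduceFinMk, d0, d12, d13, d15, c23,
      c24, c25, c34, c35, d23, d25, d35, d45, lie_self]
    · module
    · match_scalars
      all_goals linarith only [h1, h2, h3]
    · module
    · module
    · match_scalars
      all_goals linarith only [h1, h2, h3]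
    · module
  have hz : ∀ i, ⁅p • b 2 + r • b 4 - u • b 5, b i⁆ = 0 := by
    intro i
    simp only [sub_lie, add_lie, smul_lie]
    fin_cases i <;> simp only [Fin.zero_eta, Fin.mk_one, Fin.reduceFinMk, d0, d12, d14, d15, c23,
      c24, c25, d34, c45, d24, d25, d35, d45, lie_self]
    · module
    · match_scalars
      all_goals linarith only [h1, h2, h3]
    · module
    · match_scalars
      all_goals linarith only [h1, h2, h3]
    · module
    · module
  have hall : ∀ {x : L}, (∀ i, ⁅x, b i⁆ = 0) → ∀ y : L, ⁅x, y⁆ = 0 := fun hx y => by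
    rw [← b.sum_repr y]
    simp only [lie_sum, lie_smul, hx, smul_zero, Finset.sum_const_zero]
  let b' := basisOfLinearIndependentOfCardEqFinrank hli
    (by rw [Module.finrank_eq_card_basis b])
  have hb' : ⇑b' = _ := coe_basisOfLinearIndependentOfCardEqFinrank _ _
  refine HasDiag.of_support (s := ![0, -r, -1]) (HasDiag.of_basis b' ?_ ?_ ?_ ?_ ?_ ?_) ?_
  · simp [hb', c12]
  · simp [hb', c25]
  · simp [hb', d15]
  · exact fun i => by rw [hb']; exact hall hz _
  · exact fun i => by rw [hb']; exact hall c0 _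
  · exact fun i => by rw [hb']; exact hall hw _
  · intro i
    fin_cases i <;> simp [hr]

theorem jacobi_relations (b : Module.Basis (Fin 6) ℝ L) {k l s t p q r u f h : ℝ}
    (c0 : ∀ i, ⁅b 0, b i⁆ = 0)
    (c12 : ⁅b 1, b 2⁆ = -f • b 0)
    (c13 : ⁅b 1, b 3⁆ = k • b 0 + s • b 2 + p • b 3 + q • b 5)
    (c14 : ⁅b 1, b 4⁆ = l • b 0 + t • b 2 + u • b 3 + s • b 5)
    (c15 : ⁅b 1, b 5⁆ = h • b 0 - u • b 2 + r • b 3 - p • b 5)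
    (c23 : ⁅b 2, b 3⁆ = -p • b 0) (c24 : ⁅b 2, b 4⁆ = -u • b 0) (c25 : ⁅b 2, b 5⁆ = -r • b 0)
    (c34 : ⁅b 3, b 4⁆ = (q + t) • b 0 - l • b 2 - k • b 5)
    (c35 : ⁅b 3, b 5⁆ = -u • b 0 + h • b 2 + f • b 5)
    (c45 : ⁅b 4, b 5⁆ = p • b 0 - f • b 2 + h • b 5) :
    h = 0 ∧ f = 0 ∧ p ^ 2 + q * r = 0 ∧ p * u + r * s = 0 ∧ u ^ 2 + r * t = 0 ∧ k * r = 0 ∧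
      l * r = 0 := by
  have d0 : ∀ i, ⁅b i, b 0⁆ = 0 := fun i => by rw [← lie_skew, c0, neg_zero]
  have d12 := (lie_skew (b 2) (b 1)).symm.trans (congrArg Neg.neg c12)
  have d13 := (lie_skew (b 3) (b 1)).symm.trans (congrArg Neg.neg c13)
  have d14 := (lie_skew (b 4) (b 1)).symm.trans (congrArg Neg.neg c14)
  have d15 := (lie_skew (b 5) (b 1)).symm.trans (congrArg Neg.neg c15)
  have d23 := (lie_skew (b 3) (b 2)).symm.trans (congrArg Neg.neg c23)
  have d24 := (lie_skew (b 4) (b 2)).symm.trans (congrArg Neg.neg c24)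
  have d25 := (lie_skew (b 5) (b 2)).symm.trans (congrArg Neg.neg c25)
  have d34 := (lie_skew (b 4) (b 3)).symm.trans (congrArg Neg.neg c34)
  have d35 := (lie_skew (b 5) (b 3)).symm.trans (congrArg Neg.neg c35)
  have d45 := (lie_skew (b 5) (b 4)).symm.trans (congrArg Neg.neg c45)
  have hb : ∀ i j, b.coord i (b j) = if j = i then 1 else 0 := fun i j => by
    rw [Module.Basis.coord_apply, Module.Basis.repr_self, Finsupp.single_apply]
  have j345 := congrArg (b.coord 2) (lie_jacobi (b 3) (b 4) (b 5))
  have j123 := congrArg (b.coord 0) (lie_jacobi (b 1) (b 2) (b 3))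
  have j124 := congrArg (b.coord 0) (lie_jacobi (b 1) (b 2) (b 4))
  have j134 := congrArg (b.coord 3) (lie_jacobi (b 1) (b 3) (b 4))
  have j145 := congrArg (b.coord 0) (lie_jacobi (b 1) (b 4) (b 5))
  have j145' := congrArg (b.coord 2) (lie_jacobi (b 1) (b 4) (b 5))
  simp [c12, c13, c14, c15, c23, c24, c25, c34, c35, c45, d0, d13, d14, d15, d23, d24,
    d25, d34, d35, hb, -Module.Basis.coord_apply] at j345 j123 j124 j134 j145 j145'
  -- The `b₂`-coordinate of the Jacobi identity for `b₃, b₄, b₅` reads `h² + f² = 0`.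
  have hh : h = 0 := by nlinarith only [j345]
  have hf : f = 0 := by nlinarith only [j345]
  subst hh hf
  have e1 : p ^ 2 + q * r = 0 := by linarith only [j123]
  have e2 : k * r = 0 := by
    rcases j134 with h | h <;> simp [h]
  refine ⟨rfl, rfl, e1, by linarith only [j124], by linarith only [j145, e1], e2, ?_⟩
  linarith only [j145']

/-- The relations `p² + q r = 0`, `u² + r t = 0` and `k r = l r = 0` split the table: `r = 0` forces
`p = u = 0`, and `r ≠ 0` forces `k = l = 0`. -/
theorem exists_hasDiag_of_brackets (b : Module.Basis (Fin 6) ℝ L) {k l s t p q r u f h : ℝ}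
    (c0 : ∀ i, ⁅b 0, b i⁆ = 0)
    (c12 : ⁅b 1, b 2⁆ = -f • b 0)
    (c13 : ⁅b 1, b 3⁆ = k • b 0 + s • b 2 + p • b 3 + q • b 5)
    (c14 : ⁅b 1, b 4⁆ = l • b 0 + t • b 2 + u • b 3 + s • b 5)
    (c15 : ⁅b 1, b 5⁆ = h • b 0 - u • b 2 + r • b 3 - p • b 5)
    (c23 : ⁅b 2, b 3⁆ = -p • b 0) (c24 : ⁅b 2, b 4⁆ = -u • b 0) (c25 : ⁅b 2, b 5⁆ = -r • b 0)
    (c34 : ⁅b 3, b 4⁆ = (q + t) • b 0 - l • b 2 - k • b 5)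
    (c35 : ⁅b 3, b 5⁆ = -u • b 0 + h • b 2 + f • b 5)
    (c45 : ⁅b 4, b 5⁆ = p • b 0 - f • b 2 + h • b 5) :
    ∃ s : Fin 3 → ℝ, s 0 + s 1 + s 2 = 0 ∧ HasDiag L s := by
  obtain ⟨rfl, rfl, e1, e2, e3, e4, e5⟩ :=
    jacobi_relations b c0 c12 c13 c14 c15 c23 c24 c25 c34 c35 c45
  have d0 : ∀ i, ⁅b i, b 0⁆ = 0 := fun i => by rw [← lie_skew, c0, neg_zero]
  have d12 := (lie_skew (b 2) (b 1)).symm.trans (congrArg Neg.neg c12)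
  have d15 := (lie_skew (b 5) (b 1)).symm.trans (congrArg Neg.neg c15)
  have d25 := (lie_skew (b 5) (b 2)).symm.trans (congrArg Neg.neg c25)
  have d35 := (lie_skew (b 5) (b 3)).symm.trans (congrArg Neg.neg c35)
  have d45 := (lie_skew (b 5) (b 4)).symm.trans (congrArg Neg.neg c45)
  by_cases hr : r = 0
  · subst hr
    have hp : p = 0 := by simpa using e1
    have hu : u = 0 := by simpa using e3
    subst hp hu
    refine exists_hasDiag_of_brackets_of_eq_zero b c0 (k := k) (l := l) (s := s) (t := t) (q := q)
      ?_ ?_ (by simpa using c13) (by simpa using c14) c34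
    · intro i
      fin_cases i <;> simp [d0, d12, c23, c24, c25]
    · intro i
      fin_cases i <;> simp [d0, d15, d25, d35, d45]
  · have hk : k = 0 := by simpa [hr] using e4
    have hl : l = 0 := by simpa [hr] using e5
    subst hk hl
    refine ⟨![0, 1, -1], by simp, hasDiag_of_brackets_of_ne_zero b (s := s) (t := t) (p := p)
      (q := q) (u := u) hr e1 e2 e3 c0 (by simpa using c12) (by simpa using c13)
      (by simpa using c14) (by simpa using c15) c23 c24 c25 (by simpa using c34)
      (by simpa using c35) (by simpa using c45)⟩

end Table
end SHF

end

/-! ### Necessity: choice of the two vectors from nilpotency. -/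

noncomputable section
open scoped Topology
namespace SHF

section Nilpotent
variable {L : Type*} [LieRing L] [LieAlgebra ℝ L]

/-- Take `Z` outside `ℝX` in the last term of the lower central series not contained in `ℝX`. If
that term lies in the commutator, `φ Z = 0` is automatic. Otherwise it is all of `L`, and `Z` is
chosen in the kernel of `φ`, whose dimension exceeds one. -/
theorem exists_lie_mem_span [LieRing.IsNilpotent L] (hL : 2 < Module.finrank ℝ L) (φ : L →ₗ[ℝ] ℝ)
    (hφ : ∀ x y : L, φ ⁅x, y⁆ = 0) (X : L) :
    ∃ Z ∉ Submodule.span ℝ {X}, φ Z = 0 ∧ ∀ y : L, ⁅y, Z⁆ ∈ Submodule.span ℝ {X} := by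
  classical
  have : FiniteDimensional ℝ L := Module.finite_of_finrank_pos (by omega)
  have hX : Module.finrank ℝ (Submodule.span ℝ {X}) ≤ 1 := by
    simpa using finrank_span_le_card (R := ℝ) ({X} : Set L)
  have hex : ∃ k, (LieModule.lowerCentralSeries ℝ L L k).toSubmodule ≤ Submodule.span ℝ {X} := by
    obtain ⟨k, hk⟩ := LieModule.IsNilpotent.nilpotent ℝ L L
    exact ⟨k, by simp [hk]⟩
  have hk := Nat.find_spec hex
  have hmin := fun m => Nat.find_min hex (m := m)
  generalize Nat.find hex = k at hk hmin
  have hmem : ∀ j, ∀ z ∈ LieModule.lowerCentralSeries ℝ L L j, ∀ y : L,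
      ⁅y, z⁆ ∈ LieModule.lowerCentralSeries ℝ L L (j + 1) := fun j z hz y => by
    rw [LieModule.lowerCentralSeries_succ]
    exact LieSubmodule.lie_mem_lie (LieSubmodule.mem_top y) hz
  rcases k with _ | _ | j
  · exfalso
    simp only [LieModule.lowerCentralSeries_zero, LieSubmodule.top_toSubmodule] at hk
    have := Submodule.finrank_mono hk
    rw [finrank_top] at this
    omega
  · have hlt : ¬ LinearMap.ker φ ≤ Submodule.span ℝ {X} := by
      intro hle
      have h1 := Submodule.finrank_mono hle
      have h2 := LinearMap.finrank_range_add_finrank_ker φ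
      have h3 := Submodule.finrank_le (LinearMap.range φ)
      rw [Module.finrank_self] at h3
      omega
    obtain ⟨Z, hZ, hZX⟩ := Set.not_subset.1 hlt
    exact ⟨Z, hZX, hZ, fun y => hk (hmem 0 Z (LieSubmodule.mem_top Z) y)⟩
  · obtain ⟨Z, hZ, hZX⟩ := Set.not_subset.1 (hmin (j + 1) (by omega))
    refine ⟨Z, hZX, ?_, fun y => hk (hmem _ Z hZ y)⟩
    have hle : (LieModule.lowerCentralSeries ℝ L L (j + 1)).toSubmodule ≤ LinearMap.ker φ := by
      rw [LieModule.lowerCentralSeries_succ, LieSubmodule.lieIdeal_oper_eq_linear_span',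
        Submodule.span_le]
      rintro _ ⟨x, -, n, -, rfl⟩
      exact hφ x n
    exact hle hZ

theorem detForm_complexCoord_re {V : Type*} [AddCommGroup V] [Module ℝ V]
    (b : Module.Basis (Fin 6) ℝ V) (x : V) (j k : Fin 6) :
    (detForm (complexCoord b) ![x, b j, b k]).re = stdPsi (b.repr x) j k := by
  have hb : ∀ i j, b.coord i (b j) = if j = i then 1 else 0 := fun i j => by
    rw [Module.Basis.coord_apply, Module.Basis.repr_self, Finsupp.single_apply]
  rw [detForm_fin_three]
  simp only [complexCoord, Matrix.cons_val, LinearMap.add_apply, LinearMap.smul_apply,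
    LinearMap.comp_apply, Algebra.linearMap_apply, Complex.coe_algebraMap, smul_eq_mul, hb]
  generalize hx : (fun i => b.coord i x) = y
  have hy : ∀ i, b.coord i x = y i := fun i => congrFun hx i
  have hr : ⇑(b.repr x) = y := hx
  rw [hr]
  simp only [hy]
  fin_cases j <;> fin_cases k <;> simp [stdPsi]

theorem IsSU3.exists_hasDiag [TopologicalSpace L] [LieRing.IsNilpotent L]
    {ω : L [⋀^Fin 2]→L[ℝ] ℝ} {Ψ : L [⋀^Fin 3]→L[ℝ] ℂ} (h : IsSU3 ω Ψ)
    (hL : Module.finrank ℝ L = 6) (hω : ∀ v, Nilmanifold.ceDiff ω v = 0)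
    (hΨ : ∀ v, Nilmanifold.ceDiff (rePart Ψ) v = 0) :
    ∃ s : Fin 3 → ℝ, s 0 + s 1 + s 2 = 0 ∧ HasDiag L s := by
  have : FiniteDimensional ℝ L := Module.finite_of_finrank_eq_succ hL
  have : Nontrivial L := Module.nontrivial_of_finrank_pos (R := ℝ) (by omega)
  obtain ⟨⟨X, hXc⟩, hX⟩ := @exists_ne (LieAlgebra.center ℝ L)
    LieAlgebra.non_trivial_center_of_isNilpotent 0
  have hX0 : X ≠ 0 := fun h0 => hX (Subtype.ext h0)
  have hXl : ∀ y : L, ⁅y, X⁆ = 0 := fun y => hXc y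
  have hω' : ∀ x y z : L, ω ![⁅x, y⁆, z] - ω ![⁅x, z⁆, y] + ω ![⁅y, z⁆, x] = 0 := by
    intro x y z
    have := hω ![x, y, z]
    rw [ceDiff_two] at this
    exact neg_eq_zero.1 this
  have h0 : ∀ y : L, ω ![0, y] = 0 := fun y => ω.map_coord_zero 0 rfl
  -- For central `X`, `dω(x, y, X) = 0` reduces to `ω([x, y], X) = 0`, so `ω(X, ·)` vanishes on
  -- commutators.
  obtain ⟨Z, hZX, hZ, hZl⟩ := exists_lie_mem_span (by omega) (contract ω.toAlternatingMap X)
    (fun x y => by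
      have := hω' x y X
      rw [hXl, hXl, h0, h0, sub_zero, add_zero] at this
      rw [contract_apply, twoForm_swap]
      exact neg_eq_zero.2 this) X
  rw [contract_apply] at hZ
  obtain ⟨b, r, hr, hb0, hb2, hωb, hΨb⟩ := h.exists_adapted_basis hL hX0 hZX hZ
  obtain ⟨c, hc⟩ := Submodule.mem_span_singleton.1 hb0
  have hc0 : c ≠ 0 := by
    rintro rfl
    exact b.ne_zero 0 (by rw [← hc, zero_smul])
  have hl0 : ∀ y : L, ⁅b 0, y⁆ = 0 := fun y => by rw [← hc, ← lie_skew, lie_smul, hXl]; simp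
  have hl2 : ∀ y : L, ∃ d : ℝ, ⁅y, b 2⁆ = d • b 0 := by
    intro y
    obtain ⟨m, n, hmn⟩ := Submodule.mem_span_pair.1 hb2
    obtain ⟨d, hd⟩ := Submodule.mem_span_singleton.1 (hZl y)
    refine ⟨n * d * c⁻¹, ?_⟩
    rw [← hmn, lie_add, lie_smul, lie_smul, hXl, ← hd, ← hc, smul_zero, zero_add, smul_smul,
      smul_smul, inv_mul_cancel_right₀ hc0]
  let C : Fin 6 → Fin 6 → Fin 6 → ℝ := fun i j => b.repr ⁅b i, b j⁆
  have hC2 : ∀ i k, k ≠ 0 → C i 2 k = 0 := by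
    intro i k hk
    obtain ⟨d, hd⟩ := hl2 (b i)
    simp [C, hd, hk.symm]
  have hΩ : ∀ i j k, ω ![⁅b i, b j⁆, b k] = stdOmega (C i j) k := by
    intro i j k
    rw [hωb]
    fin_cases k <;> simp [stdOmega, C]
  have hΦ : ∀ i j k l, rePart Ψ ![⁅b i, b j⁆, b k, b l] = r * stdPsi (C i j) k l := by
    intro i j k l
    rw [← detForm_complexCoord_re, ← Complex.re_ofReal_mul, ← hΨb]
    rfl
  have key := structureConstants_of_closed (C := C) (fun j => by
      ext k
      simp [C, hl0]) hC2 (fun i k hk => by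
      have : C 2 i k = -C i 2 k := by
        simp only [C]
        rw [← lie_skew, map_neg, Finsupp.neg_apply]
      rw [this, hC2 i k hk, neg_zero])
    (fun i j k => by
      rw [← hΩ, ← hΩ, ← hΩ]
      exact hω' _ _ _)
    (fun i j k l => by
      have := hΨ ![b i, b j, b k, b l]
      rw [ceDiff_three] at this
      simp only [Matrix.cons_val, hΦ] at this
      refine mul_left_cancel₀ hr ?_
      linear_combination -this)
  have hsum : ∀ i j, ⁅b i, b j⁆ = ∑ k, C i j k • b k := fun i j => (b.sum_repr _).symm
  obtain ⟨e12, e13, e14, e15, e23, e24, e25, e34, e35, e45⟩ := key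
  generalize C = C at *
  refine exists_hasDiag_of_brackets b (f := C 3 5 5) (k := C 1 3 0) (s := C 1 3 2) (p := C 1 3 3)
    (q := C 1 3 5) (l := C 1 4 0) (t := C 1 4 2) (u := C 1 4 3) (h := C 1 5 0) (r := C 1 5 3)
    (fun i => hl0 _) ?_ ?_ ?_ ?_ ?_ ?_ ?_ ?_ ?_ ?_
  · rw [hsum, e12]
    simp [Fin.sum_univ_six]
  · rw [hsum, e13]
    simp [Fin.sum_univ_six]
  · rw [hsum, e14]
    simp [Fin.sum_univ_six]
  · rw [hsum, e15]
    simp [Fin.sum_univ_six]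
    module
  · rw [hsum, e23]
    simp [Fin.sum_univ_six]
  · rw [hsum, e24]
    simp [Fin.sum_univ_six]
  · rw [hsum, e25]
    simp [Fin.sum_univ_six]
  · rw [hsum, e34]
    simp [Fin.sum_univ_six]
    module
  · rw [hsum, e35]
    simp [Fin.sum_univ_six]
  · rw [hsum, e45]
    simp [Fin.sum_univ_six]
    module

end Nilpotent
end SHF

end

/-! ### Sufficiency: the standard structure on a diagonal algebra. -/

noncomputable section
open scoped Topology
namespace SHF

section Continuous
variable {V A : Type*} [AddCommGroup V] [Module ℝ V] [TopologicalSpace V]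
  [CommRing A] [Algebra ℝ A] [TopologicalSpace A] [IsTopologicalRing A]

/-- The wedge product of continuous linear forms. -/
def detFormL {k : ℕ} (θ : Fin k → V →L[ℝ] A) : V [⋀^Fin k]→L[ℝ] A :=
  { detForm fun i => (θ i : V →ₗ[ℝ] A) with
    cont := by
      have : Continuous fun v : Fin k → V => Matrix.det (Matrix.of fun i j => θ i (v j)) :=
        Continuous.matrix_det (by fun_prop)
      exact this.congr fun v => (detForm_apply _ v).symm }

theorem detFormL_toAlternatingMap {k : ℕ} (θ : Fin k → V →L[ℝ] A) :
    (detFormL θ).toAlternatingMap = detForm fun i => (θ i : V →ₗ[ℝ] A) := rfl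

end Continuous

section Standard
variable {V : Type*} [AddCommGroup V] [Module ℝ V] [TopologicalSpace V]
  [IsTopologicalAddGroup V] [ContinuousSMul ℝ V] [T2Space V] [FiniteDimensional ℝ V]

/-- The coordinates of a basis as continuous linear forms. -/
def coordL (b : Module.Basis (Fin 6) ℝ V) (i : Fin 6) : V →L[ℝ] ℝ :=
  LinearMap.toContinuousLinearMap (b.coord i)

/-- The linear forms `θₖ = xₖ + i yₖ`, where `x₀, x₁, x₂, y₀, y₁, y₂` are the coordinates. -/
def stdTheta (b : Module.Basis (Fin 6) ℝ V) (k : Fin 3) : V →L[ℝ] ℂ :=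
  Complex.ofRealCLM.comp (coordL b (![0, 1, 2] k)) +
    Complex.I • Complex.ofRealCLM.comp (coordL b (![3, 4, 5] k))

theorem stdTheta_apply (b : Module.Basis (Fin 6) ℝ V) (k : Fin 3) (v : V) :
    stdTheta b k v = b.coord (![0, 1, 2] k) v + Complex.I * b.coord (![3, 4, 5] k) v := rfl

/-- The two-form `∑ₖ yₖ ∧ xₖ`. -/
def stdTwoForm (b : Module.Basis (Fin 6) ℝ V) : V [⋀^Fin 2]→L[ℝ] ℝ :=
  ∑ k : Fin 3, detFormL ![coordL b (![3, 4, 5] k), coordL b (![0, 1, 2] k)]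

theorem stdTwoForm_toAlternatingMap (b : Module.Basis (Fin 6) ℝ V) :
    (stdTwoForm b).toAlternatingMap =
      ∑ k : Fin 3, detForm ![b.coord (![3, 4, 5] k), b.coord (![0, 1, 2] k)] := by
  ext v
  simp only [stdTwoForm, ContinuousAlternatingMap.coe_toAlternatingMap,
    ContinuousAlternatingMap.sum_apply, alternatingMap_sum_apply]
  refine Finset.sum_congr rfl fun k _ => ?_
  refine (detForm_apply _ _).trans ((detForm_apply _ _).trans ?_).symm
  congr 1
  ext i j
  fin_cases i <;> rfl

theorem stdTwoForm_apply (b : Module.Basis (Fin 6) ℝ V) (v w : V) : stdTwoForm b ![v, w] =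
    b.coord 3 v * b.coord 0 w - b.coord 3 w * b.coord 0 v +
    (b.coord 4 v * b.coord 1 w - b.coord 4 w * b.coord 1 v) +
    (b.coord 5 v * b.coord 2 w - b.coord 5 w * b.coord 2 v) := by
  change (stdTwoForm b).toAlternatingMap ![v, w] = _
  rw [stdTwoForm_toAlternatingMap, alternatingMap_sum_apply]
  simp only [detForm_fin_two, Fin.sum_univ_three, Matrix.cons_val]

/-- Over `ℂ`, `yₖ ∧ xₖ = yₖ ∧ θₖ` because `θₖ = xₖ + i yₖ`, and `θₖ` already occurs in `Ψ`. -/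
theorem wedge_stdTheta_stdTwoForm (b : Module.Basis (Fin 6) ℝ V) :
    wedge (detFormL (stdTheta b)) (toComplex (stdTwoForm b)) = 0 := by
  let y : Fin 3 → V →ₗ[ℝ] ℂ := fun k => (Algebra.linearMap ℝ ℂ).comp (b.coord (![3, 4, 5] k))
  have h : (toComplex (stdTwoForm b)).toAlternatingMap =
      ∑ k : Fin 3, detForm ![y k, (stdTheta b k : V →ₗ[ℝ] ℂ)] := by
    ext v
    have hv : v = ![v 0, v 1] := by
      funext i
      fin_cases i <;> rfl
    rw [alternatingMap_sum_apply, hv]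
    change ((stdTwoForm b ![v 0, v 1] : ℝ) : ℂ) = _
    rw [stdTwoForm_apply]
    simp only [detForm_fin_two, Fin.sum_univ_three, Matrix.cons_val, y, LinearMap.comp_apply,
      Algebra.linearMap_apply, Complex.coe_algebraMap, ContinuousLinearMap.coe_coe, stdTheta_apply]
    push_cast
    ring
  ext v
  rw [wedge_apply, h, detFormL_toAlternatingMap, ← algWedgeₗ_apply, map_sum]
  rw [Finset.sum_eq_zero]
  · rfl
  · intro k _
    rw [algWedgeₗ_apply, algWedge_detForm]
    fin_cases k
    · exact detForm_eq_zero (i := 0) (j := 4) rfl (by decide)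
    · exact detForm_eq_zero (i := 1) (j := 4) rfl (by decide)
    · exact detForm_eq_zero (i := 2) (j := 4) rfl (by decide)

/-- The change of basis from `y₀, x₀, y₁, x₁, y₂, x₂` to `θ₀, θ₁, θ₂, θ̄₀, θ̄₁, θ̄₂`. -/
def thetaMatrix : Matrix (Fin 6) (Fin 6) ℂ :=
  !![Complex.I, 1, 0, 0, 0, 0; 0, 0, Complex.I, 1, 0, 0; 0, 0, 0, 0, Complex.I, 1;
    -Complex.I, 1, 0, 0, 0, 0; 0, 0, -Complex.I, 1, 0, 0; 0, 0, 0, 0, -Complex.I, 1]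

theorem det_thetaMatrix : thetaMatrix.det = 8 * Complex.I := by
  have h3 : Complex.I ^ 3 = -Complex.I := by rw [pow_succ, Complex.I_sq]; ring
  rw [thetaMatrix]
  simp [Matrix.det_succ_row_zero, Fin.sum_univ_succ, Fin.succAbove]
  ring_nf
  rw [h3]
  ring

/-- Relative to `y₀ ∧ x₀ ∧ y₁ ∧ x₁ ∧ y₂ ∧ x₂`, the form `Ψ ∧ Ψ̄` has coefficient `det thetaMatrix =
8 i` and `ω³` has coefficient `6`; indeed `8 i = (4/3) i · 6`. -/
theorem wedge_stdTheta_conj (b : Module.Basis (Fin 6) ℝ V) (v : Fin 6 → V) :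
    wedge (detFormL (stdTheta b)) (conjForm (detFormL (stdTheta b))) v =
      (4 / 3 : ℂ) * Complex.I *
        (wedge (wedge (stdTwoForm b) (stdTwoForm b)) (stdTwoForm b) v : ℝ) := by
  let η : Fin 3 → V →ₗ[ℝ] ℂ := fun k =>
    (Complex.conjCLE : ℂ →L[ℝ] ℂ).toLinearMap.comp (stdTheta b k : V →ₗ[ℝ] ℂ)
  have h1 : (conjForm (detFormL (stdTheta b))).toAlternatingMap = detForm η := by
    ext v
    rw [detForm_apply]
    change (starRingEnd ℂ) (detForm _ v) = _
    rw [detForm_apply, RingHom.map_det]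
    rfl
  have h2 := algWedge_cube (fun k => b.coord (![3, 4, 5] k)) (fun k => b.coord (![0, 1, 2] k))
  rw [← stdTwoForm_toAlternatingMap] at h2
  let y : Fin 6 → V →ₗ[ℝ] ℝ := ![b.coord 3, b.coord 0, b.coord 4, b.coord 1, b.coord 5, b.coord 2]
  have h3 : wedge (wedge (stdTwoForm b) (stdTwoForm b)) (stdTwoForm b) v =
      6 * Matrix.det (Matrix.of fun i j => y i (v j)) := by
    have := DFunLike.congr_fun h2 v
    rw [AlternatingMap.smul_apply, detForm_apply] at this
    rw [wedge_apply, wedge_toAlternatingMap, this, zsmul_eq_mul]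
    rfl
  have h4 : (Matrix.of fun i j => (Fin.append (fun k => (stdTheta b k : V →ₗ[ℝ] ℂ)) η) i (v j)) =
      thetaMatrix * (Complex.ofRealHom.mapMatrix (Matrix.of fun i j => y i (v j))) := by
    ext i j
    rw [Matrix.mul_apply, Fin.sum_univ_six]
    fin_cases i <;> simp [thetaMatrix, y, Fin.append, Fin.addCases, η, stdTheta_apply] <;> ring
  rw [h3, wedge_apply, h1, detFormL_toAlternatingMap, algWedge_detForm, detForm_apply]
  refine (congrArg Matrix.det h4).trans ?_
  rw [Matrix.det_mul, det_thetaMatrix, ← RingHom.map_det]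
  simp only [Complex.ofRealHom_eq_coe]
  push_cast
  ring

theorem isSU3_std (b : Module.Basis (Fin 6) ℝ V) :
    IsSU3 (stdTwoForm b) (detFormL (stdTheta b)) where
  nondegenerate v hv := by
    refine b.ext_elem fun i => ?_
    have h := fun i => hv (b i)
    simp only [stdTwoForm_apply] at h
    have h0 := h 0
    have h1 := h 1
    have h2 := h 2
    have h3 := h 3
    have h4 := h 4
    have h5 := h 5
    simp at h0 h1 h2 h3 h4 h5
    fin_cases i <;> simp [h0, h1, h2, h3, h4, h5]
  decomposable_tamed := by
    let J : V →ₗ[ℝ] V := b.constr ℝ ![b 3, b 4, b 5, -b 0, -b 1, -b 2]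
    have hJ : ∀ v, J v = b.coord 0 v • b 3 + b.coord 1 v • b 4 + b.coord 2 v • b 5 -
        b.coord 3 v • b 0 - b.coord 4 v • b 1 - b.coord 5 v • b 2 := by
      intro v
      simp only [J, Module.Basis.constr_apply_fintype, Fin.sum_univ_six, Module.Basis.equivFun_apply,
        Module.Basis.coord_apply, Matrix.cons_val]
      module
    refine ⟨stdTheta b, fun v => detForm_apply _ _, J, fun i v => ?_, fun v hv => ?_⟩
    · simp only [stdTheta_apply, hJ]
      have := Complex.I_mul_I
      fin_cases i <;> simp [mul_add, ← mul_assoc] <;> ring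
    · rw [stdTwoForm_apply]
      simp only [hJ]
      simp
      have hne : ∃ i, b.repr v i ≠ 0 := by
        by_contra! hc
        exact hv (b.ext_elem fun i => by simp [hc])
      have hs : 0 < ∑ i, b.repr v i ^ 2 := by
        obtain ⟨i, hi⟩ := hne
        exact Finset.sum_pos' (fun _ _ => sq_nonneg _) ⟨i, Finset.mem_univ i, by positivity⟩
      rw [Fin.sum_univ_six] at hs
      linarith
  wedge_eq_zero := wedge_stdTheta_stdTwoForm b
  volume := wedge_stdTheta_conj b

end Standard

section Sufficiency
variable {L : Type*} [LieRing L] [LieAlgebra ℝ L] [TopologicalSpace L]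
  [IsTopologicalAddGroup L] [ContinuousSMul ℝ L] [T2Space L]

theorem rePart_stdTheta_apply [FiniteDimensional ℝ L] (b : Module.Basis (Fin 6) ℝ L) (u v w : L) :
    rePart (detFormL (stdTheta b)) ![u, v, w] =
    Matrix.det !![b.coord 0 u, b.coord 0 v, b.coord 0 w; b.coord 1 u, b.coord 1 v, b.coord 1 w;
      b.coord 2 u, b.coord 2 v, b.coord 2 w] -
    Matrix.det !![b.coord 0 u, b.coord 0 v, b.coord 0 w; b.coord 4 u, b.coord 4 v, b.coord 4 w;
      b.coord 5 u, b.coord 5 v, b.coord 5 w] -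
    Matrix.det !![b.coord 3 u, b.coord 3 v, b.coord 3 w; b.coord 1 u, b.coord 1 v, b.coord 1 w;
      b.coord 5 u, b.coord 5 v, b.coord 5 w] -
    Matrix.det !![b.coord 3 u, b.coord 3 v, b.coord 3 w; b.coord 4 u, b.coord 4 v, b.coord 4 w;
      b.coord 2 u, b.coord 2 v, b.coord 2 w] := by
  change Complex.re (detForm (fun i => (stdTheta b i : L →ₗ[ℝ] ℂ)) ![u, v, w]) = _
  rw [detForm_fin_three]
  simp only [ContinuousLinearMap.coe_coe, stdTheta_apply, Matrix.det_fin_three, Matrix.of_apply,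
    Matrix.cons_val]
  simp [-Module.Basis.coord_apply]
  ring

/-- Here `dyₖ` is a multiple `-sₖ` of the product of the two other `xⱼ` in cyclic order, so `dω` is
a multiple of `(s₀ + s₁ + s₂) x₀ ∧ x₁ ∧ x₂`. In `d Re Ψ` each term repeats some `xⱼ`, whatever `s`
is. -/
theorem HasDiag.exists_isSU3 {s : Fin 3 → ℝ} (h : HasDiag L s) (hs : s 0 + s 1 + s 2 = 0) :
    ∃ (ω : L [⋀^Fin 2]→L[ℝ] ℝ) (Ψ : L [⋀^Fin 3]→L[ℝ] ℂ), IsSU3 ω Ψ ∧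
      (∀ v, Nilmanifold.ceDiff ω v = 0) ∧ ∀ v, Nilmanifold.ceDiff (rePart Ψ) v = 0 := by
  obtain ⟨b, hb⟩ := h
  have : FiniteDimensional ℝ L := b.finiteDimensional_of_finite
  have hc : ∀ i (x y : L), b.coord i ⁅x, y⁆ = ![0, 0, 0,
      s 0 * (b.coord 1 x * b.coord 2 y - b.coord 2 x * b.coord 1 y),
      s 1 * (b.coord 2 x * b.coord 0 y - b.coord 0 x * b.coord 2 y),
      s 2 * (b.coord 0 x * b.coord 1 y - b.coord 1 x * b.coord 0 y)] i := by
    intro i x y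
    rw [hb]
    fin_cases i <;> simp
  refine ⟨stdTwoForm b, detFormL (stdTheta b), isSU3_std b, fun v => ?_, fun v => ?_⟩
  · rw [ceDiff_two]
    simp only [stdTwoForm_apply, hc, Matrix.cons_val]
    have hs0 : s 0 = -s 1 - s 2 := by linarith
    rw [hs0]
    ring
  · rw [ceDiff_three]
    simp only [rePart_stdTheta_apply, hc, Matrix.cons_val, Matrix.det_fin_three, Matrix.of_apply]
    ring

end Sufficiency
end SHF

end

/-! ### The criterion for a given nilmanifold. -/

noncomputable section
open scoped Manifold Topology
namespace SHF

namespace Nilmanifold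
variable {N : Nilmanifold.{u}}

theorem carriesInvariantSymplecticHalfFlat_iff_hasDiag [LieRing.IsNilpotent N.lieAlg] :
    N.CarriesInvariantSymplecticHalfFlat ↔
      ∃ s : Fin 3 → ℝ, s 0 + s 1 + s 2 = 0 ∧ HasDiag N.lieAlg s := by
  have hdim : Module.finrank ℝ N.lieAlg = 6 := finrank_tangentSpace (M := N.G) 1
  have : FiniteDimensional ℝ N.lieAlg := Module.finite_of_finrank_eq_succ hdim
  have : T2Space N.lieAlg := inferInstanceAs (T2Space E6)
  rw [carriesInvariantSymplecticHalfFlat_iff fun ω hω v => ceDiff_wedge_self hω v]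
  constructor
  · rintro ⟨ω, Ψ, h, hω, hΨ⟩
    exact h.exists_hasDiag hdim hω hΨ
  · rintro ⟨s, hs, h⟩
    exact h.exists_isSU3 hs

theorem CorrespondsTo.carries_iff {𝔤 : Type*} [LieRing 𝔤] [LieAlgebra ℝ 𝔤]
    [LieRing.IsNilpotent 𝔤] (h : N.CorrespondsTo 𝔤) :
    N.CarriesInvariantSymplecticHalfFlat ↔
      HasDiag 𝔤 0 ∨ HasDiag 𝔤 ![0, 1, -1] ∨ HasDiag 𝔤 ![1, 1, -2] := by
  obtain ⟨e⟩ := h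
  have : LieRing.IsNilpotent N.lieAlg :=
    (LieEquiv.nilpotent_iff_equiv_nilpotent e).2 inferInstance
  rw [carriesInvariantSymplecticHalfFlat_iff_hasDiag, ← exists_hasDiag_iff]
  exact exists_congr fun s => and_congr_right fun _ => ⟨fun h => h.map e, fun h => h.map e.symm⟩

end Nilmanifold
end SHF

end

/-! ### Existence: two-step nilpotent groups with integral lattices. -/

noncomputable section
open scoped Manifold ContDiff Topology
namespace SHF

/-- The bilinear map `(x, y) ↦ (0, 0, 0, s₀ x₁ y₂, s₁ x₂ y₀, s₂ x₀ y₁)`. -/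
def modelBilin (s : Fin 3 → ℤ) : E6 →L[ℝ] E6 →L[ℝ] E6 :=
  LinearMap.toContinuousLinearMap
    (LinearMap.toContinuousLinearMap.toLinearMap ∘ₗ LinearMap.mk₂ ℝ
      (fun x y : E6 => !₂[0, 0, 0, s 0 * (x 1 * y 2), s 1 * (x 2 * y 0), s 2 * (x 0 * y 1)])
      (fun x x' y => by ext i; fin_cases i <;> simp <;> ring)
      (fun c x y => by ext i; fin_cases i <;> simp <;> ring)
      (fun x y y' => by ext i; fin_cases i <;> simp <;> ring)
      (fun c x y => by ext i; fin_cases i <;> simp <;> ring))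

theorem modelBilin_apply (s : Fin 3 → ℤ) (x y : E6) : modelBilin s x y =
    !₂[0, 0, 0, s 0 * (x 1 * y 2), s 1 * (x 2 * y 0), s 2 * (x 0 * y 1)] := rfl

/-- The two-step nilpotent Lie group structure `x * y = x + y + B (x, y)` on `ℝ⁶`. -/
def Model (_ : Fin 3 → ℤ) : Type := E6

namespace Model
variable {s : Fin 3 → ℤ}

instance : TopologicalSpace (Model s) := inferInstanceAs (TopologicalSpace E6)
instance : T2Space (Model s) := inferInstanceAs (T2Space E6)
instance : ConnectedSpace (Model s) := inferInstanceAs (ConnectedSpace E6)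
instance : ChartedSpace E6 (Model s) := inferInstanceAs (ChartedSpace E6 E6)

/-- The coordinates of an element of the model. -/
def toE6 (x : Model s) : E6 := x

theorem ext_coord {x y : Model s} (h : ∀ i, x.toE6 i = y.toE6 i) : x = y := PiLp.ext h

instance : Mul (Model s) := ⟨fun x y => x.toE6 + y.toE6 + modelBilin s x.toE6 y.toE6⟩
instance : One (Model s) := ⟨(0 : E6)⟩
instance : Inv (Model s) := ⟨fun x => -x.toE6 + modelBilin s x.toE6 x.toE6⟩

theorem toE6_mul (x y : Model s) :
    (x * y).toE6 = x.toE6 + y.toE6 + modelBilin s x.toE6 y.toE6 := rfl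
theorem toE6_one : (1 : Model s).toE6 = 0 := rfl
theorem toE6_inv (x : Model s) : x⁻¹.toE6 = -x.toE6 + modelBilin s x.toE6 x.toE6 := rfl

instance : Group (Model s) where
  mul_assoc x y z := by
    refine ext_coord fun i => ?_
    simp only [toE6_mul, modelBilin_apply]
    fin_cases i <;> simp <;> ring
  one_mul x := by
    refine ext_coord fun i => ?_
    simp only [toE6_mul, toE6_one, modelBilin_apply]
    fin_cases i <;> simp
  mul_one x := by
    refine ext_coord fun i => ?_
    simp only [toE6_mul, toE6_one, modelBilin_apply]
    fin_cases i <;> simp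
  inv_mul_cancel x := by
    refine ext_coord fun i => ?_
    simp only [toE6_mul, toE6_one, toE6_inv, modelBilin_apply]
    fin_cases i <;> simp

instance : IsManifold (𝓡 6) ∞ (Model s) := inferInstanceAs (IsManifold (𝓡 6) ∞ E6)

theorem contMDiff_toE6 : ContMDiff (𝓡 6) 𝓘(ℝ, E6) ∞ (toE6 : Model s → E6) :=
  (contMDiff_id : ContMDiff (𝓡 6) (𝓡 6) ∞ (id : E6 → E6))

theorem contMDiff_of_toE6 {H M E' : Type*} [NormedAddCommGroup E'] [NormedSpace ℝ E']
    [TopologicalSpace H] {I : ModelWithCorners ℝ E' H} [TopologicalSpace M] [ChartedSpace H M]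
    {f : M → Model s} (h : ContMDiff I 𝓘(ℝ, E6) ∞ fun x => (f x).toE6) :
    ContMDiff I (𝓡 6) ∞ f := h

instance : LieGroup (𝓡 6) ∞ (Model s) where
  contMDiff_mul := by
    refine contMDiff_of_toE6 ?_
    have h1 : ContMDiff ((𝓡 6).prod (𝓡 6)) 𝓘(ℝ, E6) ∞ fun p : Model s × Model s => p.1.toE6 :=
      contMDiff_toE6.comp contMDiff_fst
    have h2 : ContMDiff ((𝓡 6).prod (𝓡 6)) 𝓘(ℝ, E6) ∞ fun p : Model s × Model s => p.2.toE6 :=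
      contMDiff_toE6.comp contMDiff_snd
    exact (h1.add h2).add (((modelBilin s).contMDiff.comp h1).clm_apply h2)
  contMDiff_inv := by
    refine contMDiff_of_toE6 ?_
    have h1 : ContMDiff (𝓡 6) 𝓘(ℝ, E6) ∞ fun p : Model s => p.toE6 := contMDiff_toE6
    exact h1.neg.add (((modelBilin s).contMDiff.comp h1).clm_apply h1)

/-- The first three coordinates. -/
def toAbelian : Model s →* Multiplicative (Fin 3 → ℝ) where
  toFun x := Multiplicative.ofAdd ![x.toE6 0, x.toE6 1, x.toE6 2]
  map_one' := by
    rw [toE6_one]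
    simp
  map_mul' x y := by
    rw [← ofAdd_add, toE6_mul, modelBilin_apply]
    congr 1
    ext i
    fin_cases i <;> simp

instance : Group.IsNilpotent (Model s) := by
  -- The group is a central extension of an abelian one: `modelBilin` depends only on the first
  -- three coordinates, which are additive.
  refine Subgroup.isNilpotent_of_ker_le_center (toAbelian (s := s)) (fun x hx => ?_)
  have h : ![x.toE6 0, x.toE6 1, x.toE6 2] = 0 := hx
  have h0 : x.toE6 0 = 0 := congrFun h 0
  have h1 : x.toE6 1 = 0 := congrFun h 1
  have h2 : x.toE6 2 = 0 := congrFun h 2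
  rw [Subgroup.mem_center_iff]
  intro g
  refine ext_coord fun i => ?_
  simp only [toE6_mul, modelBilin_apply]
  fin_cases i <;> simp [h0, h1, h2, add_comm]

/-- The subgroup of the elements with integral coordinates. -/
def lattice (s : Fin 3 → ℤ) : Subgroup (Model s) where
  carrier := {x | ∀ i, ∃ n : ℤ, (n : ℝ) = x.toE6 i}
  one_mem' i := ⟨0, by rw [toE6_one]; simp⟩
  mul_mem' {x y} hx hy := by
    choose m hm using hx
    choose n hn using hy
    intro i
    rw [toE6_mul, modelBilin_apply]
    refine ⟨m i + n i + ![0, 0, 0, s 0 * (m 1 * n 2), s 1 * (m 2 * n 0), s 2 * (m 0 * n 1)] i, ?_⟩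
    fin_cases i <;> simp [← hm, ← hn]
  inv_mem' {x} hx := by
    choose m hm using hx
    intro i
    rw [toE6_inv, modelBilin_apply]
    refine ⟨-m i + ![0, 0, 0, s 0 * (m 1 * m 2), s 1 * (m 2 * m 0), s 2 * (m 0 * m 1)] i, ?_⟩
    fin_cases i <;> simp [← hm]

instance : DiscreteTopology (lattice s) := by
  let b : Module.Basis (Fin 6) ℝ E6 := (EuclideanSpace.basisFun (Fin 6) ℝ).toBasis
  have h : ∀ x : Model s, x ∈ lattice s → x.toE6 ∈ Submodule.span ℤ (Set.range b) := by
    intro x hx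
    rw [Module.Basis.mem_span_iff_repr_mem]
    exact fun i => hx i
  let f : lattice s → Submodule.span ℤ (Set.range b) := fun x => ⟨x.1.toE6, h x.1 x.2⟩
  refine DiscreteTopology.of_continuous_injective (f := f) ?_ ?_
  · exact Continuous.subtype_mk (continuous_subtype_val (p := (· ∈ lattice s))) _
  · intro x y hxy
    have h1 : (f x).1 = (f y).1 := by rw [hxy]
    exact Subtype.ext h1

theorem exists_mul_mem_cube (x : Model s) :
    ∃ γ ∈ lattice s, ∀ i, (γ * x).toE6 i ∈ Set.Icc (0 : ℝ) 1 := by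
  let m : Fin 3 → ℤ := ![-⌊x.toE6 0⌋, -⌊x.toE6 1⌋, -⌊x.toE6 2⌋]
  -- The floors of the last three coordinates are taken after adding the bilinear terms that
  -- multiplication by the first three entries of `γ` creates.
  let n : Fin 3 → ℤ := ![-⌊x.toE6 3 + s 0 * (m 1 * x.toE6 2)⌋, -⌊x.toE6 4 + s 1 * (m 2 * x.toE6 0)⌋,
    -⌊x.toE6 5 + s 2 * (m 0 * x.toE6 1)⌋]
  let γ : Model s := (!₂[(m 0 : ℝ), m 1, m 2, n 0, n 1, n 2] : E6)
  have hγ : γ.toE6 = !₂[(m 0 : ℝ), m 1, m 2, n 0, n 1, n 2] := rfl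
  have hfl : ∀ a : ℝ, -(⌊a⌋ : ℝ) + a ∈ Set.Icc (0 : ℝ) 1 := fun a =>
    ⟨by linarith [Int.floor_le a], by linarith [Int.lt_floor_add_one a]⟩
  refine ⟨γ, fun i => ⟨![m 0, m 1, m 2, n 0, n 1, n 2] i, ?_⟩, fun i => ?_⟩
  · rw [hγ]
    fin_cases i <;> simp
  · rw [toE6_mul, hγ, modelBilin_apply]
    fin_cases i
    · simpa [m] using hfl (x.toE6 0)
    · simpa [m] using hfl (x.toE6 1)
    · simpa [m] using hfl (x.toE6 2)
    · simpa [n, add_assoc] using hfl (x.toE6 3 + s 0 * (m 1 * x.toE6 2))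
    · simpa [n, add_assoc] using hfl (x.toE6 4 + s 1 * (m 2 * x.toE6 0))
    · simpa [n, add_assoc] using hfl (x.toE6 5 + s 2 * (m 0 * x.toE6 1))

theorem isCompact_cube : IsCompact {x : Model s | ∀ i, x.toE6 i ∈ Set.Icc (0 : ℝ) 1} := by
  have h : IsCompact (Set.univ.pi fun _ : Fin 6 => Set.Icc (0 : ℝ) 1) :=
    isCompact_univ_pi fun _ => isCompact_Icc
  have h1 : {x : E6 | ∀ i, x i ∈ Set.Icc (0 : ℝ) 1} =
      WithLp.toLp 2 '' Set.univ.pi fun _ : Fin 6 => Set.Icc (0 : ℝ) 1 := by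
    ext x
    constructor
    · exact fun hx => ⟨WithLp.ofLp x, fun i _ => hx i, rfl⟩
    · rintro ⟨y, hy, rfl⟩ i
      exact hy i trivial
  have h2 : IsCompact {x : E6 | ∀ i, x i ∈ Set.Icc (0 : ℝ) 1} := by
    rw [h1]
    exact h.image (PiLp.continuous_toLp 2 _)
  exact h2

instance : CompactSpace (MulAction.orbitRel.Quotient (lattice s) (Model s)) := by
  refine ⟨?_⟩
  have h := (isCompact_cube (s := s)).image
    (continuous_quotient_mk' (s := MulAction.orbitRel (lattice s) (Model s)))
  convert h
  refine (Set.eq_univ_of_forall fun q => ?_).symm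
  induction q using Quotient.inductionOn' with
  | h x =>
    obtain ⟨γ, hγ, hx⟩ := exists_mul_mem_cube x
    exact ⟨γ * x, hx, Quotient.sound' ⟨⟨γ, hγ⟩, rfl⟩⟩

/-- The nilmanifold of the model. -/
def nilmanifold (s : Fin 3 → ℤ) : Nilmanifold.{0} where
  G := Model s
  Γ := lattice s
  compactSpace := inferInstance

theorem mulInvariantVectorField_apply (v : E6) (g : Model s) :
    mulInvariantVectorField (I := 𝓡 6) (G := Model s) v g =
      (v + modelBilin s g.toE6 v : E6) := by
  have h : HasFDerivAt (fun y : E6 => g.toE6 + y + modelBilin s g.toE6 y)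
      (ContinuousLinearMap.id ℝ E6 + modelBilin s g.toE6) (1 : Model s).toE6 :=
    ((hasFDerivAt_id _).const_add _).add (modelBilin s g.toE6).hasFDerivAt
  have h1 : HasMFDerivAt (𝓡 6) (𝓡 6) (fun y : Model s => g * y) 1
      (ContinuousLinearMap.id ℝ E6 + modelBilin s g.toE6) := h.hasMFDerivAt
  exact DFunLike.congr_fun h1.mfderiv v

open VectorField in
theorem mlieBracket_eq_lieBracket_zero (V W : Π x : E6, TangentSpace 𝓘(ℝ, E6) x) :
    mlieBracket 𝓘(ℝ, E6) V W (0 : E6) = lieBracket ℝ V W (0 : E6) := by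
  rw [← mlieBracketWithin_univ, mlieBracketWithin_eq_lieBracketWithin]
  exact congrFun (lieBracketWithin_univ (𝕜 := ℝ) (V := (V : E6 → E6)) (W := (W : E6 → E6))) 0

open VectorField in
theorem lieBracket_add_modelBilin (v w : E6) :
    lieBracket ℝ (fun g : E6 => v + modelBilin s g v) (fun g : E6 => w + modelBilin s g w) 0 =
      modelBilin s v w - modelBilin s w v := by
  have h : ∀ v : E6, fderiv ℝ (fun g : E6 => v + modelBilin s g v) 0 = (modelBilin s).flip v :=
    fun v => (((modelBilin s).flip v).hasFDerivAt.const_add v).fderiv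
  rw [lieBracket, h, h]
  simp

open VectorField in
theorem mlieBracket_add_modelBilin (v w : E6) :
    (mlieBracket 𝓘(ℝ, E6) (fun g : E6 => (v + modelBilin s g v : E6))
      (fun g : E6 => (w + modelBilin s g w : E6)) (0 : E6) : E6) =
      modelBilin s v w - modelBilin s w v :=
  (mlieBracket_eq_lieBracket_zero _ _).trans (lieBracket_add_modelBilin v w)

open VectorField in
-- The left-invariant field of `v` is the affine field `g ↦ v + B(g, v)`. The bracket of two such
-- fields at the identity is the antisymmetrisation of `B`, which needs no factor `½`, so `B` can be
-- kept integral.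
theorem bracket_eq (v w : GroupLieAlgebra (𝓡 6) (Model s)) :
    (⁅v, w⁆ : GroupLieAlgebra (𝓡 6) (Model s)) =
      (modelBilin s v w - modelBilin s w v : E6) := by
  have h : ∀ v : E6, mulInvariantVectorField (I := 𝓡 6) (G := Model s) v =
      fun g : E6 => (v + modelBilin s g v : E6) :=
    fun v => funext fun g => mulInvariantVectorField_apply v g
  refine (congrArg₂ (fun V W => mlieBracket (𝓡 6) V W (1 : Model s)) (h v) (h w)).trans ?_
  exact mlieBracket_add_modelBilin (s := s) v w

theorem hasDiag : HasDiag (nilmanifold s).lieAlg fun i => s i := by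
  let b : Module.Basis (Fin 6) ℝ E6 := (EuclideanSpace.basisFun (Fin 6) ℝ).toBasis
  have h : ∀ x y : E6, modelBilin s x y - modelBilin s y x =
      (s 0 * (b.coord 1 x * b.coord 2 y - b.coord 2 x * b.coord 1 y)) • b 3 +
      (s 1 * (b.coord 2 x * b.coord 0 y - b.coord 0 x * b.coord 2 y)) • b 4 +
      (s 2 * (b.coord 0 x * b.coord 1 y - b.coord 1 x * b.coord 0 y)) • b 5 := by
    intro x y
    ext i
    simp only [modelBilin_apply, b]
    fin_cases i <;> simp <;> ring
  exact ⟨b, fun x y => (bracket_eq x y).trans (h x y)⟩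

end Model
end SHF

end

/-! ### A nilmanifold for each of the three algebras, and the theorem. -/

noncomputable section
namespace SHF

theorem HasDiag.nonempty_lieEquiv {L L' : Type*} [LieRing L] [LieAlgebra ℝ L] [LieRing L']
    [LieAlgebra ℝ L'] {s : Fin 3 → ℝ} (h : HasDiag L s) (h' : HasDiag L' s) :
    Nonempty (L ≃ₗ⁅ℝ⁆ L') := by
  obtain ⟨b, hb⟩ := h
  obtain ⟨b', hb'⟩ := h'
  let e : L ≃ₗ[ℝ] L' := b.equiv b' (Equiv.refl _)
  have he : ∀ i, e (b i) = b' i := fun i => by simp [e]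
  have hc : ∀ i x, b'.coord i (e x) = b.coord i x := fun i x =>
    LinearMap.congr_fun (f := b'.coord i ∘ₗ e.toLinearMap) (b.ext fun j => by
      simp [he, Finsupp.single_apply]) x
  refine ⟨{ e with map_lie' := fun {x y} => ?_ }⟩
  change e ⁅x, y⁆ = ⁅e x, e y⁆
  rw [hb, hb']
  simp only [map_add, map_smul, he, hc]

theorem Model.correspondsTo {𝔤 : Type*} [LieRing 𝔤] [LieAlgebra ℝ 𝔤] {s : Fin 3 → ℤ}
    (h : HasDiag 𝔤 fun i => s i) : (nilmanifold s).CorrespondsTo 𝔤 :=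
  HasDiag.nonempty_lieEquiv hasDiag h

theorem exists_correspondsTo {𝔤 : Type*} [LieRing 𝔤] [LieAlgebra ℝ 𝔤]
    (h : HasDiag 𝔤 0 ∨ HasDiag 𝔤 ![0, 1, -1] ∨ HasDiag 𝔤 ![1, 1, -2]) :
    ∃ N : Nilmanifold.{0}, N.CorrespondsTo 𝔤 := by
  obtain h | h | h := h
  · exact ⟨_, Model.correspondsTo (s := 0) (h.of_support fun i => by simp)⟩
  · exact ⟨_, Model.correspondsTo (s := ![0, 1, -1])
      (h.of_support fun i => by fin_cases i <;> simp)⟩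
  · exact ⟨_, Model.correspondsTo (s := ![1, 1, -2])
      (h.of_support fun i => by fin_cases i <;> simp)⟩

end SHF

end

theorem theorem2p3 (𝔤 : Type u) [LieRing 𝔤] [LieAlgebra ℝ 𝔤] [LieRing.IsNilpotent 𝔤]
    (hdim : Module.finrank ℝ 𝔤 = 6) :
    ((∃ N : SHF.Nilmanifold.{0}, N.CorrespondsTo 𝔤 ∧ N.CarriesInvariantSymplecticHalfFlat) ↔
      SHF.Is000000 𝔤 ∨ SHF.Is00001213 𝔤 ∨ SHF.Is000121323 𝔤) ∧
    ∀ N : SHF.Nilmanifold.{v}, N.CorrespondsTo 𝔤 →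
      (N.CarriesInvariantSymplecticHalfFlat ↔
        SHF.Is000000 𝔤 ∨ SHF.Is00001213 𝔤 ∨ SHF.Is000121323 𝔤) := by
  have := Module.finite_of_finrank_eq_succ hdim
  rw [SHF.is000000_iff, SHF.is00001213_iff, SHF.is000121323_iff]
  refine ⟨⟨fun ⟨N, hN, h⟩ => hN.carries_iff.1 h, fun h => ?_⟩, fun N hN => hN.carries_iff⟩
  -- Only existence is left: once some nilmanifold corresponds to `𝔤`, the criterion valid for every
  -- nilmanifold applies to it.
  obtain ⟨N, hN⟩ := SHF.exists_correspondsTo h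
  exact ⟨N, hN, hN.carries_iff.2 h⟩
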